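/- **Setting.** Fix $M>0$. For $L\ge 0$ and $r>2M$ put $\mu^0(r)=\frac12\ln(1-\frac{2M}r)$, $\lambda^0=-\mu^0$ and $\Psi^0_L(r)=e^{\mu^0(r)}\sqrt{1+L/r^2}$. For $L>12M^2$ let $s^0_L<r^0_L$ be the two zeros of $(\Psi^0_L)'$ on $]2M,\infty[$. Fix * $l>-\frac12$ and $\Phi\colon\mathbb R\to[0,\infty[$ in $L^\infty_{\mathrm{loc}}(\mathbb R)$ with $\Phi(\alpha)=0$ for $\alpha\le 0$ and $\Phi>0$ on some interval $]0,\alpha_0[$; * $L_0>12M^2$ and $E^0$ with $\Psi^0_{L_0}(r^0_{L_0})<E^0<\min\{1,\Psi^0_{L_0}(s^0_{L_0})\}$; put $r_0=s^0_{L_0}$, and let $r^0_-\in\,]s^0_{L_0},r^0_{L_0}[$ be the unique radius with $\Psi^0_{L_0}(r^0_-)=E^0$; * $\eta_0>0$ with $r_0+\eta_0<r^0_-$, and a non-negative $\chi\in C^\infty(\mathbb R)$ with $\chi(s)=0$ for $s\le 0$ and $\chi(s)=1$ for $s\ge\eta_0$. With $c_l=\int_0^1 s^l(1-s)^{-1/2}ds$,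 $d_l=\int_0^1 s^l(1-s)^{1/2}ds$ and $a(r,y)=1-e^{-y}\sqrt{1+L_0/r^2}$ let $$G(r,y)=2\pi c_l r^{2l}e^{3y}\int_0^{a(r,y)}\Phi(\alpha)(1-\alpha)^2\Big(e^{2y}(1-\alpha)^2-1-\tfrac{L_0}{r^2}\Big)^{l+\frac12}d\alpha,$$ $$H(r,y)=2\pi d_l r^{2l}e^{y}\int_0^{a(r,y)}\Phi(\alpha)\Big(e^{2y}(1-\alpha)^2-1-\tfrac{L_0}{r^2}\Big)^{l+\frac32}d\alpha$$ if $a(r,y)>0$, and $G(r,y)=H(r,y)=0$ otherwise. For $\delta>0$ let $y^\delta\in C^1(]2M,\infty[)$ be the solution of $$y'(r)=-\frac{1}{1-\frac2r(M+m^\delta(r))}\Big(\frac{M+m^\delta(r)}{r^2}+4\pi r\,p^\delta(r)\Big),\quad r>2M,\qquad y(4M)=\ln(\sqrt2\,E^0),$$ with $\rho^\delta(r)=\delta\chi(r-r_0)G(r,y(r))$, $p^\delta(r)=\delta\chi(r-r_0)H(r,y(r))$, $m^\delta(r)=4\pi\int_{2M}^r s^2\rho^\delta(s)\,ds$, and with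 no matter in $]2M,4M]$, i.e. $\rho^\delta=0$ there. Put $M^\delta=\lim_{r\to\infty}m^\delta(r)$, $E^\delta=\exp(\lim_{r\to\infty}y^\delta(r))$, $\mu^\delta=\ln E^\delta-y^\delta$, $\lambda^\delta(r)=-\frac12\ln\big(1-\frac2r(M+m^\delta(r))\big)$. The associated static shell is $$f^\delta(x,v)=\delta\,\chi(|x|-r_0)\,\Phi\big(1-E/E^\delta\big)\,(L-L_0)_+^l,\qquad E=e^{\mu^\delta(|x|)}\sqrt{1+|v|^2},\quad L=|x\times v|^2.$$ It has *single-well structure* if, with $\Psi^\delta_L(r)=e^{\mu^\delta(r)}\sqrt{1+L/r^2}$, for every $L>0$ with $L\ge L_0$ for which $I_L=\{r>2M : \Psi^\delta_L(r)<E^\delta,\ \rho^\delta(r)>0\}$ is non-empty there is exactly one $r_L\in I_L$ with $(\Psi^\delta_L)'(r_L)=0$. **Claim.** For all sufficiently small $\delta>0$ the function $y^\delta$ exists and is unique on $]2M,\infty[$, the limits defining $M^\delta$ and $E^\delta$ exist, and $\mu^\delta\in C^2(]2M,\infty[)$. As $\delta\to0$ (from above), $$\rho^\delta\to0,\qquad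 p^\delta\to0,\qquad \lambda^\delta\to\lambda^0\qquad\text{uniformly on }]2M,\infty[,\qquad M^\delta\to0,\qquad E^\delta\to E^0,$$ $$(\mu^\delta)^{(k)}\to(\mu^0)^{(k)}\quad\text{uniformly on }]2M,\infty[,\qquad k\in\{0,1,2\}.$$ Moreover, there is $\delta_0>0$ such that $f^\delta$ has single-well structure for every $0<\delta\le\delta_0$. -/

import Mathlib

open Filter Topology MeasureTheory Set
open scoped ContDiff

noncomputable section

namespace EinsteinVlasov

/-! ### The pure Schwarzschild case -/

/-- The metric coefficient `μ⁰` of the Schwarzschild solution of mass `M`. -/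
def muSS (M r : ℝ) : ℝ := 1 / 2 * Real.log (1 - 2 * M / r)

/-- The metric coefficient `λ⁰` of the Schwarzschild solution of mass `M`. -/
def lambdaSS (M r : ℝ) : ℝ := -(1 / 2) * Real.log (1 - 2 * M / r)

/-- The effective potential `Ψ_L⁰` of the Schwarzschild solution. -/
def psiSS (M L r : ℝ) : ℝ := √(1 - 2 * M / r) * √(1 + L / r ^ 2)

/-- The zeros of `(Ψ_L⁰)'` on `]2M, ∞[`; for `L > 12 M²` there are exactly two of them. -/
def critRadii (M L : ℝ) : Set ℝ := {r | 2 * M < r ∧ HasDerivAt (psiSS M L) 0 r}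

/-- `s_L⁰`, the smaller zero of `(Ψ_L⁰)'` (the local maximum of `Ψ_L⁰`). -/
def sSS (M L : ℝ) : ℝ := sInf (critRadii M L)

/-- `r_L⁰`, the larger zero of `(Ψ_L⁰)'` (the local minimum of `Ψ_L⁰`). -/
def rSS (M L : ℝ) : ℝ := sSup (critRadii M L)

/-- `r_-⁰(E, L)`, the radius in `]s_L⁰, r_L⁰[` at which `Ψ_L⁰` takes the value `E`; it is unique for
`L > 12 M²` and `Ψ_L⁰(r_L⁰) < E < min {1, Ψ_L⁰(s_L⁰)}`. -/
def rMinusSS (M E L : ℝ) : ℝ := sInf {r | sSS M L < r ∧ r < rSS M L ∧ psiSS M L r = E}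

/-! ### The choices of the construction -/

/-- The quantities that are fixed before the size `δ` of the shell varies. -/
structure ShellParams where
  /-- mass of the black hole -/
  M : ℝ
  /-- lower bound for the angular momentum -/
  L₀ : ℝ
  /-- cut-off energy `E⁰` of the pure Schwarzschild case -/
  E0 : ℝ
  /-- exponent in the angular momentum dependence -/
  l : ℝ
  /-- width of the transition region of the radial cut-off -/
  η₀ : ℝ
  /-- energy dependence of the microscopic equation of state -/
  Φ : ℝ → ℝ
  /-- radial cut-off function -/
  χ : ℝ → ℝ

namespace ShellParams

variable (P : ShellParams)

/-- `r₀ = s_{L₀}⁰`. -/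
def r₀ : ℝ := sSS P.M P.L₀

/-- The requirements on the fixed quantities. -/
structure Admissible : Prop where
  M_pos : 0 < P.M
  l_gt : -(1 / 2) < P.l
  Phi_nonneg : ∀ α, 0 ≤ P.Φ α
  /-- `Φ` is locally essentially bounded (and measurable). -/
  Phi_locBdd : ∀ K : Set ℝ, IsCompact K → MemLp P.Φ ⊤ (volume.restrict K)
  Phi_zero : ∀ α ≤ 0, P.Φ α = 0
  Phi_pos : ∃ α₀ > 0, ∀ α, 0 < α → α < α₀ → 0 < P.Φ α
  L₀_gt : 12 * P.M ^ 2 < P.L₀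
  E0_gt : psiSS P.M P.L₀ (rSS P.M P.L₀) < P.E0
  E0_lt : P.E0 < min 1 (psiSS P.M P.L₀ (sSS P.M P.L₀))
  η₀_pos : 0 < P.η₀
  η₀_small : P.r₀ + P.η₀ < rMinusSS P.M P.E0 P.L₀
  chi_smooth : ContDiff ℝ ∞ P.χ
  chi_nonneg : ∀ s, 0 ≤ P.χ s
  chi_zero : ∀ s ≤ 0, P.χ s = 0
  chi_one : ∀ s, P.η₀ ≤ s → P.χ s = 1

/-! ### Density, pressure and the reduced equation -/

/-- `c_l = ∫₀¹ s^l / √(1 - s) ds`. -/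
def cl : ℝ := ∫ s in (0 : ℝ)..1, s ^ P.l / √(1 - s)

/-- `d_l = ∫₀¹ s^l √(1 - s) ds`. -/
def dl : ℝ := ∫ s in (0 : ℝ)..1, s ^ P.l * √(1 - s)

open Classical in
/-- The function `G(r, y)` that gives the density. -/
def G (r y : ℝ) : ℝ :=
  if Real.exp (-y) * √(1 + P.L₀ / r ^ 2) < 1 then
    2 * Real.pi * P.cl * r ^ (2 * P.l) * Real.exp (3 * y) *
      ∫ α in (0 : ℝ)..(1 - Real.exp (-y) * √(1 + P.L₀ / r ^ 2)),
        P.Φ α * (1 - α) ^ 2 *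
          (Real.exp (2 * y) * (1 - α) ^ 2 - 1 - P.L₀ / r ^ 2) ^ (P.l + 1 / 2)
  else 0

open Classical in
/-- The function `H(r, y)` that gives the pressure. -/
def H (r y : ℝ) : ℝ :=
  if Real.exp (-y) * √(1 + P.L₀ / r ^ 2) < 1 then
    2 * Real.pi * P.dl * r ^ (2 * P.l) * Real.exp y *
      ∫ α in (0 : ℝ)..(1 - Real.exp (-y) * √(1 + P.L₀ / r ^ 2)),
        P.Φ α * (Real.exp (2 * y) * (1 - α) ^ 2 - 1 - P.L₀ / r ^ 2) ^ (P.l + 3 / 2)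
  else 0

/-- The Vlasov density `ρ^δ` that belongs to `y`. -/
def rho (δ : ℝ) (y : ℝ → ℝ) (r : ℝ) : ℝ := δ * P.χ (r - P.r₀) * P.G r (y r)

/-- The Vlasov pressure `p^δ` that belongs to `y`. -/
def pressure (δ : ℝ) (y : ℝ → ℝ) (r : ℝ) : ℝ := δ * P.χ (r - P.r₀) * P.H r (y r)

/-- The local Vlasov mass `m^δ(r) = 4π ∫_{2M}^r s² ρ^δ(s) ds`. -/
def localMass (δ : ℝ) (y : ℝ → ℝ) (r : ℝ) : ℝ :=
  4 * Real.pi * ∫ s in (2 * P.M)..r, s ^ 2 * P.rho δ y s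

/-- `y` is the function `y^δ` on `]2M, ∞[`: a `C¹` solution of the reduced integro-differential
equation with `y(4M) = ln(√2 E⁰)` and no matter in `]2M, 4M]`, so that the local mass, which also
enters the equation, starts with the value `0` at `r = 4M`. -/
structure IsShell (δ : ℝ) (y : ℝ → ℝ) : Prop where
  contDiffOn : ContDiffOn ℝ 1 y (Ioi (2 * P.M))
  denom_ne_zero : ∀ r, 2 * P.M < r → 1 - 2 / r * (P.M + P.localMass δ y r) ≠ 0
  equation : ∀ r, 2 * P.M < r →
    HasDerivAt y
      (-(1 / (1 - 2 / r * (P.M + P.localMass δ y r)) *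
        ((P.M + P.localMass δ y r) / r ^ 2 + 4 * Real.pi * r * P.pressure δ y r))) r
  initial : y (4 * P.M) = Real.log (√2 * P.E0)
  vacuum : ∀ r, 2 * P.M < r → r ≤ 4 * P.M → P.rho δ y r = 0

/-- The total Vlasov mass `M^δ`. -/
def totalMass (δ : ℝ) (y : ℝ → ℝ) : ℝ := limUnder atTop (P.localMass δ y)

/-- The metric coefficient `λ^δ`. -/
def lambda (δ : ℝ) (y : ℝ → ℝ) (r : ℝ) : ℝ :=
  -(1 / 2) * Real.log (1 - 2 / r * (P.M + P.localMass δ y r))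

end ShellParams

/-- The cut-off energy `E^δ = exp (lim_{r → ∞} y(r))`. -/
def cutoffEnergy (y : ℝ → ℝ) : ℝ := Real.exp (limUnder atTop y)

/-- The metric coefficient `μ^δ = ln E^δ - y`. -/
def mu (y : ℝ → ℝ) (r : ℝ) : ℝ := Real.log (cutoffEnergy y) - y r

/-! ### Steady states and single-well structure -/

/-- Position and momentum space. -/
abbrev R3 : Type := EuclideanSpace ℝ (Fin 3)

/-- The particle energy `E(x, v) = e^{μ(|x|)} √(1 + |v|²)`. -/
def particleEnergy (μ : ℝ → ℝ) (x v : R3) : ℝ := Real.exp (μ ‖x‖) * √(1 + ‖v‖ ^ 2)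

/-- The angular momentum `L(x, v) = |x × v|²`. -/
def angularMomentum (x v : R3) : ℝ := ‖WithLp.toLp 2 (crossProduct x.ofLp v.ofLp)‖ ^ 2

/-- The data of a spherically symmetric steady state around a central black hole that enter the
single-well structure. -/
structure SteadyState where
  /-- the phase space density -/
  f : R3 → R3 → ℝ
  /-- the Schwarzschild radius: only radii above it belong to the spacetime -/
  horizon : ℝ
  /-- the cut-off energy -/
  E₀ : ℝ
  /-- the lower bound for the angular momentum -/
  L₀ : ℝ
  /-- the metric coefficient `μ` -/
  μ : ℝ → ℝ
  /-- the density -/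
  ρ : ℝ → ℝ

namespace SteadyState

/-- The effective potential `Ψ_L(r) = e^{μ(r)} √(1 + L / r²)`. -/
def effPot (S : SteadyState) (L r : ℝ) : ℝ := Real.exp (S.μ r) * √(1 + L / r ^ 2)

/-- `I_L = {Ψ_L < E₀} ∩ {ρ > 0}`. -/
def wellSet (S : SteadyState) (L : ℝ) : Set ℝ :=
  {r | S.horizon < r ∧ S.effPot L r < S.E₀ ∧ 0 < S.ρ r}

/-- Single-well structure. -/
def HasSingleWell (S : SteadyState) : Prop :=
  ∀ L : ℝ, 0 < L → S.L₀ ≤ L → (S.wellSet L).Nonempty →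
    ∃! r, r ∈ S.wellSet L ∧ HasDerivAt (S.effPot L) 0 r

end SteadyState

open Classical in
/-- The microscopic equation of state `φ(E, L) = Φ(1 - E / E_c) (L - L₀)₊^l` with cut-off energy
`E_c`. -/
def ShellParams.eos (P : ShellParams) (Ec E L : ℝ) : ℝ :=
  P.Φ (1 - E / Ec) * (if P.L₀ < L then (L - P.L₀) ^ P.l else 0)

/-- The static shell `f^δ(x, v) = δ χ(|x| - r₀) φ(E, L)` given by the solution `y` of the reduced
equation, with its cut-off energy, metric coefficient and density. -/
def ShellParams.shell (P : ShellParams) (δ : ℝ) (y : ℝ → ℝ) : SteadyState where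
  f := fun x v => δ * P.χ (‖x‖ - P.r₀) *
    P.eos (cutoffEnergy y) (particleEnergy (mu y) x v) (angularMomentum x v)
  horizon := 2 * P.M
  E₀ := cutoffEnergy y
  L₀ := P.L₀
  μ := mu y
  ρ := P.rho δ y

end EinsteinVlasov

end

/-!
Write `F = -y'`. With `A = M + m`, `N = 4 π r³ p` the reduced equation reads
`F = (A + N) / (r (r - 2 A))`, and in the absence of matter it is solved by `ySS = ln E⁰ - μ⁰`, for
which `F = M / (r (r - 2 M))`.

*Matter functions.* Density and pressure depend on `y` through the ratio
`b = e^{-2y} (1 + L₀ / r²)`: up to explicit factors they are `∫₀¹ φ(α) ((1 - α)² - b)₊ ^ p dα` with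
`p > 0` for the density and `p > 1` for the pressure (`Admissible.G_eq`, `Admissible.H_eq`). The
second is `C¹` in `b`. The first is still Lipschitz continuous, although its integrand need not be
(`abs_profile_sub_le`). Both vanish exactly for `b ≥ 1`.

*Confinement.* Matter only makes `y` decrease faster, hence `y ≤ ySS` for every shell. Since `Ψ_{L₀}⁰`
exceeds `E⁰` on `[r₀, r₀ + η₀]`, and on `[r₀, 4M]` if `r₀ < 4M`, matter of a function below `ySS`
lives in the fixed compact interval `[4M, 2M / (1 - (E⁰)²)]`, and beyond `r₀ + η₀`. There everything
is bounded, so that matter is of size `δ`.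

*Existence and uniqueness.* The integrated equation is a fixed point equation on
`C([4M, 2M / (1 - (E⁰)²)])`. The unknown enters its right-hand side only through the matter terms,
which carry a factor `δ`, so that it is a contraction for small `δ` (`Admissible.exists_contracting`).

*Convergence.* `F` differs from its Schwarzschild value by at most `C δ / r²`, which is integrable at
infinity and controls `y`, its limit, and `μ'`. For `μ''` one uses that the derivatives of `m` and
`N` are of size `δ` as well, and that `F'` is a continuous function of these quantities and `1 / r`
on a compact box.

*Single well.* A radius is critical for `Ψ_L` if and only if `F = L / (r (r² + L))`. The minimum of
`Ψ_L` over the matter region is attained inside, which gives a critical radius in the well. At any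
critical radius in the well `F ≥ L₀ / (r (r² + L₀))`. In the Schwarzschild case this fails on
`]s_{L₀}, r_{L₀}[`, an interval that contains `6M`, so for small `δ` these radii exceed some fixed
`ρ₁ > 6M`. Solving for `L` gives `L = r³ F / (1 - r F)`; the sign of the derivative of the right-hand
side is that of `3 F + r F' - 2 r F²`, which equals `M (r - 6M) / (r (r - 2M)²)` in the Schwarzschild
case. So for small `δ` the right-hand side is strictly increasing on the matter region beyond `ρ₁`,
and there is only one critical radius, whatever `L ≥ L₀` is.
-/

noncomputable section

namespace EinsteinVlasov

/-! ### Profile functions -/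

/-- The power `u₊ ^ p` of the positive part. -/
def posPow (p u : ℝ) : ℝ := max u 0 ^ p

theorem posPow_nonneg (p u : ℝ) : 0 ≤ posPow p u := Real.rpow_nonneg (le_max_right _ _) _

theorem posPow_of_nonpos {p u : ℝ} (hp : 0 < p) (hu : u ≤ 0) : posPow p u = 0 := by
  rw [posPow, max_eq_right hu, Real.zero_rpow hp.ne']

theorem posPow_of_nonneg {p u : ℝ} (hu : 0 ≤ u) : posPow p u = u ^ p := by
  rw [posPow, max_eq_left hu]

theorem posPow_pos {p u : ℝ} (hu : 0 < u) : 0 < posPow p u := by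
  rw [posPow_of_nonneg hu.le]; exact Real.rpow_pos_of_pos hu p

theorem posPow_mono {p u v : ℝ} (hp : 0 ≤ p) (h : u ≤ v) : posPow p u ≤ posPow p v :=
  Real.rpow_le_rpow (le_max_right _ _) (max_le_max_right 0 h) hp

theorem posPow_le_one {p u : ℝ} (hp : 0 ≤ p) (h : u ≤ 1) : posPow p u ≤ 1 :=
  Real.rpow_le_one (le_max_right _ _) (max_le h zero_le_one) hp

theorem continuous_posPow {p : ℝ} (hp : 0 ≤ p) : Continuous (posPow p) :=
  (continuous_id.max continuous_const).rpow_const fun _ => Or.inr hp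

theorem hasDerivAt_posPow {p : ℝ} (hp : 1 < p) (u : ℝ) :
    HasDerivAt (posPow p) (p * posPow (p - 1) u) u := by
  have key : ∀ v : ℝ, v ≠ 0 → HasDerivAt (posPow p) (p * posPow (p - 1) v) v := by
    intro v hv
    rcases lt_or_gt_of_ne hv with h | h
    · rw [posPow_of_nonpos (by linarith) h.le, mul_zero]
      refine (hasDerivAt_const v (0 : ℝ)).congr_of_eventuallyEq ?_
      filter_upwards [Iio_mem_nhds h] with w hw
      exact posPow_of_nonpos (by linarith) (le_of_lt hw)
    · rw [posPow_of_nonneg h.le]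
      refine (Real.hasDerivAt_rpow_const (Or.inl h.ne')).congr_of_eventuallyEq ?_
      filter_upwards [Ioi_mem_nhds h] with w hw
      exact posPow_of_nonneg (le_of_lt hw)
  by_cases hu : u = 0
  · subst hu
    exact hasDerivAt_of_hasDerivAt_of_ne key
      (continuous_posPow (by linarith)).continuousAt
      (continuous_const.mul (continuous_posPow (p := p - 1) (by linarith))).continuousAt
  · exact key u hu

/-- The dependence of density and pressure on `b = e^{-2y} (1 + L₀ / r²)`. -/
def profile (φ : ℝ → ℝ) (p b : ℝ) : ℝ := ∫ α in (0 : ℝ)..1, φ α * posPow p ((1 - α) ^ 2 - b)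

section profile

variable {φ : ℝ → ℝ} {p b B : ℝ}

theorem intervalIntegrable_profile (hφ : IntervalIntegrable φ volume 0 1) (hp : 0 ≤ p) (b : ℝ) :
    IntervalIntegrable (fun α => φ α * posPow p ((1 - α) ^ 2 - b)) volume 0 1 :=
  hφ.mul_continuousOn ((continuous_posPow hp).comp (by fun_prop)).continuousOn

theorem profile_nonneg (hφ : ∀ α, 0 ≤ φ α) : 0 ≤ profile φ p b :=
  intervalIntegral.integral_nonneg zero_le_one fun α _ => mul_nonneg (hφ α) (posPow_nonneg _ _)

theorem profile_eq_zero (hp : 0 < p) (hb : 1 ≤ b) : profile φ p b = 0 := by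
  rw [profile, intervalIntegral.integral_congr (g := fun _ => 0)]
  · simp
  · intro α hα
    rw [uIcc_of_le zero_le_one] at hα
    have : (1 - α) ^ 2 ≤ 1 := by nlinarith [hα.1, hα.2]
    simp only
    rw [posPow_of_nonpos hp (by linarith), mul_zero]

theorem profile_pos (hφ : ∀ α, 0 ≤ φ α) (hint : IntervalIntegrable φ volume 0 1) (hp : 0 ≤ p)
    {α₀ : ℝ} (hα₀ : 0 < α₀) (hpos : ∀ α, 0 < α → α < α₀ → 0 < φ α) (hb : b < 1) :
    0 < profile φ p b := by
  obtain ⟨c, hc0, hc1, hc2, hcb⟩ : ∃ c : ℝ, 0 < c ∧ c ≤ 1 ∧ c ≤ α₀ ∧ 2 * c ≤ 1 - b := by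
    refine ⟨min (min 1 α₀) ((1 - b) / 2), ?_, ?_, ?_, ?_⟩
    · exact lt_min (lt_min one_pos hα₀) (by linarith)
    · exact (min_le_left _ _).trans (min_le_left _ _)
    · exact (min_le_left _ _).trans (min_le_right _ _)
    · linarith [min_le_right (min 1 α₀) ((1 - b) / 2)]
  have hI := intervalIntegrable_profile (p := p) hint hp b
  have h1 : 0 < ∫ α in (0 : ℝ)..c, φ α * posPow p ((1 - α) ^ 2 - b) := by
    refine intervalIntegral.intervalIntegral_pos_of_pos_on
      (hI.mono_set ?_) (fun x hx => ?_) hc0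
    · rw [uIcc_of_le hc0.le, uIcc_of_le zero_le_one]; exact Icc_subset_Icc_right hc1
    · exact mul_pos (hpos x hx.1 (hx.2.trans_le hc2))
        (posPow_pos (by nlinarith [hx.1, hx.2, sq_nonneg x]))
  refine h1.trans_le (intervalIntegral.integral_mono_interval le_rfl hc0.le hc1 ?_ hI)
  exact Eventually.of_forall fun α => mul_nonneg (hφ α) (posPow_nonneg _ _)

theorem continuous_profile (hφ : IntervalIntegrable φ volume 0 1) (hp : 0 ≤ p) :
    Continuous (profile φ p) := by
  refine continuous_iff_continuousAt.2 fun b => ?_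
  refine intervalIntegral.continuousAt_of_dominated_interval
    (bound := fun α => |φ α| * (2 + |b|) ^ p) ?_ ?_ ?_ ?_
  · exact Eventually.of_forall fun x =>
      (intervalIntegrable_profile hφ hp x).def'.aestronglyMeasurable
  · filter_upwards [Metric.ball_mem_nhds b one_pos] with x hx
    refine Eventually.of_forall fun α hα => ?_
    rw [uIoc_of_le zero_le_one] at hα
    rw [norm_mul, Real.norm_eq_abs, Real.norm_of_nonneg (posPow_nonneg _ _)]
    refine mul_le_mul_of_nonneg_left (Real.rpow_le_rpow (le_max_right _ _) ?_ hp) (abs_nonneg _)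
    rw [Metric.mem_ball, Real.dist_eq] at hx
    have := abs_lt.1 hx
    refine max_le ?_ (by positivity)
    nlinarith [hα.1, hα.2, neg_abs_le b]
  · exact hφ.abs.mul_const _
  · refine Eventually.of_forall fun α _ => ?_
    exact (continuous_const.mul ((continuous_posPow hp).comp (by fun_prop))).continuousAt

theorem hasDerivAt_profile (hφ : IntervalIntegrable φ volume 0 1) (hp : 1 < p) (b : ℝ) :
    HasDerivAt (profile φ p) (-(p * profile φ (p - 1) b)) b := by
  have h0 : 0 ≤ p - 1 := by linarith
  have := (intervalIntegral.hasDerivAt_integral_of_dominated_loc_of_deriv_le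
    (F := fun b α => φ α * posPow p ((1 - α) ^ 2 - b))
    (F' := fun b α => φ α * -(p * posPow (p - 1) ((1 - α) ^ 2 - b)))
    (bound := fun α => |φ α| * (p * (2 + |b|) ^ (p - 1))) (μ := volume) (a := 0) (b := 1)
    (Metric.ball_mem_nhds b one_pos) ?_ ?_ ?_ ?_ ?_ ?_).2
  · convert! this using 1
    rw [profile, ← intervalIntegral.integral_const_mul, ← intervalIntegral.integral_neg]
    congr 1; ext α; ring
  · exact Eventually.of_forall fun x =>
      (intervalIntegrable_profile hφ (by linarith) x).def'.aestronglyMeasurable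
  · exact intervalIntegrable_profile hφ (by linarith) b
  · have : IntervalIntegrable (fun α => φ α * -(p * posPow (p - 1) ((1 - α) ^ 2 - b)))
        volume 0 1 :=
      hφ.mul_continuousOn
        ((continuous_const.mul ((continuous_posPow h0).comp (by fun_prop))).neg).continuousOn
    exact this.def'.aestronglyMeasurable
  · refine Eventually.of_forall fun α hα x hx => ?_
    rw [uIoc_of_le zero_le_one] at hα
    rw [norm_mul, norm_neg, norm_mul, Real.norm_eq_abs, Real.norm_of_nonneg (posPow_nonneg _ _),
      Real.norm_of_nonneg (by linarith : 0 ≤ p)]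
    refine mul_le_mul_of_nonneg_left (mul_le_mul_of_nonneg_left
      (Real.rpow_le_rpow (le_max_right _ _) ?_ h0) (by linarith)) (abs_nonneg _)
    rw [Metric.mem_ball, Real.dist_eq] at hx
    have := abs_lt.1 hx
    refine max_le ?_ (by positivity)
    nlinarith [hα.1, hα.2, neg_abs_le b]
  · exact hφ.abs.mul_const _
  · refine Eventually.of_forall fun α _ x _ => ?_
    have h1 : HasDerivAt (fun x : ℝ => (1 - α) ^ 2 - x) (-1) x := by
      simpa using (hasDerivAt_id x).const_sub ((1 - α) ^ 2)
    have := (((hasDerivAt_posPow hp _).comp x h1).const_mul (φ α))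
    convert! this using 1
    ring

theorem contDiff_profile (hφ : IntervalIntegrable φ volume 0 1) (hp : 1 < p) :
    ContDiff ℝ 1 (profile φ p) := by
  rw [contDiff_one_iff_deriv]
  refine ⟨fun b => (hasDerivAt_profile hφ hp b).differentiableAt, ?_⟩
  have : deriv (profile φ p) = fun b => -(p * profile φ (p - 1) b) :=
    funext fun b => (hasDerivAt_profile hφ hp b).deriv
  rw [this]
  exact (continuous_const.mul (continuous_profile hφ (by linarith))).neg

theorem abs_profile_le (hp : 0 ≤ p)
    (hB : ∀ᵐ α, α ∈ uIoc (0 : ℝ) 1 → |φ α| ≤ B) (hb : 0 ≤ b) : |profile φ p b| ≤ B := by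
  have := intervalIntegral.norm_integral_le_of_norm_le_const_ae
    (f := fun α => φ α * posPow p ((1 - α) ^ 2 - b)) (a := 0) (b := 1) (C := B) ?_
  · simpa [profile] using this
  · filter_upwards [hB] with α h hα
    have h1 := h hα
    rw [uIoc_of_le zero_le_one] at hα
    rw [norm_mul, Real.norm_eq_abs, Real.norm_of_nonneg (posPow_nonneg _ _)]
    have h2 : posPow p ((1 - α) ^ 2 - b) ≤ 1 := posPow_le_one hp (by nlinarith [hα.1, hα.2])
    nlinarith [abs_nonneg (φ α), posPow_nonneg p ((1 - α) ^ 2 - b)]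

theorem abs_profile_sub_le_of_one_lt (hφ : IntervalIntegrable φ volume 0 1) (hp : 1 < p)
    (hB : ∀ᵐ α, α ∈ uIoc (0 : ℝ) 1 → |φ α| ≤ B) {b c : ℝ} (hb : 0 ≤ b) (hc : 0 ≤ c) :
    |profile φ p b - profile φ p c| ≤ p * B * |b - c| := by
  refine (convex_Ici (0 : ℝ)).norm_image_sub_le_of_norm_hasDerivWithin_le
    (f := profile φ p) (fun x _ => (hasDerivAt_profile hφ hp x).hasDerivWithinAt) ?_ hc hb
  intro x hx
  rw [norm_neg, norm_mul, Real.norm_of_nonneg (by linarith : 0 ≤ p)]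
  exact mul_le_mul_of_nonneg_left (abs_profile_le (by linarith) hB hx) (by linarith)

/-- The weight `1 - α` is, up to a constant, the derivative of `(1 - α)² - b`. -/
theorem integral_weight_posPow (hp : 0 < p) (hb : 0 ≤ b) :
    ∫ α in (0 : ℝ)..1, (1 - α) * posPow p ((1 - α) ^ 2 - b) =
      posPow (p + 1) (1 - b) / (2 * (p + 1)) := by
  have hd : ∀ x ∈ uIcc (0 : ℝ) 1,
      HasDerivAt (fun α : ℝ => -(posPow (p + 1) ((1 - α) ^ 2 - b) / (2 * (p + 1))))
        ((1 - x) * posPow p ((1 - x) ^ 2 - b)) x := by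
    intro x _
    have h1 : HasDerivAt (fun α : ℝ => (1 - α) ^ 2 - b) (2 * (1 - x) * (-1)) x := by
      have := (((hasDerivAt_id x).const_sub 1).pow 2).sub_const b
      convert! this using 1
      simp
    have h2 := (((hasDerivAt_posPow (p := p + 1) (by linarith) _).comp x h1).div_const
      (2 * (p + 1))).neg
    convert! h2 using 1
    rw [add_sub_cancel_right]
    field_simp
  rw [intervalIntegral.integral_eq_sub_of_hasDerivAt hd]
  · rw [posPow_of_nonpos (by linarith : 0 < p + 1) (by linarith : (1 - (1 : ℝ)) ^ 2 - b ≤ 0)]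
    norm_num
  · exact Continuous.intervalIntegrable
      ((by fun_prop : Continuous fun α : ℝ => 1 - α).mul
        ((continuous_posPow hp.le).comp (by fun_prop))) _ _

/-- If the weight vanishes linearly at `α = 1`, the profile is Lipschitz continuous for every
positive exponent, also for `p < 1` where the integrand is only Hölder continuous in `b`:
the integrand is monotone in `b`, and after replacing the weight by `1 - α` the integral is
elementary. -/
theorem abs_profile_sub_le (hφ : IntervalIntegrable φ volume 0 1) (hp : 0 < p)
    (hB : ∀ᵐ α, α ∈ uIoc (0 : ℝ) 1 → |φ α| ≤ B * (1 - α)) (hB0 : 0 ≤ B) {b c : ℝ}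
    (hb : 0 ≤ b) (hc : 0 ≤ c) :
    |profile φ p b - profile φ p c| ≤ B * |b - c| := by
  wlog hbc : b ≤ c generalizing b c
  · rw [abs_sub_comm, abs_sub_comm b c]
    exact this hc hb (le_of_not_ge hbc)
  have hI1 := intervalIntegrable_profile hφ hp.le b
  have hI2 := intervalIntegrable_profile hφ hp.le c
  have hJ : ∀ d : ℝ, IntervalIntegrable (fun α : ℝ => (1 - α) * posPow p ((1 - α) ^ 2 - d))
      volume 0 1 := fun d => Continuous.intervalIntegrable
      ((by fun_prop : Continuous fun α : ℝ => 1 - α).mul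
        ((continuous_posPow hp.le).comp (by fun_prop))) _ _
  have h1 : |profile φ p b - profile φ p c| ≤
      ∫ α in (0 : ℝ)..1, B * ((1 - α) * posPow p ((1 - α) ^ 2 - b) -
        (1 - α) * posPow p ((1 - α) ^ 2 - c)) := by
    rw [profile, profile, ← intervalIntegral.integral_sub hI1 hI2, ← Real.norm_eq_abs]
    refine intervalIntegral.norm_integral_le_of_norm_le zero_le_one ?_
      (((hJ b).sub (hJ c)).const_mul B)
    filter_upwards [hB] with α h hα
    have h := h (by rwa [uIoc_of_le zero_le_one])
    have hm : posPow p ((1 - α) ^ 2 - c) ≤ posPow p ((1 - α) ^ 2 - b) :=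
      posPow_mono hp.le (by linarith)
    rw [← mul_sub, ← mul_sub, norm_mul, Real.norm_of_nonneg (sub_nonneg.2 hm), ← mul_assoc]
    exact mul_le_mul_of_nonneg_right h (sub_nonneg.2 hm)
  refine h1.trans ?_
  rw [intervalIntegral.integral_const_mul]
  refine mul_le_mul_of_nonneg_left ?_ hB0
  rw [intervalIntegral.integral_sub (hJ b) (hJ c), integral_weight_posPow hp hb,
    integral_weight_posPow hp hc, ← sub_div, div_le_iff₀ (by linarith)]
  have h2 := (convex_Iic (1 : ℝ)).norm_image_sub_le_of_norm_hasDerivWithin_le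
    (f := posPow (p + 1)) (C := p + 1) (x := 1 - c) (y := 1 - b)
    (fun x _ => (hasDerivAt_posPow (by linarith) x).hasDerivWithinAt) ?_
    (by simpa using hc) (by simpa using hb)
  · have h3 := (abs_le.1 h2).2
    rw [show ‖1 - b - (1 - c)‖ = |b - c| by rw [Real.norm_eq_abs, abs_sub_comm]; congr 1; ring]
      at h3
    nlinarith [abs_nonneg (b - c)]
  · intro x hx
    rw [add_sub_cancel_right, norm_mul, Real.norm_of_nonneg (posPow_nonneg _ _),
      Real.norm_of_nonneg (by linarith)]
    exact mul_le_of_le_one_right (by linarith) (posPow_le_one hp.le hx)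

end profile

/-! ### Density and pressure as functions of the radius and `y` -/

/-- The quotient `(Ψ_L / E)² = e^{-2y} (1 + L / r²)`, whose value `1` marks the boundary of the
region with matter of angular momentum `L`. -/
def energyRatio (L r y : ℝ) : ℝ := Real.exp (-2 * y) * (1 + L / r ^ 2)

theorem energyRatio_pos {L r : ℝ} (hL : 0 ≤ L) (y : ℝ) : 0 < energyRatio L r y := by
  unfold energyRatio; positivity

theorem energyRatio_eq_sq {L r : ℝ} (hL : 0 ≤ L) (y : ℝ) :
    energyRatio L r y = (Real.exp (-y) * √(1 + L / r ^ 2)) ^ 2 := by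
  rw [mul_pow, Real.sq_sqrt (by positivity), energyRatio, ← Real.exp_nat_mul]
  congr 2; push_cast; ring

theorem energyRatio_lt_one_iff {L r : ℝ} (hL : 0 ≤ L) (y : ℝ) :
    energyRatio L r y < 1 ↔ Real.exp (-y) * √(1 + L / r ^ 2) < 1 := by
  rw [energyRatio_eq_sq hL, sq_lt_one_iff₀ (by positivity)]

theorem one_le_energyRatio_of_nonpos {L r y : ℝ} (hL : 0 ≤ L) (hy : y ≤ 0) :
    1 ≤ energyRatio L r y := by
  have h1 : 1 ≤ Real.exp (-2 * y) := Real.one_le_exp (by linarith)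
  have h2 : 0 ≤ L / r ^ 2 := by positivity
  unfold energyRatio; nlinarith

theorem integral_eq_profile {φ : ℝ → ℝ} {p L r y : ℝ} (hφ : IntervalIntegrable φ volume 0 1)
    (hp : 0 < p) (hL : 0 ≤ L) (h : Real.exp (-y) * √(1 + L / r ^ 2) < 1) :
    ∫ α in (0 : ℝ)..(1 - Real.exp (-y) * √(1 + L / r ^ 2)),
        φ α * (Real.exp (2 * y) * (1 - α) ^ 2 - 1 - L / r ^ 2) ^ p =
      Real.exp (2 * p * y) * profile φ p (energyRatio L r y) := by
  set s := Real.exp (-y) * √(1 + L / r ^ 2) with hs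
  have hs0 : 0 ≤ s := by positivity
  have hb : energyRatio L r y = s ^ 2 := energyRatio_eq_sq hL y
  have hI := intervalIntegrable_profile hφ hp.le (energyRatio L r y)
  have h01 : (0 : ℝ) ≤ 1 - s := by linarith
  have hI1 : IntervalIntegrable (fun α => φ α * posPow p ((1 - α) ^ 2 - energyRatio L r y))
      volume 0 (1 - s) := hI.mono_set (by
        rw [uIcc_of_le h01, uIcc_of_le zero_le_one]; exact Icc_subset_Icc_right (by linarith))
  have hI2 : IntervalIntegrable (fun α => φ α * posPow p ((1 - α) ^ 2 - energyRatio L r y))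
      volume (1 - s) 1 := hI.mono_set (by
        rw [uIcc_of_le (by linarith), uIcc_of_le zero_le_one]; exact Icc_subset_Icc_left h01)
  have hzero : ∫ α in (1 - s)..1, φ α * posPow p ((1 - α) ^ 2 - energyRatio L r y) = 0 := by
    rw [intervalIntegral.integral_congr (g := fun _ => 0)]
    · simp
    · intro α hα
      rw [uIcc_of_le (by linarith)] at hα
      simp only
      rw [posPow_of_nonpos hp (by rw [hb]; nlinarith [hα.1, hα.2]), mul_zero]
  rw [profile, ← intervalIntegral.integral_add_adjacent_intervals hI1 hI2, hzero, add_zero,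
    ← intervalIntegral.integral_const_mul]
  refine intervalIntegral.integral_congr fun α hα => ?_
  rw [uIcc_of_le h01] at hα
  have h3 : 0 ≤ (1 - α) ^ 2 - energyRatio L r y := by rw [hb]; nlinarith [hα.1, hα.2]
  have h4 : Real.exp (2 * y) * (1 - α) ^ 2 - 1 - L / r ^ 2 =
      Real.exp (2 * y) * ((1 - α) ^ 2 - energyRatio L r y) := by
    have : Real.exp (2 * y) * Real.exp (-2 * y) = 1 := by rw [← Real.exp_add]; simp
    unfold energyRatio
    linear_combination (1 + L / r ^ 2) * this
  rw [h4, Real.mul_rpow (Real.exp_pos _).le h3, posPow_of_nonneg h3, ← Real.exp_mul]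
  rw [show 2 * y * p = 2 * p * y by ring]
  ring

namespace ShellParams

variable {P : ShellParams}

theorem Admissible.L₀_pos (hP : P.Admissible) : 0 < P.L₀ := by
  have := hP.L₀_gt; nlinarith [hP.M_pos]

theorem Admissible.exists_bound (hP : P.Admissible) :
    IntervalIntegrable P.Φ volume 0 1 ∧
      ∃ B, 0 ≤ B ∧ ∀ᵐ α, α ∈ uIoc (0 : ℝ) 1 → |P.Φ α| ≤ B := by
  have h := hP.Phi_locBdd (Icc 0 1) isCompact_Icc
  constructor
  · rw [intervalIntegrable_iff, uIoc_of_le zero_le_one]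
    have : IntegrableOn P.Φ (Icc 0 1) volume := h.integrable le_top
    exact this.mono_set Ioc_subset_Icc_self
  · refine ⟨(eLpNorm P.Φ ⊤ (volume.restrict (Icc 0 1))).toReal, ENNReal.toReal_nonneg, ?_⟩
    have h1 := ae_le_eLpNormEssSup (f := P.Φ) (μ := volume.restrict (Icc (0 : ℝ) 1))
    rw [ae_restrict_iff' measurableSet_Icc] at h1
    filter_upwards [h1] with α hα hm
    rw [uIoc_of_le zero_le_one] at hm
    have h2 := hα (Ioc_subset_Icc_self hm)
    rw [← eLpNorm_exponent_top] at h2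
    have h3 := ENNReal.toReal_mono h.2.ne h2
    simpa using h3

variable (P) in
/-- The factor `Φ(α) (1 - α)²` of the integrand in the density. -/
def densityWeight (α : ℝ) : ℝ := P.Φ α * (1 - α) ^ 2

theorem Admissible.densityWeight_nonneg (hP : P.Admissible) (α : ℝ) : 0 ≤ P.densityWeight α :=
  mul_nonneg (hP.Phi_nonneg α) (sq_nonneg _)

theorem Admissible.intervalIntegrable_densityWeight (hP : P.Admissible) :
    IntervalIntegrable P.densityWeight volume 0 1 :=
  hP.exists_bound.1.mul_continuousOn
    (by fun_prop : Continuous fun α : ℝ => (1 - α) ^ 2).continuousOn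

theorem Admissible.G_eq (hP : P.Admissible) (r y : ℝ) :
    P.G r y = 2 * Real.pi * P.cl * r ^ (2 * P.l) * (Real.exp ((2 * P.l + 4) * y) *
      profile P.densityWeight (P.l + 1 / 2) (energyRatio P.L₀ r y)) := by
  have hp : 0 < P.l + 1 / 2 := by linarith [hP.l_gt]
  unfold G
  split_ifs with h
  · have := integral_eq_profile hP.intervalIntegrable_densityWeight hp hP.L₀_pos.le h
    unfold densityWeight at this ⊢
    rw [this, show (2 * P.l + 4) * y = 3 * y + 2 * (P.l + 1 / 2) * y by ring, Real.exp_add]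
    ring
  · rw [← energyRatio_lt_one_iff hP.L₀_pos.le, not_lt] at h
    rw [profile_eq_zero hp h]; simp

theorem Admissible.H_eq (hP : P.Admissible) (r y : ℝ) :
    P.H r y = 2 * Real.pi * P.dl * r ^ (2 * P.l) * (Real.exp ((2 * P.l + 4) * y) *
      profile P.Φ (P.l + 3 / 2) (energyRatio P.L₀ r y)) := by
  have hp : 0 < P.l + 3 / 2 := by linarith [hP.l_gt]
  unfold H
  split_ifs with h
  · have := integral_eq_profile hP.exists_bound.1 hp hP.L₀_pos.le h
    rw [this, show (2 * P.l + 4) * y = y + 2 * (P.l + 3 / 2) * y by ring, Real.exp_add]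
    ring
  · rw [← energyRatio_lt_one_iff hP.L₀_pos.le, not_lt] at h
    rw [profile_eq_zero hp h]; simp

theorem Admissible.G_eq_zero (hP : P.Admissible) {r y : ℝ} (h : 1 ≤ energyRatio P.L₀ r y) :
    P.G r y = 0 := by
  rw [hP.G_eq, profile_eq_zero (by linarith [hP.l_gt]) h]; simp

theorem Admissible.H_eq_zero (hP : P.Admissible) {r y : ℝ} (h : 1 ≤ energyRatio P.L₀ r y) :
    P.H r y = 0 := by
  rw [hP.H_eq, profile_eq_zero (by linarith [hP.l_gt]) h]; simp

/-- The constant `c_l` is a convergent Beta integral. -/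
theorem Admissible.cl_pos (hP : P.Admissible) : 0 < P.cl := by
  refine intervalIntegral.intervalIntegral_pos_of_pos_on ?_ (fun x hx => ?_) one_pos
  · have h := (Complex.betaIntegral_convergent (u := ((P.l + 1 : ℝ) : ℂ)) (v := ((1 / 2 : ℝ) : ℂ))
      (by rw [Complex.ofReal_re]; linarith [hP.l_gt]) (by rw [Complex.ofReal_re]; norm_num)).norm
    refine h.congr_uIoo ?_
    intro x hx
    rw [uIoo_of_le zero_le_one] at hx
    have h1 : (0 : ℝ) < 1 - x := by linarith [hx.2]
    simp only
    rw [norm_mul, Complex.norm_cpow_eq_rpow_re_of_pos hx.1,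
      show (1 - (x : ℂ)) = ((1 - x : ℝ) : ℂ) by push_cast; ring,
      Complex.norm_cpow_eq_rpow_re_of_pos h1, Complex.sub_re, Complex.sub_re, Complex.ofReal_re,
      Complex.ofReal_re, Complex.one_re, add_sub_cancel_right, Real.sqrt_eq_rpow,
      div_eq_mul_inv (x ^ P.l), ← Real.rpow_neg h1.le]
    norm_num
  · exact div_pos (Real.rpow_pos_of_pos hx.1 _) (Real.sqrt_pos.2 (by linarith [hx.2]))

theorem dl_nonneg : 0 ≤ P.dl :=
  intervalIntegral.integral_nonneg zero_le_one fun _ hx =>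
    mul_nonneg (Real.rpow_nonneg hx.1 _) (Real.sqrt_nonneg _)

theorem Admissible.G_nonneg (hP : P.Admissible) {r : ℝ} (hr : 0 < r) (y : ℝ) : 0 ≤ P.G r y := by
  rw [hP.G_eq]
  have := hP.cl_pos
  have := profile_nonneg (p := P.l + 1 / 2) (b := energyRatio P.L₀ r y) hP.densityWeight_nonneg
  positivity

theorem Admissible.H_nonneg (hP : P.Admissible) {r : ℝ} (hr : 0 < r) (y : ℝ) : 0 ≤ P.H r y := by
  rw [hP.H_eq]
  have := P.dl_nonneg
  have := profile_nonneg (p := P.l + 3 / 2) (b := energyRatio P.L₀ r y) hP.Phi_nonneg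
  positivity

theorem Admissible.G_pos (hP : P.Admissible) {r y : ℝ} (hr : 0 < r)
    (h : energyRatio P.L₀ r y < 1) : 0 < P.G r y := by
  rw [hP.G_eq]
  have := hP.cl_pos
  obtain ⟨α₀, h0, hpos⟩ := hP.Phi_pos
  have : 0 < profile P.densityWeight (P.l + 1 / 2) (energyRatio P.L₀ r y) := by
    refine profile_pos hP.densityWeight_nonneg hP.intervalIntegrable_densityWeight
      (by linarith [hP.l_gt]) (lt_min one_pos h0) (fun α ha hb => ?_) h
    have h1 := lt_min_iff.1 hb
    exact mul_pos (hpos α ha h1.2) (by nlinarith [h1.1])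
  positivity

theorem Admissible.continuousOn_G (hP : P.Admissible) :
    ContinuousOn (fun q : ℝ × ℝ => P.G q.1 q.2) (Ioi 0 ×ˢ univ) := by
  simp_rw [hP.G_eq]
  have h1 : ContinuousOn (fun q : ℝ × ℝ => q.1 ^ (2 * P.l)) (Ioi 0 ×ˢ univ) :=
    continuousOn_fst.rpow_const fun q hq => Or.inl (ne_of_gt hq.1)
  have h2 : ContinuousOn (fun q : ℝ × ℝ => energyRatio P.L₀ q.1 q.2) (Ioi 0 ×ˢ univ) := by
    unfold energyRatio
    refine ContinuousOn.mul (by fun_prop) (continuousOn_const.add (ContinuousOn.div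
      continuousOn_const (by fun_prop) fun q hq => pow_ne_zero 2 (ne_of_gt hq.1)))
  have h3 := (continuous_profile (p := P.l + 1 / 2) hP.intervalIntegrable_densityWeight
    (by linarith [hP.l_gt])).comp_continuousOn h2
  exact (continuousOn_const.mul h1).mul (ContinuousOn.mul (by fun_prop) h3)

theorem Admissible.contDiffOn_H (hP : P.Admissible) :
    ContDiffOn ℝ 1 (fun q : ℝ × ℝ => P.H q.1 q.2) (Ioi 0 ×ˢ univ) := by
  simp_rw [hP.H_eq]
  have h1 : ContDiffOn ℝ 1 (fun q : ℝ × ℝ => q.1 ^ (2 * P.l)) (Ioi 0 ×ˢ univ) :=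
    contDiff_fst.contDiffOn.rpow_const_of_ne fun q hq => ne_of_gt hq.1
  have h2 : ContDiffOn ℝ 1 (fun q : ℝ × ℝ => energyRatio P.L₀ q.1 q.2) (Ioi 0 ×ˢ univ) := by
    unfold energyRatio
    refine ContDiffOn.mul (by fun_prop) (contDiffOn_const.add (ContDiffOn.div
      contDiffOn_const (by fun_prop) fun q hq => pow_ne_zero 2 (ne_of_gt hq.1)))
  have h3 := (contDiff_profile (p := P.l + 3 / 2) hP.exists_bound.1
    (by linarith [hP.l_gt])).comp_contDiffOn h2
  exact (contDiffOn_const.mul h1).mul (ContDiffOn.mul (by fun_prop) h3)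

end ShellParams

theorem abs_exp_mul_sub_le {c Y u v : ℝ} (hc : 0 ≤ c) (hu : u ≤ Y) (hv : v ≤ Y) :
    |Real.exp (c * u) - Real.exp (c * v)| ≤ c * Real.exp (c * Y) * |u - v| := by
  refine (convex_Iic Y).norm_image_sub_le_of_norm_hasDerivWithin_le
    (f := fun x => Real.exp (c * x)) (f' := fun x => Real.exp (c * x) * c)
    (fun x _ => ?_) (fun x hx => ?_) hv hu
  · have := ((hasDerivAt_id x).const_mul c).exp
    simpa using this.hasDerivWithinAt
  · rw [norm_mul, Real.norm_of_nonneg (Real.exp_pos _).le, Real.norm_of_nonneg hc, mul_comm]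
    exact mul_le_mul_of_nonneg_left
      (Real.exp_le_exp.2 (mul_le_mul_of_nonneg_left hx hc)) hc

/-- Density and pressure are Lipschitz continuous in `y`, uniformly on compact sets of radii; there
is no lower bound on `y`, since both vanish for `y ≤ 0`. -/
theorem exists_lipschitz_of_profile {k : ℝ → ℝ} {B C L c e a R Y : ℝ} (hB : 0 ≤ B) (hL : 0 ≤ L)
    (hc : 0 ≤ c) (ha : 0 < a)
    (hk : ∀ b d, 0 ≤ b → 0 ≤ d → |k b - k d| ≤ B * |b - d|) (hk0 : ∀ b, 1 ≤ b → k b = 0) :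
    ∃ K, 0 ≤ K ∧ ∀ r ∈ Icc a R, ∀ u ≤ Y, ∀ v ≤ Y,
      |C * r ^ e * (Real.exp (c * u) * k (energyRatio L r u)) -
        C * r ^ e * (Real.exp (c * v) * k (energyRatio L r v))| ≤ K * |u - v| := by
  obtain ⟨D, hD⟩ : ∃ D, ∀ r ∈ Icc a R, ‖C * r ^ e‖ ≤ D := by
    refine isCompact_Icc.exists_bound_of_continuousOn (continuousOn_const.mul
      (continuousOn_id.rpow_const fun x hx => Or.inl (ne_of_gt (ha.trans_le hx.1))))
  set β := 1 + L / a ^ 2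
  have hβ : 1 ≤ β := le_add_of_nonneg_right (by positivity)
  set e0 := Real.exp (c * Y)
  have he0 : 0 < e0 := Real.exp_pos _
  have hkB : ∀ b, 0 ≤ b → |k b| ≤ B := by
    intro b hb
    rcases le_total 1 b with h | h
    · rw [hk0 b h]; simpa using hB
    · have := hk b 1 hb zero_le_one
      rw [hk0 1 le_rfl, sub_zero, abs_of_nonpos (by linarith : b - 1 ≤ 0)] at this
      nlinarith
  refine ⟨|D| * (e0 * (B * (β * 2)) + B * (c * e0)), by positivity, fun r hr => ?_⟩
  have hr0 : 0 < r := ha.trans_le hr.1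
  have key : ∀ u, 0 ≤ u → u ≤ Y → ∀ v, 0 ≤ v → v ≤ Y →
      |C * r ^ e * (Real.exp (c * u) * k (energyRatio L r u)) -
        C * r ^ e * (Real.exp (c * v) * k (energyRatio L r v))| ≤
        |D| * (e0 * (B * (β * 2)) + B * (c * e0)) * |u - v| := by
    intro u hu0 hu v hv0 hv
    have h1 : |energyRatio L r u - energyRatio L r v| ≤ β * 2 * |u - v| := by
      have hL' : L / r ^ 2 ≤ L / a ^ 2 := by
        have := hr.1
        gcongr
      have h := abs_exp_mul_sub_le (c := 2) (Y := 0) (u := -u) (v := -v) (by norm_num)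
        (by linarith) (by linarith)
      rw [mul_zero, Real.exp_zero, mul_one, show -u - -v = -(u - v) by ring, abs_neg] at h
      unfold energyRatio
      rw [← sub_mul, abs_mul, abs_of_nonneg (by positivity : 0 ≤ 1 + L / r ^ 2), mul_comm,
        mul_assoc, show -2 * u = 2 * -u by ring, show -2 * v = 2 * -v by ring]
      exact mul_le_mul (by simpa [β] using hL') h (abs_nonneg _) (by linarith)
    have h2 := (hk _ _ (energyRatio_pos (r := r) hL u).le (energyRatio_pos (r := r) hL v).le).trans
      (mul_le_mul_of_nonneg_left h1 hB)
    have h3 := hkB _ (energyRatio_pos (r := r) hL v).le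
    have h4 := abs_exp_mul_sub_le hc hu hv
    have h5 : |Real.exp (c * u)| ≤ e0 := by
      rw [Real.abs_exp]; exact Real.exp_le_exp.2 (mul_le_mul_of_nonneg_left hu hc)
    rw [← mul_sub, abs_mul, mul_assoc]
    refine mul_le_mul ((hD r hr).trans (le_abs_self D)) ?_ (abs_nonneg _) (abs_nonneg _)
    rw [show Real.exp (c * u) * k (energyRatio L r u) - Real.exp (c * v) * k (energyRatio L r v) =
      Real.exp (c * u) * (k (energyRatio L r u) - k (energyRatio L r v)) +
      k (energyRatio L r v) * (Real.exp (c * u) - Real.exp (c * v)) by ring]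
    refine (abs_add_le _ _).trans ?_
    rw [abs_mul, abs_mul, add_mul]
    refine add_le_add ?_ ?_
    · calc _ ≤ e0 * (B * (β * 2 * |u - v|)) := mul_le_mul h5 h2 (abs_nonneg _) he0.le
        _ = _ := by ring
    · calc _ ≤ B * (c * e0 * |u - v|) := mul_le_mul h3 h4 (abs_nonneg _) hB
        _ = _ := by ring
  intro u hu v hv
  have hz : ∀ w ≤ 0, k (energyRatio L r w) = 0 := fun w hw =>
    hk0 _ (one_le_energyRatio_of_nonpos hL hw)
  -- replacing `y` by its positive part does not change the function
  have hmax : ∀ w, Real.exp (c * w) * k (energyRatio L r w) =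
      Real.exp (c * max w 0) * k (energyRatio L r (max w 0)) := by
    intro w
    rcases le_total w 0 with h | h
    · rw [max_eq_right h, hz w h, hz 0 le_rfl]; simp
    · rw [max_eq_left h]
  rcases le_total Y 0 with hY | hY
  · rw [hz u (hu.trans hY), hz v (hv.trans hY)]
    simp only [mul_zero, sub_self, abs_zero]
    positivity
  · rw [hmax u, hmax v]
    refine (key _ (le_max_right _ _) (max_le hu hY) _ (le_max_right _ _) (max_le hv hY)).trans ?_
    refine mul_le_mul_of_nonneg_left ?_ (by positivity)
    exact abs_max_sub_max_le_abs u v 0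

namespace ShellParams

variable {P : ShellParams}

/-- The weight of the density has the factor `1 - α` that `abs_profile_sub_le` needs. -/
theorem Admissible.exists_lipschitz_G (hP : P.Admissible) {a : ℝ} (ha : 0 < a) (R Y : ℝ) :
    ∃ K, 0 ≤ K ∧ ∀ r ∈ Icc a R, ∀ u ≤ Y, ∀ v ≤ Y, |P.G r u - P.G r v| ≤ K * |u - v| := by
  obtain ⟨hI, B, hB0, hB⟩ := hP.exists_bound
  have hp : 0 < P.l + 1 / 2 := by linarith [hP.l_gt]
  simp_rw [hP.G_eq]
  refine exists_lipschitz_of_profile hB0 hP.L₀_pos.le (by linarith) ha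
    (fun b d hb hd => abs_profile_sub_le hP.intervalIntegrable_densityWeight hp ?_ hB0 hb hd)
    (fun b hb => profile_eq_zero hp hb)
  filter_upwards [hB] with α h hα
  have h := h hα
  rw [uIoc_of_le zero_le_one] at hα
  rw [densityWeight, abs_mul, abs_of_nonneg (sq_nonneg (1 - α)), pow_two, ← mul_assoc]
  have h1 : 0 ≤ 1 - α := by linarith [hα.2]
  refine mul_le_mul_of_nonneg_right ?_ h1
  nlinarith [abs_nonneg (P.Φ α), hα.1]

theorem Admissible.exists_lipschitz_H (hP : P.Admissible) {a : ℝ} (ha : 0 < a) (R Y : ℝ) :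
    ∃ K, 0 ≤ K ∧ ∀ r ∈ Icc a R, ∀ u ≤ Y, ∀ v ≤ Y, |P.H r u - P.H r v| ≤ K * |u - v| := by
  obtain ⟨hI, B, hB0, hB⟩ := hP.exists_bound
  have hp : 1 < P.l + 3 / 2 := by linarith [hP.l_gt]
  simp_rw [hP.H_eq]
  exact exists_lipschitz_of_profile (by positivity) hP.L₀_pos.le (by linarith) ha
    (fun b d hb hd => abs_profile_sub_le_of_one_lt hI hp hB hb hd)
    (fun b hb => profile_eq_zero (by linarith) hb)

end ShellParams

/-! ### Effective potentials and the Schwarzschild case -/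

theorem hasDerivAt_sqrt_angular {L r : ℝ} (hL : 0 ≤ L) (hr : 0 < r) :
    HasDerivAt (fun r => √(1 + L / r ^ 2)) (√(1 + L / r ^ 2) * -(L / (r * (r ^ 2 + L)))) r := by
  have hpos : 0 < 1 + L / r ^ 2 := by positivity
  have h1 : HasDerivAt (fun r : ℝ => 1 + L / r ^ 2) (-(2 * L / r ^ 3)) r := by
    have := ((hasDerivAt_const r L).div (hasDerivAt_pow 2 r) (by positivity)).const_add 1
    convert! this using 1
    field_simp
    ring
  convert! h1.sqrt hpos.ne' using 1
  have hs : √(1 + L / r ^ 2) ^ 2 = 1 + L / r ^ 2 := Real.sq_sqrt hpos.le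
  have hs0 : √(1 + L / r ^ 2) ≠ 0 := (Real.sqrt_pos.2 hpos).ne'
  rw [eq_div_iff (by positivity)]
  have : √(1 + L / r ^ 2) * -(L / (r * (r ^ 2 + L))) * (2 * √(1 + L / r ^ 2)) =
    -(2 * L / (r * (r ^ 2 + L))) * √(1 + L / r ^ 2) ^ 2 := by ring
  rw [this, hs]
  field_simp

theorem hasDerivAt_exp_mul_sqrt_angular {μ : ℝ → ℝ} {L r d : ℝ} (hL : 0 ≤ L) (hr : 0 < r)
    (hμ : HasDerivAt μ d r) :
    HasDerivAt (fun r => Real.exp (μ r) * √(1 + L / r ^ 2))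
      (Real.exp (μ r) * √(1 + L / r ^ 2) * (d - L / (r * (r ^ 2 + L)))) r := by
  convert! hμ.exp.mul (hasDerivAt_sqrt_angular hL hr) using 1
  ring

theorem hasDerivAt_exp_mul_sqrt_angular_zero_iff {μ : ℝ → ℝ} {L r d : ℝ} (hL : 0 ≤ L) (hr : 0 < r)
    (hμ : HasDerivAt μ d r) :
    HasDerivAt (fun r => Real.exp (μ r) * √(1 + L / r ^ 2)) 0 r ↔ d = L / (r * (r ^ 2 + L)) := by
  have h := hasDerivAt_exp_mul_sqrt_angular hL hr hμ
  have hpos : 0 < Real.exp (μ r) * √(1 + L / r ^ 2) := by positivity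
  constructor
  · intro h0
    have := h.unique h0
    rcases mul_eq_zero.1 this with h1 | h1
    · exact absurd h1 hpos.ne'
    · linarith
  · intro h0
    rwa [h0, sub_self, mul_zero] at h

section Schwarzschild

variable {M L r : ℝ}

theorem one_sub_pos (hM : 0 < M) (hr : 2 * M < r) : 0 < 1 - 2 * M / r := by
  have : 0 < r := by linarith
  rw [sub_pos, div_lt_one this]; exact hr

theorem hasDerivAt_muSS (hM : 0 < M) (hr : 2 * M < r) :
    HasDerivAt (muSS M) (M / (r * (r - 2 * M))) r := by
  have h0 : 0 < r := by linarith
  have h2 : r - 2 * M ≠ 0 := by linarith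
  have h1 : HasDerivAt (fun r : ℝ => 1 - 2 * M / r) (2 * M / r ^ 2) r := by
    have := ((hasDerivAt_const r (2 * M)).div (hasDerivAt_id r) h0.ne').const_sub 1
    convert! this using 1
    simp [neg_div]
  have := (h1.log (one_sub_pos hM hr).ne').const_mul (1 / 2)
  convert! this using 1
  field_simp

theorem exp_muSS (hM : 0 < M) (hr : 2 * M < r) : Real.exp (muSS M r) = √(1 - 2 * M / r) := by
  rw [muSS, mul_comm, ← div_eq_mul_one_div, Real.exp_half, Real.exp_log (one_sub_pos hM hr)]

theorem hasDerivAt_psiSS_zero_iff (hM : 0 < M) (hL : 0 ≤ L) (hr : 2 * M < r) :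
    HasDerivAt (psiSS M L) 0 r ↔ M * r ^ 2 - L * r + 3 * M * L = 0 := by
  have h0 : 0 < r := by linarith
  have h2 : r - 2 * M ≠ 0 := by linarith
  have hev : psiSS M L =ᶠ[𝓝 r] fun r => Real.exp (muSS M r) * √(1 + L / r ^ 2) := by
    filter_upwards [Ioi_mem_nhds hr] with x hx
    rw [exp_muSS hM hx, psiSS]
  rw [hev.hasDerivAt_iff, hasDerivAt_exp_mul_sqrt_angular_zero_iff hL h0 (hasDerivAt_muSS hM hr)]
  rw [div_eq_div_iff (by positivity) (by positivity), ← sub_eq_zero,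
    show M * (r * (r ^ 2 + L)) - L * (r * (r - 2 * M)) = r * (M * r ^ 2 - L * r + 3 * M * L) -
      r * (M * L - M * L) by ring, sub_self, mul_zero, sub_zero]
  simp [h0.ne']

theorem psiSS_sq (hM : 0 < M) (hL : 0 ≤ L) (hr : 2 * M < r) :
    psiSS M L r ^ 2 = (1 - 2 * M / r) * (1 + L / r ^ 2) := by
  rw [psiSS, mul_pow, Real.sq_sqrt (one_sub_pos hM hr).le, Real.sq_sqrt (by positivity)]

theorem continuousAt_psiSS (hM : 0 < M) (L : ℝ) (hr : 2 * M < r) :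
    ContinuousAt (psiSS M L) r := by
  have h0 : r ≠ 0 := by linarith
  unfold psiSS
  refine ContinuousAt.mul (ContinuousAt.sqrt ?_) (ContinuousAt.sqrt ?_)
  · exact continuousAt_const.sub (continuousAt_const.div continuousAt_id h0)
  · exact continuousAt_const.add (continuousAt_const.div (by fun_prop) (pow_ne_zero 2 h0))

/-- For `L > 12 M²` the critical radii are the zeros of `M r² - L r + 3 M L`, and they lie in
`]3M, 6M[` and `]6M, ∞[`. -/
theorem critRadii_spec (hM : 0 < M) (hL : 12 * M ^ 2 < L) :
    3 * M < sSS M L ∧ sSS M L < 6 * M ∧ 6 * M < rSS M L ∧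
      ∀ x, M * x ^ 2 - L * x + 3 * M * L = M * (x - sSS M L) * (x - rSS M L) := by
  have hL0 : 0 < L := by nlinarith
  set D := √(L ^ 2 - 12 * M ^ 2 * L)
  have hdisc : 0 < L ^ 2 - 12 * M ^ 2 * L := by nlinarith
  have hD : D ^ 2 = L ^ 2 - 12 * M ^ 2 * L := Real.sq_sqrt hdisc.le
  have hD0 : 0 < D := Real.sqrt_pos.2 hdisc
  set s := (L - D) / (2 * M) with hs
  set t := (L + D) / (2 * M) with ht
  have hfac : ∀ x, M * x ^ 2 - L * x + 3 * M * L = M * (x - s) * (x - t) := by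
    intro x
    rw [hs, ht]
    field_simp
    linear_combination hD
  have hst : s < t := by rw [hs, ht]; gcongr; linarith
  have hmid : 6 * M < t := by
    rw [ht, lt_div_iff₀ (by linarith)]; nlinarith
  have h6 : M * (6 * M - s) * (6 * M - t) < 0 := by rw [← hfac]; nlinarith
  have hs6 : s < 6 * M := by
    by_contra h
    push Not at h
    nlinarith [mul_nonneg (mul_nonneg hM.le (sub_nonneg.2 h)) (sub_pos.2 hmid).le]
  have h3 : 0 < M * (3 * M - s) * (3 * M - t) := by rw [← hfac]; nlinarith [pow_pos hM 3]
  have hs3 : 3 * M < s := by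
    by_contra h
    push Not at h
    nlinarith [mul_nonneg (mul_nonneg hM.le (sub_nonneg.2 h)) (by linarith : (0 : ℝ) ≤ t - 3 * M)]
  have hcrit : critRadii M L = {s, t} := by
    ext x
    simp only [critRadii, mem_ofPred_eq, mem_insert_iff, mem_singleton_iff]
    constructor
    · rintro ⟨hx, hd⟩
      rw [hasDerivAt_psiSS_zero_iff hM hL0.le hx, hfac] at hd
      rcases mul_eq_zero.1 hd with h | h
      · rcases mul_eq_zero.1 h with h | h
        · exact absurd h hM.ne'
        · left; linarith
      · right; linarith
    · intro h
      have hx : 2 * M < x := by rcases h with rfl | rfl <;> linarith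
      refine ⟨hx, ?_⟩
      rw [hasDerivAt_psiSS_zero_iff hM hL0.le hx, hfac]
      rcases h with rfl | rfl <;> simp
  have h1 : sSS M L = s := by rw [sSS, hcrit, csInf_pair, inf_eq_left.2 hst.le]
  have h2 : rSS M L = t := by rw [rSS, hcrit, csSup_pair, sup_eq_right.2 hst.le]
  rw [h1, h2]
  exact ⟨hs3, hs6, hmid, hfac⟩

end Schwarzschild

namespace ShellParams

variable {P : ShellParams}

variable (P) in
/-- The Schwarzschild limit `ln E⁰ - μ⁰` of `y`. -/
def ySS (r : ℝ) : ℝ := Real.log P.E0 - muSS P.M r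

variable (P) in
/-- The radius `2M / (1 - (E⁰)²)` at which `ySS` vanishes. There is no matter beyond it. -/
def outerRadius : ℝ := 2 * P.M / (1 - P.E0 ^ 2)

namespace Admissible

theorem E0_lt_one (hP : P.Admissible) : P.E0 < 1 := (lt_min_iff.1 hP.E0_lt).1

theorem two_thirds_lt (hP : P.Admissible) : 0 < P.E0 ∧ 2 / 3 < P.E0 ^ 2 := by
  have hM := hP.M_pos
  obtain ⟨-, -, h6, -⟩ := critRadii_spec hM hP.L₀_gt
  set t := rSS P.M P.L₀
  have ht : 0 < t := by linarith
  have h0 : 0 ≤ psiSS P.M P.L₀ t := by unfold psiSS; positivity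
  have hE := hP.E0_gt
  have h1 : psiSS P.M P.L₀ t ^ 2 < P.E0 ^ 2 := by gcongr
  rw [psiSS_sq hM hP.L₀_pos.le (by linarith)] at h1
  have h2 : 2 * P.M / t < 1 / 3 := by rw [div_lt_iff₀ ht]; linarith
  have h3 : 0 < P.L₀ / t ^ 2 := div_pos hP.L₀_pos (by positivity)
  refine ⟨h0.trans_lt hE, ?_⟩
  nlinarith

theorem E0_pos (hP : P.Admissible) : 0 < P.E0 := hP.two_thirds_lt.1

theorem six_mul_lt_outerRadius (hP : P.Admissible) : 6 * P.M < P.outerRadius := by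
  have h1 := hP.E0_lt_one
  obtain ⟨h2, h3⟩ := hP.two_thirds_lt
  have hM := hP.M_pos
  rw [outerRadius, lt_div_iff₀ (by nlinarith)]
  nlinarith

theorem hasDerivAt_ySS (hP : P.Admissible) {r : ℝ} (hr : 2 * P.M < r) :
    HasDerivAt P.ySS (-(P.M / (r * (r - 2 * P.M)))) r :=
  (hasDerivAt_muSS hP.M_pos hr).const_sub _

theorem ySS_four_mul (hP : P.Admissible) : P.ySS (4 * P.M) = Real.log (√2 * P.E0) := by
  have hM := hP.M_pos
  rw [ySS, muSS, show 1 - 2 * P.M / (4 * P.M) = 2⁻¹ by field_simp; norm_num, Real.log_inv,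
    Real.log_mul (by positivity) hP.E0_pos.ne', Real.log_sqrt (by norm_num)]
  ring

theorem energyRatio_ySS (hP : P.Admissible) {L r : ℝ} (hL : 0 ≤ L) (hr : 2 * P.M < r) :
    energyRatio L r (P.ySS r) = (psiSS P.M L r / P.E0) ^ 2 := by
  have hE := hP.E0_pos
  rw [energyRatio_eq_sq hL, ySS, neg_sub, Real.exp_sub, exp_muSS hP.M_pos hr, Real.exp_log hE,
    psiSS]
  ring

theorem ySS_nonpos (hP : P.Admissible) {r : ℝ} (hr : P.outerRadius ≤ r) : P.ySS r ≤ 0 := by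
  have hM := hP.M_pos
  have hr6 := hP.six_mul_lt_outerRadius
  have h0 : 0 < r := by linarith
  have h1 := hP.E0_lt_one
  have hE := hP.E0_pos
  have h2 : P.E0 ^ 2 ≤ 1 - 2 * P.M / r := by
    rw [outerRadius, div_le_iff₀ (by nlinarith)] at hr
    rw [le_sub_comm, div_le_iff₀ h0]
    linarith
  have := Real.log_le_log (by positivity) h2
  rw [Real.log_pow] at this
  rw [ySS, muSS]
  push_cast at this
  linarith

/-- The effective potential is larger than `E⁰` in the transition region of the radial cut-off,
because `r₀ + η₀ < r_-⁰`. -/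
theorem E0_lt_psiSS (hP : P.Admissible) {r : ℝ} (h0 : P.r₀ ≤ r) (h1 : r ≤ P.r₀ + P.η₀) :
    P.E0 < psiSS P.M P.L₀ r := by
  have hM := hP.M_pos
  obtain ⟨h3, h6, h6', -⟩ := critRadii_spec hM hP.L₀_gt
  set s := sSS P.M P.L₀ with hs
  set t := rSS P.M P.L₀ with ht
  have hr0 : P.r₀ = s := rfl
  have hEs : P.E0 < psiSS P.M P.L₀ s := (lt_min_iff.1 hP.E0_lt).2
  have hEt := hP.E0_gt
  have hcont : ContinuousOn (psiSS P.M P.L₀) (Icc s t) := fun x hx =>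
    (continuousAt_psiSS hM _ (by linarith [hx.1])).continuousWithinAt
  set S := {r | s < r ∧ r < t ∧ psiSS P.M P.L₀ r = P.E0} with hS
  have hlow : BddBelow S := ⟨s, fun x hx => hx.1.le⟩
  have hsmall : P.r₀ + P.η₀ < sInf S := hP.η₀_small
  obtain ⟨c, hc, hcE⟩ := intermediate_value_Ioo' (by linarith : s ≤ t) hcont ⟨hEt, hEs⟩
  have hct : sInf S ≤ c := csInf_le hlow ⟨hc.1, hc.2, hcE⟩
  by_contra hr
  push Not at hr
  have hsr : s ≤ r := by rw [← hr0]; exact h0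
  have hrt : r < t := by linarith [hc.2]
  obtain ⟨d, hd, hdE⟩ := intermediate_value_Icc' hsr
    (hcont.mono (Icc_subset_Icc_right hrt.le)) ⟨hr, hEs.le⟩
  have hsd : s < d := by
    refine lt_of_le_of_ne hd.1 ?_
    rintro rfl
    exact hEs.ne' hdE
  have : sInf S ≤ d := csInf_le hlow ⟨hsd, by linarith [hd.2], hdE⟩
  linarith [hd.2]

/-- If `r₀ < 4M`, the effective potential is at least `1` on `[r₀, 4M]`. -/
theorem one_le_psiSS (hP : P.Admissible) {r : ℝ} (h0 : P.r₀ ≤ r) (h1 : r ≤ 4 * P.M) :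
    1 ≤ psiSS P.M P.L₀ r := by
  have hM := hP.M_pos
  obtain ⟨h3, h6, h6', hfac⟩ := critRadii_spec hM hP.L₀_gt
  have hr0 : P.r₀ = sSS P.M P.L₀ := rfl
  set s := sSS P.M P.L₀ with hs
  set t := rSS P.M P.L₀ with ht
  rw [hr0] at h0
  have hsq : 0 ≤ psiSS P.M P.L₀ r := by unfold psiSS; positivity
  rw [← one_le_sq_iff₀ hsq, psiSS_sq hM hP.L₀_pos.le (by linarith)]
  have hr : 0 < r := by linarith
  have hL16 : 16 * P.M ^ 2 ≤ P.L₀ := by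
    have := hfac (4 * P.M)
    have h4 : P.M * (4 * P.M - s) * (4 * P.M - t) ≤ 0 :=
      mul_nonpos_of_nonneg_of_nonpos (mul_nonneg hM.le (by linarith)) (by linarith)
    nlinarith
  have hq := hfac r
  have hmain : 0 ≤ P.L₀ * r - 2 * P.M * r ^ 2 - 2 * P.M * P.L₀ := by
    have h5 : P.M * (r - s) * (r - t) ≤ 0 :=
      mul_nonpos_of_nonneg_of_nonpos (mul_nonneg hM.le (by linarith)) (by linarith)
    rw [← hq] at h5
    nlinarith [mul_nonneg hM.le (sub_nonneg.2 h1)]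
  have : (1 - 2 * P.M / r) * (1 + P.L₀ / r ^ 2) =
      1 + (P.L₀ * r - 2 * P.M * r ^ 2 - 2 * P.M * P.L₀) / r ^ 3 := by
    field_simp
    ring
  rw [this]
  have := div_nonneg hmain (pow_nonneg hr.le 3)
  linarith

theorem one_lt_energyRatio (hP : P.Admissible) {r y : ℝ} (h0 : P.r₀ ≤ r)
    (h1 : r ≤ 4 * P.M ∨ r ≤ P.r₀ + P.η₀) (hy : y ≤ P.ySS r) : 1 < energyRatio P.L₀ r y := by
  have hM := hP.M_pos
  have h3 : 3 * P.M < P.r₀ := (critRadii_spec hM hP.L₀_gt).1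
  have hE : P.E0 < psiSS P.M P.L₀ r := by
    rcases h1 with h | h
    · exact hP.E0_lt_one.trans_le (hP.one_le_psiSS h0 h)
    · exact hP.E0_lt_psiSS h0 h
  have h2 : energyRatio P.L₀ r (P.ySS r) ≤ energyRatio P.L₀ r y := by
    have := hP.L₀_pos
    exact mul_le_mul_of_nonneg_right (Real.exp_le_exp.2 (by linarith)) (by positivity)
  refine lt_of_lt_of_le ?_ h2
  rw [hP.energyRatio_ySS hP.L₀_pos.le (by linarith)]
  exact one_lt_pow₀ ((one_lt_div hP.E0_pos).2 hE) two_ne_zero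

end Admissible

end ShellParams

/-! ### The right-hand side of the reduced equation -/

/-- `-y'` in terms of the mass `A = M + m` inside the radius `r` and of `N = 4 π r³ p`. -/
def slope (A N r : ℝ) : ℝ := (A + N) / (r * (r - 2 * A))

theorem slope_eq {A p r : ℝ} (hr : 0 < r) :
    1 / (1 - 2 / r * A) * (A / r ^ 2 + 4 * Real.pi * r * p) =
      slope A (4 * Real.pi * r ^ 3 * p) r := by
  have h : 1 - 2 / r * A = (r - 2 * A) / r := by field_simp
  rw [slope, h, one_div_div]
  by_cases h0 : r - 2 * A = 0
  · simp [h0]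
  · field_simp

/-- The factor `1 / r²` makes the bound integrable at infinity. The smallness conditions keep
`r - 2 A` above `r / 4`. -/
theorem slope_sub_le {M A B N K r : ℝ} (hM : 0 < M) (hr : 4 * M ≤ r) (hA : A ≤ 3 / 2 * M)
    (hB0 : 0 ≤ B) (hB : B ≤ 3 / 2 * M) (hK0 : 0 ≤ K) (hK : K ≤ M) :
    |slope A N r - slope B K r| ≤ (24 * |A - B| + 4 * |N - K|) / r ^ 2 := by
  have hr0 : 0 < r := by linarith
  have h1 : r / 4 ≤ r - 2 * A := by linarith
  have h2 : r / 4 ≤ r - 2 * B := by linarith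
  have h1' : 0 < r - 2 * A := by linarith
  have h2' : 0 < r - 2 * B := by linarith
  have e : slope A N r - slope B K r = ((A - B) + (N - K)) / (r * (r - 2 * A)) +
      (B + K) / r * (2 * (A - B) / ((r - 2 * A) * (r - 2 * B))) := by
    rw [slope, slope, div_sub_div _ _ (by positivity) (by positivity), div_mul_div_comm,
      div_add_div _ _ (by positivity) (by positivity),
      div_eq_div_iff (by positivity) (by positivity)]
    ring
  have b1 : |((A - B) + (N - K)) / (r * (r - 2 * A))| ≤ 4 * (|A - B| + |N - K|) / r ^ 2 := by
    rw [abs_div, abs_of_pos (by positivity : 0 < r * (r - 2 * A)),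
      div_le_div_iff₀ (by positivity) (by positivity)]
    have h3 := abs_add_le (A - B) (N - K)
    have h4 : r ^ 2 ≤ 4 * (r * (r - 2 * A)) := by nlinarith
    calc _ ≤ (|A - B| + |N - K|) * (4 * (r * (r - 2 * A))) :=
          mul_le_mul h3 h4 (by positivity) (by positivity)
      _ = _ := by ring
  have b2 : |(B + K) / r * (2 * (A - B) / ((r - 2 * A) * (r - 2 * B)))| ≤
      20 * |A - B| / r ^ 2 := by
    rw [abs_mul, abs_div (2 * (A - B)), abs_of_pos (by positivity : 0 < (r - 2 * A) * (r - 2 * B)),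
      abs_of_nonneg (by positivity : 0 ≤ (B + K) / r), abs_mul, abs_two]
    have h3 : (B + K) / r ≤ 5 / 8 := by rw [div_le_iff₀ hr0]; linarith
    have h4 : r ^ 2 / 16 ≤ (r - 2 * A) * (r - 2 * B) := by nlinarith
    have h5 : 2 * |A - B| / ((r - 2 * A) * (r - 2 * B)) ≤ 2 * |A - B| / (r ^ 2 / 16) := by
      gcongr
    calc _ ≤ 5 / 8 * (2 * |A - B| / (r ^ 2 / 16)) :=
          mul_le_mul h3 h5 (by positivity) (by norm_num)
      _ = _ := by field_simp; ring
  rw [e]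
  refine (abs_add_le _ _).trans ((add_le_add b1 b2).trans (le_of_eq ?_))
  ring

theorem slope_le_slope {M A N r : ℝ} (hM : 0 < M) (hr : 2 * M < r) (hA : M ≤ A) (hN : 0 ≤ N)
    (hd : 0 < r - 2 * A) : M / (r * (r - 2 * M)) ≤ slope A N r := by
  have hr0 : 0 < r := by linarith
  unfold slope
  gcongr <;> linarith

/-! ### Matter below the Schwarzschild solution -/

namespace ShellParams

variable {P : ShellParams} {δ : ℝ} {u v y : ℝ → ℝ} {r : ℝ}

variable (P) in
/-- The term `4 π r³ p` of the reduced equation. -/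
def pressureTerm (δ : ℝ) (y : ℝ → ℝ) (r : ℝ) : ℝ := 4 * Real.pi * r ^ 3 * P.pressure δ y r

variable (P) in
/-- `-y'` as a function of the matter that belongs to `u`. -/
def slopeOf (δ : ℝ) (u : ℝ → ℝ) (r : ℝ) : ℝ :=
  slope (P.M + P.localMass δ u r) (P.pressureTerm δ u r) r

variable (P) in
/-- `u` is continuous on `]2M, ∞[`, and its matter vanishes on `]2M, 4M]`. -/
structure VacuumInside (δ : ℝ) (u : ℝ → ℝ) : Prop where
  cont : ContinuousOn u (Ioi (2 * P.M))
  rho_eq_zero : ∀ r, 2 * P.M < r → r ≤ 4 * P.M → P.rho δ u r = 0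

variable (P) in
/-- `u` is continuous on `]2M, ∞[` and lies below `ySS`. Its matter is then confined to
`[4M, outerRadius]`. -/
structure Sub (u : ℝ → ℝ) : Prop where
  cont : ContinuousOn u (Ioi (2 * P.M))
  le_ySS : ∀ r, 2 * P.M < r → u r ≤ P.ySS r

theorem VacuumInside.localMass_eq_zero (hu : P.VacuumInside δ u) (hr : 2 * P.M < r)
    (hr4 : r ≤ 4 * P.M) : P.localMass δ u r = 0 := by
  have hz : ∀ s ∈ uIoc (2 * P.M) r, s ^ 2 * P.rho δ u s = 0 := by
    intro s hs
    rw [uIoc_of_le hr.le] at hs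
    rw [hu.rho_eq_zero s hs.1 (hs.2.trans hr4), mul_zero]
  rw [localMass, intervalIntegral.integral_zero_ae (Eventually.of_forall hz), mul_zero]

namespace Admissible

theorem three_mul_lt_r₀ (hP : P.Admissible) : 3 * P.M < P.r₀ :=
  (critRadii_spec hP.M_pos hP.L₀_gt).1

theorem continuousOn_rho (hP : P.Admissible) (hu : ContinuousOn u (Ioi (2 * P.M))) :
    ContinuousOn (P.rho δ u) (Ioi (2 * P.M)) := by
  have hM := hP.M_pos
  have h1 : ContinuousOn (fun r => P.G r (u r)) (Ioi (2 * P.M)) :=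
    hP.continuousOn_G.comp (continuousOn_id.prodMk hu) fun r hr =>
      ⟨show 0 < r by linarith [mem_Ioi.1 hr], mem_univ _⟩
  exact (continuousOn_const.mul
    (hP.chi_smooth.continuous.comp (by fun_prop)).continuousOn).mul h1

theorem continuousOn_pressure (hP : P.Admissible) (hu : ContinuousOn u (Ioi (2 * P.M))) :
    ContinuousOn (P.pressure δ u) (Ioi (2 * P.M)) := by
  have hM := hP.M_pos
  have h1 : ContinuousOn (fun r => P.H r (u r)) (Ioi (2 * P.M)) :=
    hP.contDiffOn_H.continuousOn.comp (continuousOn_id.prodMk hu) fun r hr =>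
      ⟨show 0 < r by linarith [mem_Ioi.1 hr], mem_univ _⟩
  exact (continuousOn_const.mul
    (hP.chi_smooth.continuous.comp (by fun_prop)).continuousOn).mul h1

theorem rho_nonneg (hP : P.Admissible) (hδ : 0 ≤ δ) (hr : 0 < r) : 0 ≤ P.rho δ u r :=
  mul_nonneg (mul_nonneg hδ (hP.chi_nonneg _)) (hP.G_nonneg hr _)

theorem pressureTerm_nonneg (hP : P.Admissible) (hδ : 0 ≤ δ) (hr : 0 < r) :
    0 ≤ P.pressureTerm δ u r := by
  have h1 : 0 ≤ P.pressure δ u r :=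
    mul_nonneg (mul_nonneg hδ (hP.chi_nonneg _)) (hP.H_nonneg hr _)
  unfold pressureTerm
  positivity

/-- Radii without density carry no pressure. -/
theorem pressure_eq_zero (hP : P.Admissible) (hr : 0 < r) (h : P.rho δ u r = 0) :
    P.pressure δ u r = 0 := by
  unfold rho at h
  unfold pressure
  rcases mul_eq_zero.1 h with h | h
  · rw [h, zero_mul]
  · rw [hP.H_eq_zero, mul_zero]
    by_contra h1
    exact (hP.G_pos hr (not_le.1 h1)).ne' h

theorem pressureTerm_eq_zero (hP : P.Admissible) (hr : 0 < r) (h : P.rho δ u r = 0) :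
    P.pressureTerm δ u r = 0 := by
  rw [pressureTerm, hP.pressure_eq_zero hr h, mul_zero]

theorem rho_eq_zero_of_one_le (hP : P.Admissible) (h : 1 ≤ energyRatio P.L₀ r (u r)) :
    P.rho δ u r = 0 := by
  rw [rho, hP.G_eq_zero h, mul_zero]

theorem rho_eq_zero_inner (hP : P.Admissible) (hu : u r ≤ P.ySS r)
    (hr : r ≤ 4 * P.M ∨ r ≤ P.r₀ + P.η₀) : P.rho δ u r = 0 := by
  rcases le_total r P.r₀ with h | h
  · rw [rho, hP.chi_zero _ (by linarith)]; simp
  · exact hP.rho_eq_zero_of_one_le (hP.one_lt_energyRatio h hr hu).le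

theorem rho_eq_zero_outer (hP : P.Admissible) (hu : u r ≤ P.ySS r) (hr : P.outerRadius ≤ r) :
    P.rho δ u r = 0 :=
  hP.rho_eq_zero_of_one_le
    (one_le_energyRatio_of_nonpos hP.L₀_pos.le (hu.trans (hP.ySS_nonpos hr)))

theorem vacuumInside_of_sub (hP : P.Admissible) (hu : P.Sub u) : P.VacuumInside δ u :=
  ⟨hu.cont, fun r h1 h2 => hP.rho_eq_zero_inner (hu.le_ySS r h1) (Or.inl h2)⟩

theorem continuousOn_integrand (hP : P.Admissible) (hu : ContinuousOn u (Ioi (2 * P.M))) :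
    ContinuousOn (fun s => s ^ 2 * P.rho δ u s) (Ioi (2 * P.M)) :=
  (continuousOn_pow 2).mul (hP.continuousOn_rho hu)

theorem intervalIntegrable_integrand (hP : P.Admissible) (hu : ContinuousOn u (Ioi (2 * P.M)))
    {a b : ℝ} (ha : 2 * P.M < a) (hb : 2 * P.M < b) :
    IntervalIntegrable (fun s => s ^ 2 * P.rho δ u s) volume a b :=
  ((hP.continuousOn_integrand hu).mono fun _ hx =>
    (lt_min ha hb).trans_le hx.1).intervalIntegrable

/-- Without matter in `]2M, 4M]` the local mass is an integral over radii above `4M`. -/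
theorem localMass_eq (hP : P.Admissible) (hu : P.VacuumInside δ u) (hr : 2 * P.M < r) :
    P.localMass δ u r = 4 * Real.pi * ∫ s in (4 * P.M)..r, s ^ 2 * P.rho δ u s := by
  have hM := hP.M_pos
  have hz : ∀ s ∈ uIoc (2 * P.M) (4 * P.M), s ^ 2 * P.rho δ u s = 0 := by
    intro s hs
    rw [uIoc_of_le (by linarith)] at hs
    rw [hu.rho_eq_zero s hs.1 hs.2, mul_zero]
  have h0 : IntervalIntegrable (fun s => s ^ 2 * P.rho δ u s) volume (2 * P.M) (4 * P.M) :=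
    (intervalIntegrable_const (c := (0 : ℝ))).congr fun s hs => (hz s hs).symm
  have h1 := hP.intervalIntegrable_integrand (δ := δ) hu.cont (by linarith : 2 * P.M < 4 * P.M) hr
  have h2 : ∫ s in (2 * P.M)..(4 * P.M), s ^ 2 * P.rho δ u s = 0 :=
    intervalIntegral.integral_zero_ae (Eventually.of_forall hz)
  rw [localMass, ← intervalIntegral.integral_add_adjacent_intervals h0 h1, h2, zero_add]

theorem hasDerivAt_localMass (hP : P.Admissible) (hu : P.VacuumInside δ u) (hr : 2 * P.M < r) :
    HasDerivAt (P.localMass δ u) (4 * Real.pi * (r ^ 2 * P.rho δ u r)) r := by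
  have hM := hP.M_pos
  have hc := hP.continuousOn_integrand (δ := δ) hu.cont
  have hmem : Ioi (2 * P.M) ∈ 𝓝 r := Ioi_mem_nhds hr
  have := (intervalIntegral.integral_hasDerivAt_right
    (hP.intervalIntegrable_integrand (δ := δ) hu.cont (by linarith : 2 * P.M < 4 * P.M) hr)
    (hc.stronglyMeasurableAtFilter isOpen_Ioi r hr) (hc.continuousAt hmem)).const_mul
    (4 * Real.pi)
  refine this.congr_of_eventuallyEq ?_
  filter_upwards [hmem] with x hx
  exact hP.localMass_eq hu hx

theorem localMass_mono (hP : P.Admissible) (hu : P.VacuumInside δ u) (hδ : 0 ≤ δ) :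
    MonotoneOn (P.localMass δ u) (Ioi (2 * P.M)) := by
  have hM := hP.M_pos
  refine monotoneOn_of_deriv_nonneg (convex_Ioi _) (fun x hx =>
    (hP.hasDerivAt_localMass hu hx).continuousAt.continuousWithinAt) ?_ ?_
  · intro x hx
    rw [interior_Ioi] at hx
    exact (hP.hasDerivAt_localMass hu hx).differentiableAt.differentiableWithinAt
  · intro x hx
    rw [interior_Ioi] at hx
    rw [(hP.hasDerivAt_localMass hu hx).deriv]
    have := hP.rho_nonneg (u := u) hδ (by linarith [mem_Ioi.1 hx] : 0 < x)
    positivity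

theorem localMass_nonneg (hP : P.Admissible) (hu : P.VacuumInside δ u) (hδ : 0 ≤ δ)
    (hr : 2 * P.M < r) : 0 ≤ P.localMass δ u r := by
  have hM := hP.M_pos
  rcases le_total r (4 * P.M) with h | h
  · rw [hu.localMass_eq_zero hr h]
  · rw [← hu.localMass_eq_zero (by linarith : 2 * P.M < 4 * P.M) le_rfl]
    exact hP.localMass_mono hu hδ (show 2 * P.M < 4 * P.M by linarith) hr h

theorem localMass_outer (hP : P.Admissible) (hu : P.Sub u) (hr : P.outerRadius ≤ r) :
    P.localMass δ u r = P.localMass δ u P.outerRadius := by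
  have hM := hP.M_pos
  have h6 := hP.six_mul_lt_outerRadius
  have hv := hP.vacuumInside_of_sub (δ := δ) hu
  have hz : ∀ s ∈ uIoc P.outerRadius r, s ^ 2 * P.rho δ u s = 0 := by
    intro s hs
    rw [uIoc_of_le hr] at hs
    rw [hP.rho_eq_zero_outer (hu.le_ySS s (by linarith [hs.1])) hs.1.le, mul_zero]
  rw [hP.localMass_eq hv (by linarith), hP.localMass_eq hv (by linarith),
    ← intervalIntegral.integral_add_adjacent_intervals
      (hP.intervalIntegrable_integrand (δ := δ) hu.cont (by linarith : 2 * P.M < 4 * P.M)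
        (by linarith : 2 * P.M < P.outerRadius))
      (hP.intervalIntegrable_integrand (δ := δ) hu.cont (by linarith) (by linarith)),
    intervalIntegral.integral_zero_ae (Eventually.of_forall hz), add_zero]

theorem slopeOf_eq_of_le (hP : P.Admissible) (hu : P.VacuumInside δ u) (hr : 2 * P.M < r)
    (hr4 : r ≤ 4 * P.M) : P.slopeOf δ u r = P.M / (r * (r - 2 * P.M)) := by
  have hM := hP.M_pos
  rw [slopeOf, hu.localMass_eq_zero hr hr4,
    hP.pressureTerm_eq_zero (by linarith) (hu.rho_eq_zero r hr hr4), slope, add_zero, add_zero]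

/-- A solution of the reduced equation agrees with `ySS` up to `4M` and lies below it beyond,
since matter can only make `y` decrease faster. -/
theorem le_ySS_of_hasDerivAt (hP : P.Admissible) (hδ : 0 ≤ δ) (hu : P.VacuumInside δ u)
    (hden : ∀ r, 2 * P.M < r → 0 < r - 2 * (P.M + P.localMass δ u r))
    (hd : ∀ r, 2 * P.M < r → HasDerivAt y (-P.slopeOf δ u r) r)
    (h4 : y (4 * P.M) = P.ySS (4 * P.M)) :
    (∀ r, 2 * P.M < r → r ≤ 4 * P.M → y r = P.ySS r) ∧ ∀ r, 2 * P.M < r → y r ≤ P.ySS r := by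
  have hM := hP.M_pos
  have hdiff : ∀ r, 2 * P.M < r → HasDerivAt (fun r => y r - P.ySS r)
      (-P.slopeOf δ u r - -(P.M / (r * (r - 2 * P.M)))) r :=
    fun r hr => (hd r hr).sub (hP.hasDerivAt_ySS hr)
  have hanti : AntitoneOn (fun r => y r - P.ySS r) (Ioi (2 * P.M)) := by
    refine antitoneOn_of_deriv_nonpos (convex_Ioi _) (fun x hx =>
      (hdiff x hx).continuousAt.continuousWithinAt) ?_ ?_
    · intro x hx
      rw [interior_Ioi] at hx
      exact (hdiff x hx).differentiableAt.differentiableWithinAt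
    · intro x hx
      rw [interior_Ioi] at hx
      rw [(hdiff x hx).deriv]
      have hx' : 2 * P.M < x := hx
      have := slope_le_slope hM hx (le_add_of_nonneg_right (hP.localMass_nonneg hu hδ hx))
        (hP.pressureTerm_nonneg (u := u) hδ (by linarith : 0 < x)) (hden x hx)
      unfold slopeOf
      linarith
  have heq : ∀ r, 2 * P.M < r → r ≤ 4 * P.M → y r = P.ySS r := by
    intro r hr hr4
    have := constant_of_has_deriv_right_zero (f := fun r => y r - P.ySS r) (a := r) (b := 4 * P.M)
      (fun x hx => (hdiff x (hr.trans_le hx.1)).continuousAt.continuousWithinAt)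
      (fun x hx => by
        have hx2 := hr.trans_le hx.1
        have := (hdiff x hx2).hasDerivWithinAt (s := Ici x)
        rwa [hP.slopeOf_eq_of_le hu hx2 hx.2.le, sub_self] at this)
      (4 * P.M) ⟨hr4, le_rfl⟩
    linarith
  refine ⟨heq, fun r hr => ?_⟩
  rcases le_total r (4 * P.M) with h | h
  · exact (heq r hr h).le
  · have := hanti (show 2 * P.M < 4 * P.M by linarith) hr h
    simp only at this
    linarith

/-! ### A priori estimates -/

theorem exists_chi_le (hP : P.Admissible) : ∃ X, 0 ≤ X ∧ ∀ s, |P.χ s| ≤ X := by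
  obtain ⟨X, hX⟩ := isCompact_Icc.exists_bound_of_continuousOn
    (s := Icc 0 P.η₀) hP.chi_smooth.continuous.continuousOn
  refine ⟨max X 1, le_max_of_le_right zero_le_one, fun s => ?_⟩
  rcases le_total s 0 with h | h
  · rw [hP.chi_zero s h]; simp
  rcases le_total P.η₀ s with h' | h'
  · rw [hP.chi_one s h']; simp
  · exact (hX s ⟨h, h'⟩).trans (le_max_left _ _)

theorem log_initial_pos (hP : P.Admissible) : 0 < Real.log (√2 * P.E0) := by
  have h := hP.two_thirds_lt
  refine Real.log_pos ?_
  have h0 : 0 < √2 * P.E0 := mul_pos (by positivity) h.1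
  rw [← one_lt_sq_iff₀ h0.le, mul_pow, Real.sq_sqrt (by norm_num)]
  linarith

theorem ySS_le (hP : P.Admissible) (hr : 4 * P.M ≤ r) : P.ySS r ≤ Real.log (√2 * P.E0) := by
  have hM := hP.M_pos
  rw [← hP.ySS_four_mul]
  have hanti : AntitoneOn P.ySS (Ioi (2 * P.M)) := by
    refine antitoneOn_of_deriv_nonpos (convex_Ioi _) (fun x hx =>
      (hP.hasDerivAt_ySS hx).continuousAt.continuousWithinAt) ?_ ?_
    · intro x hx
      rw [interior_Ioi] at hx
      exact (hP.hasDerivAt_ySS hx).differentiableAt.differentiableWithinAt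
    · intro x hx
      rw [interior_Ioi] at hx
      rw [(hP.hasDerivAt_ySS hx).deriv]
      have hx1 : 0 < x - 2 * P.M := sub_pos.2 hx
      have hx2 : 0 < x := by linarith
      rw [neg_nonpos]
      positivity
  exact hanti (show 2 * P.M < 4 * P.M by linarith) (show 2 * P.M < r by linarith) hr

/-- Density, pressure and local mass depend Lipschitz continuously on `y`, with a constant
proportional to `δ`. -/
theorem exists_matter_sub_le (hP : P.Admissible) : ∃ K, 0 ≤ K ∧ ∀ δ, 0 ≤ δ → ∀ u v, P.Sub u →
    P.Sub v → ∀ d, (∀ r ∈ Icc (4 * P.M) P.outerRadius, |u r - v r| ≤ d) → ∀ r, 2 * P.M < r →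
      |P.rho δ u r - P.rho δ v r| ≤ K * δ * d ∧
      |P.pressure δ u r - P.pressure δ v r| ≤ K * δ * d ∧
      |P.pressureTerm δ u r - P.pressureTerm δ v r| ≤ K * δ * d ∧
      |P.localMass δ u r - P.localMass δ v r| ≤ K * δ * d := by
  have hM := hP.M_pos
  have h6 := hP.six_mul_lt_outerRadius
  set R := P.outerRadius
  obtain ⟨X, hX0, hX⟩ := hP.exists_chi_le
  obtain ⟨K₁, hK₁, hG⟩ := hP.exists_lipschitz_G (by linarith : 0 < 4 * P.M) R
    (Real.log (√2 * P.E0))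
  obtain ⟨K₂, hK₂, hH⟩ := hP.exists_lipschitz_H (by linarith : 0 < 4 * P.M) R
    (Real.log (√2 * P.E0))
  have hR0 : 0 < R := by linarith
  set K := X * K₁ + X * K₂ + 4 * Real.pi * R ^ 3 * (X * K₁ + X * K₂) with hK
  have hpi := Real.pi_pos
  have hA : 0 ≤ X * K₁ := by positivity
  have hB : 0 ≤ X * K₂ := by positivity
  have hKa : 4 * Real.pi * R ^ 3 * (X * K₁) ≤ K := by
    have : 0 ≤ 4 * Real.pi * R ^ 3 * (X * K₂) := by positivity
    rw [hK, mul_add]; linarith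
  have hKb : 4 * Real.pi * R ^ 3 * (X * K₂) ≤ K := by
    have : 0 ≤ 4 * Real.pi * R ^ 3 * (X * K₁) := by positivity
    rw [hK, mul_add]; linarith
  have hKc : X * K₁ ≤ K ∧ X * K₂ ≤ K := by
    have : 0 ≤ 4 * Real.pi * R ^ 3 * (X * K₁ + X * K₂) := by positivity
    constructor <;> rw [hK] <;> linarith
  refine ⟨K, by positivity, fun δ hδ u v hu hv d hd => ?_⟩
  have hd0 : 0 ≤ d := (abs_nonneg _).trans (hd R ⟨by linarith, le_rfl⟩)
  have hrho : ∀ r, 2 * P.M < r → |P.rho δ u r - P.rho δ v r| ≤ X * K₁ * (δ * d) ∧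
      |P.pressure δ u r - P.pressure δ v r| ≤ X * K₂ * (δ * d) ∧
      |P.pressureTerm δ u r - P.pressureTerm δ v r| ≤ K * (δ * d) := by
    intro r hr
    have hr0 : 0 < r := by linarith
    have hvac : P.rho δ u r = 0 → P.rho δ v r = 0 →
        |P.rho δ u r - P.rho δ v r| ≤ X * K₁ * (δ * d) ∧
        |P.pressure δ u r - P.pressure δ v r| ≤ X * K₂ * (δ * d) ∧
        |P.pressureTerm δ u r - P.pressureTerm δ v r| ≤ K * (δ * d) := by
      intro h1 h2
      rw [h1, h2, hP.pressure_eq_zero hr0 h1, hP.pressure_eq_zero hr0 h2,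
        hP.pressureTerm_eq_zero hr0 h1, hP.pressureTerm_eq_zero hr0 h2, sub_self, abs_zero]
      exact ⟨by positivity, by positivity, by positivity⟩
    rcases le_total r (4 * P.M) with h | h
    · exact hvac (hP.rho_eq_zero_inner (hu.le_ySS r hr) (Or.inl h))
        (hP.rho_eq_zero_inner (hv.le_ySS r hr) (Or.inl h))
    rcases le_total R r with h' | h'
    · exact hvac (hP.rho_eq_zero_outer (hu.le_ySS r hr) h')
        (hP.rho_eq_zero_outer (hv.le_ySS r hr) h')
    have hu' := (hu.le_ySS r hr).trans (hP.ySS_le h)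
    have hv' := (hv.le_ySS r hr).trans (hP.ySS_le h)
    have hduv := hd r ⟨h, h'⟩
    have h1 : |P.rho δ u r - P.rho δ v r| ≤ X * K₁ * (δ * d) := by
      have hL := (hG r ⟨h, h'⟩ _ hu' _ hv').trans (mul_le_mul_of_nonneg_left hduv hK₁)
      rw [rho, rho, ← mul_sub, abs_mul, abs_mul, abs_of_nonneg hδ]
      calc _ ≤ δ * X * (K₁ * d) := by
            gcongr
            exact hX _
        _ = _ := by ring
    have h2 : |P.pressure δ u r - P.pressure δ v r| ≤ X * K₂ * (δ * d) := by
      have hL := (hH r ⟨h, h'⟩ _ hu' _ hv').trans (mul_le_mul_of_nonneg_left hduv hK₂)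
      rw [pressure, pressure, ← mul_sub, abs_mul, abs_mul, abs_of_nonneg hδ]
      calc _ ≤ δ * X * (K₂ * d) := by
            gcongr
            exact hX _
        _ = _ := by ring
    refine ⟨h1, h2, ?_⟩
    rw [pressureTerm, pressureTerm, ← mul_sub, abs_mul,
      abs_of_nonneg (by positivity : 0 ≤ 4 * Real.pi * r ^ 3)]
    calc _ ≤ 4 * Real.pi * R ^ 3 * (X * K₂ * (δ * d)) := by gcongr
      _ = 4 * Real.pi * R ^ 3 * (X * K₂) * (δ * d) := by ring
      _ ≤ _ := mul_le_mul_of_nonneg_right hKb (by positivity)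
  have hmass : ∀ r, 4 * P.M ≤ r → r ≤ R →
      |P.localMass δ u r - P.localMass δ v r| ≤ K * (δ * d) := by
    intro r h h'
    have hr : 2 * P.M < r := by linarith
    have hI := fun w (hw : P.Sub w) => hP.intervalIntegrable_integrand (δ := δ) hw.cont
      (by linarith : 2 * P.M < 4 * P.M) hr
    rw [hP.localMass_eq (hP.vacuumInside_of_sub hu) hr, hP.localMass_eq (hP.vacuumInside_of_sub hv) hr,
      ← mul_sub, ← intervalIntegral.integral_sub (hI u hu) (hI v hv), abs_mul,
      abs_of_nonneg (by positivity : 0 ≤ 4 * Real.pi), ← Real.norm_eq_abs (∫ _ in _.._, _)]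
    have h1 := intervalIntegral.norm_integral_le_of_norm_le_const (a := 4 * P.M) (b := r)
      (f := fun s => s ^ 2 * P.rho δ u s - s ^ 2 * P.rho δ v s) (C := R ^ 2 * (X * K₁ * (δ * d)))
      (fun s hs => by
        rw [uIoc_of_le h] at hs
        have hs0 : 0 ≤ s := by linarith [hs.1]
        rw [← mul_sub, norm_mul, Real.norm_of_nonneg (sq_nonneg s)]
        have := hs.2.trans h'
        exact mul_le_mul (by gcongr) (hrho s (by linarith [hs.1])).1 (abs_nonneg _) (by positivity))
    have h2 : |r - 4 * P.M| ≤ R := by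
      rw [abs_of_nonneg (by linarith)]; linarith
    calc _ ≤ 4 * Real.pi * (R ^ 2 * (X * K₁ * (δ * d)) * R) := by
          gcongr
          exact h1.trans (by gcongr)
      _ = 4 * Real.pi * R ^ 3 * (X * K₁) * (δ * d) := by ring
      _ ≤ _ := mul_le_mul_of_nonneg_right hKa (by positivity)
  intro r hr
  obtain ⟨h1, h2, h3⟩ := hrho r hr
  have hδd : 0 ≤ δ * d := by positivity
  rw [mul_assoc]
  refine ⟨h1.trans (mul_le_mul_of_nonneg_right hKc.1 hδd),
    h2.trans (mul_le_mul_of_nonneg_right hKc.2 hδd), h3, ?_⟩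
  rcases le_total r (4 * P.M) with h | h
  · rw [(hP.vacuumInside_of_sub hu).localMass_eq_zero hr h,
      (hP.vacuumInside_of_sub hv).localMass_eq_zero hr h, sub_self, abs_zero]
    positivity
  rcases le_total R r with h' | h'
  · rw [hP.localMass_outer hu h', hP.localMass_outer hv h']
    exact hmass R (by linarith) le_rfl
  · exact hmass r h h'

end Admissible

end ShellParams

namespace ShellParams

variable {P : ShellParams} {δ : ℝ} {u v y z : ℝ → ℝ} {r : ℝ}

namespace Admissible

/-- The matter of any `u` below `ySS` is of size `δ`: compare with `min u 0`, which carries none. -/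
theorem exists_matter_le (hP : P.Admissible) : ∃ K, 0 ≤ K ∧ ∀ δ, 0 ≤ δ → ∀ u, P.Sub u →
    ∀ r, 2 * P.M < r → |P.rho δ u r| ≤ K * δ ∧ |P.pressure δ u r| ≤ K * δ ∧
      |P.pressureTerm δ u r| ≤ K * δ ∧ |P.localMass δ u r| ≤ K * δ := by
  have hM := hP.M_pos
  obtain ⟨K, hK, h⟩ := hP.exists_matter_sub_le
  have hY := hP.log_initial_pos
  refine ⟨K * Real.log (√2 * P.E0), by positivity, fun δ hδ u hu r hr => ?_⟩
  set v : ℝ → ℝ := fun r => min (u r) 0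
  have hv : P.Sub v :=
    ⟨hu.cont.inf continuousOn_const, fun r hr => (min_le_left _ _).trans (hu.le_ySS r hr)⟩
  have hz : ∀ s, P.rho δ v s = 0 := fun s => hP.rho_eq_zero_of_one_le
    (one_le_energyRatio_of_nonpos hP.L₀_pos.le (min_le_right _ _))
  have hm : P.localMass δ v r = 0 := by simp [localMass, hz]
  have := h δ hδ u v hu hv (Real.log (√2 * P.E0)) (fun s hs => ?_) r hr
  · rw [hz, hP.pressure_eq_zero (by linarith) (hz r), hP.pressureTerm_eq_zero (by linarith) (hz r),
      hm] at this
    simp only [sub_zero] at this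
    rwa [mul_right_comm]
  · have h1 := (hu.le_ySS s (by linarith [hs.1])).trans (hP.ySS_le hs.1)
    rcases le_total (u s) 0 with h2 | h2
    · simpa [v, min_eq_left h2] using hY.le
    · simpa [v, min_eq_right h2, abs_of_nonneg h2] using h1

/-- Bounds on the right-hand side of the reduced equation for small `δ`. -/
theorem exists_slope_estimates (hP : P.Admissible) : ∃ δ₁ > 0, ∃ C, 0 ≤ C ∧
    ∀ δ, 0 ≤ δ → δ ≤ δ₁ →
      (∀ u, P.Sub u → ∀ r, 2 * P.M < r →
        P.localMass δ u r ≤ P.M / 2 ∧ P.pressureTerm δ u r ≤ P.M ∧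
        0 < r - 2 * (P.M + P.localMass δ u r) ∧
        |P.slopeOf δ u r - P.M / (r * (r - 2 * P.M))| ≤ C * δ / r ^ 2) ∧
      ∀ u v, P.Sub u → P.Sub v → ∀ d, (∀ r ∈ Icc (4 * P.M) P.outerRadius, |u r - v r| ≤ d) →
        ∀ r, 2 * P.M < r → |P.slopeOf δ u r - P.slopeOf δ v r| ≤ C * δ * d / r ^ 2 := by
  have hM := hP.M_pos
  have h6 := hP.six_mul_lt_outerRadius
  obtain ⟨K, hK, hb⟩ := hP.exists_matter_le
  obtain ⟨K', hK', hd⟩ := hP.exists_matter_sub_le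
  refine ⟨P.M / (2 * (K + 1)), by positivity, 28 * (K + K'), by positivity,
    fun δ hδ0 hδ => ?_⟩
  have hKδ : K * δ ≤ P.M / 2 := by
    rw [le_div_iff₀ (by positivity)] at hδ
    nlinarith
  have hbd : ∀ u, P.Sub u → ∀ r, 2 * P.M < r → P.localMass δ u r ≤ P.M / 2 ∧
      P.pressureTerm δ u r ≤ P.M := fun u hu r hr =>
    ⟨(le_abs_self _).trans ((hb δ hδ0 u hu r hr).2.2.2.trans hKδ),
      (le_abs_self _).trans ((hb δ hδ0 u hu r hr).2.2.1.trans (hKδ.trans (by linarith)))⟩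
  refine ⟨fun u hu r hr => ?_, fun u v hu hv d huv r hr => ?_⟩
  · have hr0 : 0 < r := by linarith
    obtain ⟨h1, h2⟩ := hbd u hu r hr
    have hvac := hP.vacuumInside_of_sub (δ := δ) hu
    rcases le_total r (4 * P.M) with h | h
    · refine ⟨h1, h2, ?_, ?_⟩
      · rw [hvac.localMass_eq_zero hr h]; linarith
      · rw [hP.slopeOf_eq_of_le hvac hr h, sub_self, abs_zero]; positivity
    · refine ⟨h1, h2, by linarith, ?_⟩
      have h3 := slope_sub_le (A := P.M + P.localMass δ u r) (N := P.pressureTerm δ u r)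
        (B := P.M) (K := 0) hM h (by linarith) hM.le (by linarith) le_rfl hM.le
      rw [add_sub_cancel_left, sub_zero,
        show slope P.M 0 r = P.M / (r * (r - 2 * P.M)) by rw [slope, add_zero]] at h3
      refine h3.trans ?_
      obtain ⟨-, -, h4, h5⟩ := hb δ hδ0 u hu r hr
      gcongr
      nlinarith [mul_nonneg hK' hδ0]
  · have hr0 : 0 < r := by linarith
    have hd0 : 0 ≤ d := (abs_nonneg _).trans (huv _ ⟨by linarith, le_rfl⟩)
    rcases le_total r (4 * P.M) with h | h
    · rw [hP.slopeOf_eq_of_le (hP.vacuumInside_of_sub hu) hr h,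
        hP.slopeOf_eq_of_le (hP.vacuumInside_of_sub hv) hr h, sub_self, abs_zero]
      positivity
    · obtain ⟨h1, h2⟩ := hbd u hu r hr
      obtain ⟨h1', h2'⟩ := hbd v hv r hr
      have h3 := slope_sub_le (A := P.M + P.localMass δ u r) (N := P.pressureTerm δ u r)
        (B := P.M + P.localMass δ v r) (K := P.pressureTerm δ v r) hM h (by linarith)
        (by linarith [hP.localMass_nonneg (hP.vacuumInside_of_sub hv) hδ0 hr]) (by linarith)
        (hP.pressureTerm_nonneg hδ0 hr0) h2'
      rw [add_sub_add_left_eq_sub] at h3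
      refine h3.trans ?_
      obtain ⟨-, -, h4, h5⟩ := hd δ hδ0 u v hu hv d huv r hr
      gcongr
      nlinarith [mul_nonneg (mul_nonneg hK hδ0) hd0]

theorem continuousOn_slopeOf (hP : P.Admissible) (hu : P.VacuumInside δ u)
    (hden : ∀ r, 2 * P.M < r → 0 < r - 2 * (P.M + P.localMass δ u r)) :
    ContinuousOn (P.slopeOf δ u) (Ioi (2 * P.M)) := by
  have hM := hP.M_pos
  have hm : ContinuousOn (P.localMass δ u) (Ioi (2 * P.M)) := fun r hr =>
    (hP.hasDerivAt_localMass hu hr).continuousAt.continuousWithinAt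
  have hp : ContinuousOn (P.pressureTerm δ u) (Ioi (2 * P.M)) :=
    ContinuousOn.mul (by fun_prop) (hP.continuousOn_pressure hu.cont)
  refine ContinuousOn.div ((continuousOn_const.add hm).add hp)
    (continuousOn_id.mul (continuousOn_id.sub
      (continuousOn_const.mul (continuousOn_const.add hm)))) fun r hr => ?_
  have h1 := hden r hr
  have h2 : 0 < r := by linarith [mem_Ioi.1 hr]
  exact (mul_pos h2 h1).ne'

theorem intervalIntegrable_slopeOf (hP : P.Admissible) (hu : P.VacuumInside δ u)
    (hden : ∀ r, 2 * P.M < r → 0 < r - 2 * (P.M + P.localMass δ u r)) {a b : ℝ}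
    (ha : 2 * P.M < a) (hb : 2 * P.M < b) :
    IntervalIntegrable (P.slopeOf δ u) volume a b :=
  ((hP.continuousOn_slopeOf hu hden).mono fun _ hx =>
    (lt_min ha hb).trans_le hx.1).intervalIntegrable

theorem hasDerivAt_integral_slopeOf (hP : P.Admissible) (hu : P.VacuumInside δ u)
    (hden : ∀ r, 2 * P.M < r → 0 < r - 2 * (P.M + P.localMass δ u r)) (c : ℝ)
    (hr : 2 * P.M < r) :
    HasDerivAt (fun r => c - ∫ s in (4 * P.M)..r, P.slopeOf δ u s) (-P.slopeOf δ u r) r := by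
  have hM := hP.M_pos
  have hc := hP.continuousOn_slopeOf hu hden
  exact (intervalIntegral.integral_hasDerivAt_right
    (hP.intervalIntegrable_slopeOf hu hden (by linarith : 2 * P.M < 4 * P.M) hr)
    (hc.stronglyMeasurableAtFilter isOpen_Ioi r hr)
    (hc.continuousAt (Ioi_mem_nhds hr))).const_sub c

/-- Two functions below `ySS` that agree on `[4M, outerRadius]` have the same matter. -/
theorem rho_eq_of_eqOn (hP : P.Admissible) (hu : P.Sub u) (hv : P.Sub v)
    (h : EqOn u v (Icc (4 * P.M) P.outerRadius)) (hr : 2 * P.M < r) :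
    P.rho δ u r = P.rho δ v r := by
  rcases le_total r (4 * P.M) with h1 | h1
  · rw [hP.rho_eq_zero_inner (hu.le_ySS r hr) (Or.inl h1),
      hP.rho_eq_zero_inner (hv.le_ySS r hr) (Or.inl h1)]
  rcases le_total P.outerRadius r with h2 | h2
  · rw [hP.rho_eq_zero_outer (hu.le_ySS r hr) h2, hP.rho_eq_zero_outer (hv.le_ySS r hr) h2]
  · rw [rho, rho, h ⟨h1, h2⟩]

theorem localMass_eq_of_eqOn (hP : P.Admissible) (hu : P.Sub u) (hv : P.Sub v)
    (h : EqOn u v (Icc (4 * P.M) P.outerRadius)) (hr : 2 * P.M < r) :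
    P.localMass δ u r = P.localMass δ v r := by
  have hM := hP.M_pos
  rw [hP.localMass_eq (hP.vacuumInside_of_sub hu) hr,
    hP.localMass_eq (hP.vacuumInside_of_sub hv) hr]
  congr 1
  refine intervalIntegral.integral_congr fun s hs => ?_
  have hs' : 2 * P.M < s := (lt_min (by linarith) hr).trans_le hs.1
  rw [hP.rho_eq_of_eqOn hu hv h hs']

theorem pressureTerm_eq_of_eqOn (hP : P.Admissible) (hu : P.Sub u) (hv : P.Sub v)
    (h : EqOn u v (Icc (4 * P.M) P.outerRadius)) (hr : 2 * P.M < r) :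
    P.pressureTerm δ u r = P.pressureTerm δ v r := by
  have hr0 : 0 < r := by linarith [hP.M_pos]
  rcases le_total r (4 * P.M) with h1 | h1
  · rw [hP.pressureTerm_eq_zero hr0 (hP.rho_eq_zero_inner (hu.le_ySS r hr) (Or.inl h1)),
      hP.pressureTerm_eq_zero hr0 (hP.rho_eq_zero_inner (hv.le_ySS r hr) (Or.inl h1))]
  rcases le_total P.outerRadius r with h2 | h2
  · rw [hP.pressureTerm_eq_zero hr0 (hP.rho_eq_zero_outer (hu.le_ySS r hr) h2),
      hP.pressureTerm_eq_zero hr0 (hP.rho_eq_zero_outer (hv.le_ySS r hr) h2)]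
  · rw [pressureTerm, pressureTerm, pressure, pressure, h ⟨h1, h2⟩]

theorem slopeOf_eq_of_eqOn (hP : P.Admissible) (hu : P.Sub u) (hv : P.Sub v)
    (h : EqOn u v (Icc (4 * P.M) P.outerRadius)) (hr : 2 * P.M < r) :
    P.slopeOf δ u r = P.slopeOf δ v r := by
  rw [slopeOf, slopeOf, hP.localMass_eq_of_eqOn hu hv h hr, hP.pressureTerm_eq_of_eqOn hu hv h hr]

end Admissible

/-! ### Basic properties of shells -/

theorem IsShell.vacuumInside (h : P.IsShell δ y) : P.VacuumInside δ y :=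
  ⟨h.contDiffOn.continuousOn, h.vacuum⟩

theorem IsShell.hasDerivAt (hP : P.Admissible) (h : P.IsShell δ y) (hr : 2 * P.M < r) :
    HasDerivAt y (-P.slopeOf δ y r) r := by
  have := h.equation r hr
  rwa [slope_eq (by linarith [hP.M_pos])] at this

/-- The denominator of the reduced equation is positive near the horizon and never vanishes. -/
theorem IsShell.denom_pos (hP : P.Admissible) (h : P.IsShell δ y) (hr : 2 * P.M < r) :
    0 < r - 2 * (P.M + P.localMass δ y r) := by
  have hM := hP.M_pos
  have hne : ∀ x, 2 * P.M < x → x - 2 * (P.M + P.localMass δ y x) ≠ 0 := by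
    intro x hx h0
    have hx0 : 0 < x := by linarith
    refine h.denom_ne_zero x hx ?_
    have : 1 - 2 / x * (P.M + P.localMass δ y x) = (x - 2 * (P.M + P.localMass δ y x)) / x := by
      field_simp
    rw [this, h0, zero_div]
  rcases le_total r (4 * P.M) with h4 | h4
  · rw [h.vacuumInside.localMass_eq_zero hr h4]; linarith
  by_contra hneg
  push Not at hneg
  have hc : ContinuousOn (fun x => x - 2 * (P.M + P.localMass δ y x)) (Icc (4 * P.M) r) :=
    fun x hx => (continuousAt_id.sub (continuousAt_const.mul (continuousAt_const.add
      (hP.hasDerivAt_localMass h.vacuumInside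
        (by linarith [hx.1])).continuousAt))).continuousWithinAt
  obtain ⟨x, hx, hx0⟩ := intermediate_value_Icc' h4 hc ⟨hneg, by
    rw [h.vacuumInside.localMass_eq_zero (by linarith) le_rfl]; linarith⟩
  exact hne x (by linarith [hx.1]) hx0

theorem IsShell.eq_ySS (hP : P.Admissible) (hδ : 0 ≤ δ) (h : P.IsShell δ y) (hr : 2 * P.M < r)
    (hr4 : r ≤ 4 * P.M) : y r = P.ySS r :=
  (hP.le_ySS_of_hasDerivAt hδ h.vacuumInside (fun _ hx => h.denom_pos hP hx)
    (fun _ hx => h.hasDerivAt hP hx) (h.initial.trans hP.ySS_four_mul.symm)).1 r hr hr4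

theorem IsShell.sub (hP : P.Admissible) (hδ : 0 ≤ δ) (h : P.IsShell δ y) : P.Sub y :=
  ⟨h.contDiffOn.continuousOn,
    (hP.le_ySS_of_hasDerivAt hδ h.vacuumInside (fun _ hx => h.denom_pos hP hx)
      (fun _ hx => h.hasDerivAt hP hx) (h.initial.trans hP.ySS_four_mul.symm)).2⟩

theorem IsShell.eq_integral (hP : P.Admissible) (h : P.IsShell δ y) (hr : 2 * P.M < r) :
    y r = Real.log (√2 * P.E0) - ∫ s in (4 * P.M)..r, P.slopeOf δ y s := by
  have hM := hP.M_pos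
  have h4 : 2 * P.M < 4 * P.M := by linarith
  have := intervalIntegral.integral_eq_sub_of_hasDerivAt (a := 4 * P.M) (b := r)
    (fun x hx => h.hasDerivAt hP ((lt_min h4 hr).trans_le hx.1))
    (hP.intervalIntegrable_slopeOf h.vacuumInside (fun _ hx => h.denom_pos hP hx) h4 hr).neg
  rw [intervalIntegral.integral_neg, h.initial] at this
  linarith

/-! ### Existence and uniqueness -/

namespace Admissible

theorem four_mul_le_outerRadius (hP : P.Admissible) : 4 * P.M ≤ P.outerRadius := by
  linarith [hP.six_mul_lt_outerRadius, hP.M_pos]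

/-- The extension of a function on `[4M, outerRadius]` that is cut off above by `ySS`. -/
def extend (hP : P.Admissible) (Z : C(Icc (4 * P.M) P.outerRadius, ℝ)) (r : ℝ) : ℝ :=
  min (Z (projIcc _ _ hP.four_mul_le_outerRadius r)) (P.ySS r)

theorem sub_extend (hP : P.Admissible) (Z : C(Icc (4 * P.M) P.outerRadius, ℝ)) :
    P.Sub (hP.extend Z) :=
  ⟨(Z.continuous.comp continuous_projIcc).continuousOn.inf fun _ hr =>
    (hP.hasDerivAt_ySS hr).continuousAt.continuousWithinAt, fun _ _ => min_le_right _ _⟩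

theorem extend_apply (hP : P.Admissible) (Z : C(Icc (4 * P.M) P.outerRadius, ℝ))
    (hr : r ∈ Icc (4 * P.M) P.outerRadius) : hP.extend Z r = min (Z ⟨r, hr⟩) (P.ySS r) := by
  rw [extend, projIcc_of_mem _ hr]

theorem abs_extend_sub_le (hP : P.Admissible) (Z W : C(Icc (4 * P.M) P.outerRadius, ℝ)) (r : ℝ) :
    |hP.extend Z r - hP.extend W r| ≤ dist Z W := by
  refine (abs_min_sub_min_le_max _ _ _ _).trans ?_
  rw [sub_self, abs_zero, max_eq_left (abs_nonneg _), ← Real.dist_eq]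
  exact ContinuousMap.dist_apply_le_dist _

open Classical in
/-- The integral operator on `C([4M, outerRadius])` whose fixed points are the restrictions of
shells. (If the denominator of the reduced equation is not positive, the value is `0`.) -/
def shellOp (hP : P.Admissible) (δ : ℝ) (Z : C(Icc (4 * P.M) P.outerRadius, ℝ)) :
    C(Icc (4 * P.M) P.outerRadius, ℝ) :=
  if h : ∀ r, 2 * P.M < r → 0 < r - 2 * (P.M + P.localMass δ (hP.extend Z) r) then
    ⟨fun r => Real.log (√2 * P.E0) - ∫ s in (4 * P.M)..r, P.slopeOf δ (hP.extend Z) s, by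
      refine continuous_iff_continuousAt.2 fun r => ?_
      have hr : 2 * P.M < (r : ℝ) := by linarith [r.2.1, hP.M_pos]
      exact ContinuousAt.comp (g := fun x : ℝ => Real.log (√2 * P.E0) -
          ∫ s in (4 * P.M)..x, P.slopeOf δ (hP.extend Z) s)
        (hP.hasDerivAt_integral_slopeOf (hP.vacuumInside_of_sub (hP.sub_extend Z)) h _
          hr).continuousAt continuous_subtype_val.continuousAt⟩
  else 0

/-- For small `δ` the operator is a contraction, because the unknown enters the right-hand side of
the reduced equation only through the matter, which carries a factor `δ`. -/
theorem exists_contracting (hP : P.Admissible) : ∃ δ₁ > 0, ∀ δ, 0 ≤ δ → δ ≤ δ₁ →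
    (∀ u, P.Sub u → ∀ r, 2 * P.M < r → 0 < r - 2 * (P.M + P.localMass δ u r)) ∧
      ContractingWith (1 / 2) (hP.shellOp δ) := by
  have hM := hP.M_pos
  have h6 := hP.six_mul_lt_outerRadius
  obtain ⟨δ₁, hδ₁, C, hC, h⟩ := hP.exists_slope_estimates
  set R := P.outerRadius
  have hR : 0 < R := by linarith
  set D := C / (4 * P.M) ^ 2 * R with hD
  have hD0 : 0 ≤ D := by positivity
  refine ⟨min δ₁ (1 / (2 * (D + 1))), lt_min hδ₁ (by positivity), fun δ hδ0 hδ => ?_⟩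
  obtain ⟨h1, h2⟩ := h δ hδ0 (hδ.trans (min_le_left _ _))
  have hden : ∀ u, P.Sub u → ∀ r, 2 * P.M < r → 0 < r - 2 * (P.M + P.localMass δ u r) :=
    fun u hu r hr => (h1 u hu r hr).2.2.1
  have hDδ : D * δ ≤ 1 / 2 := by
    have := hδ.trans (min_le_right _ _)
    rw [le_div_iff₀ (by positivity)] at this
    nlinarith
  refine ⟨hden, by rw [← NNReal.coe_lt_coe]; norm_num, LipschitzWith.of_dist_le_mul fun Z W => ?_⟩
  rw [ContinuousMap.dist_le (by positivity)]
  intro r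
  have hr : 2 * P.M < (r : ℝ) := by linarith [r.2.1]
  have hu := hP.sub_extend Z
  have hv := hP.sub_extend W
  rw [shellOp, shellOp, dif_pos (hden _ hu), dif_pos (hden _ hv), Real.dist_eq]
  simp only [ContinuousMap.coe_mk]
  have h4 : 2 * P.M < 4 * P.M := by linarith
  rw [sub_sub_sub_cancel_left, abs_sub_comm, ← intervalIntegral.integral_sub
    (hP.intervalIntegrable_slopeOf (hP.vacuumInside_of_sub hu) (hden _ hu) h4 hr)
    (hP.intervalIntegrable_slopeOf (hP.vacuumInside_of_sub hv) (hden _ hv) h4 hr),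
    ← Real.norm_eq_abs]
  have h5 := intervalIntegral.norm_integral_le_of_norm_le_const (a := 4 * P.M) (b := r)
    (f := fun s => P.slopeOf δ (hP.extend Z) s - P.slopeOf δ (hP.extend W) s)
    (C := C * δ * dist Z W / (4 * P.M) ^ 2) (fun s hs => by
      rw [uIoc_of_le r.2.1] at hs
      refine (h2 _ _ hu hv (dist Z W) (fun x _ => hP.abs_extend_sub_le Z W x) s
        (by linarith [hs.1])).trans ?_
      have := hs.1.le
      have hd0 : 0 ≤ dist Z W := dist_nonneg
      gcongr)
  refine h5.trans ?_
  have h7 : |(r : ℝ) - 4 * P.M| ≤ R := by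
    have := r.2.1
    have := r.2.2
    rw [abs_of_nonneg (by linarith)]; linarith
  have hd0 : 0 ≤ dist Z W := dist_nonneg
  calc _ ≤ C * δ * dist Z W / (4 * P.M) ^ 2 * R := by gcongr
    _ = D * δ * dist Z W := by rw [hD]; ring
    _ ≤ _ := by
      refine mul_le_mul_of_nonneg_right ?_ hd0
      simpa using hDδ

theorem exists_shell (hP : P.Admissible) : ∃ δ₁ > 0, ∀ δ, 0 < δ → δ ≤ δ₁ →
    ∃ y, P.IsShell δ y ∧ ∀ z, P.IsShell δ z → EqOn z y (Ioi (2 * P.M)) := by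
  have hM := hP.M_pos
  have h4 : 2 * P.M < 4 * P.M := by linarith
  obtain ⟨δ₁, hδ₁, h⟩ := hP.exists_contracting
  refine ⟨δ₁, hδ₁, fun δ hδ0 hδ => ?_⟩
  obtain ⟨hden, hT⟩ := h δ hδ0.le hδ
  set Z := ContractingWith.fixedPoint (hP.shellOp δ) hT with hZ
  have hfix : hP.shellOp δ Z = Z := hT.fixedPoint_isFixedPt
  set u := hP.extend Z with hu_def
  have hu : P.Sub u := hP.sub_extend Z
  have hvac := hP.vacuumInside_of_sub (δ := δ) hu
  set y : ℝ → ℝ := fun r => Real.log (√2 * P.E0) - ∫ s in (4 * P.M)..r, P.slopeOf δ u s with hy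
  have hyd : ∀ r, 2 * P.M < r → HasDerivAt y (-P.slopeOf δ u r) r := fun r hr =>
    hP.hasDerivAt_integral_slopeOf hvac (hden u hu) _ hr
  have hy4 : y (4 * P.M) = Real.log (√2 * P.E0) := by simp [hy]
  have hysub : P.Sub y :=
    ⟨fun r hr => (hyd r hr).continuousAt.continuousWithinAt,
      (hP.le_ySS_of_hasDerivAt hδ0.le hvac (hden u hu) hyd (hy4.trans hP.ySS_four_mul.symm)).2⟩
  have hyZ : ∀ r (hr : r ∈ Icc (4 * P.M) P.outerRadius), Z ⟨r, hr⟩ = y r := by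
    intro r hr
    conv_lhs => rw [← hfix]
    rw [shellOp, dif_pos (hden u hu)]
    rfl
  have hyu : EqOn u y (Icc (4 * P.M) P.outerRadius) := by
    intro r hr
    rw [hu_def, hP.extend_apply Z hr, hyZ r hr, min_eq_left (hysub.le_ySS r (by linarith [hr.1]))]
  have hslope : ∀ r, 2 * P.M < r → P.slopeOf δ u r = P.slopeOf δ y r := fun r hr =>
    hP.slopeOf_eq_of_eqOn hu hysub hyu hr
  have hyd' : ∀ r, 2 * P.M < r → HasDerivAt y (-P.slopeOf δ y r) r := fun r hr => by
    rw [← hslope r hr]; exact hyd r hr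
  have hyvac := hP.vacuumInside_of_sub (δ := δ) hysub
  refine ⟨y, ⟨?_, ?_, ?_, hy4, hyvac.rho_eq_zero⟩, ?_⟩
  · have h1 : ContDiffOn ℝ (0 + 1) y (Ioi (2 * P.M)) := by
      rw [contDiffOn_succ_iff_deriv_of_isOpen isOpen_Ioi]
      refine ⟨fun r hr => (hyd' r hr).differentiableAt.differentiableWithinAt, by simp, ?_⟩
      rw [contDiffOn_zero]
      exact (hP.continuousOn_slopeOf hyvac (hden y hysub)).neg.congr
        fun r hr => (hyd' r hr).deriv
    simpa using h1
  · intro r hr h0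
    have hr0 : 0 < r := by linarith
    have h1 : r - 2 * (P.M + P.localMass δ y r) =
        r * (1 - 2 / r * (P.M + P.localMass δ y r)) := by field_simp
    have h2 := hden y hysub r hr
    rw [h1, h0, mul_zero] at h2
    exact lt_irrefl _ h2
  · intro r hr
    rw [slope_eq (by linarith)]
    exact hyd' r hr
  · intro z hz r hr
    have hzs := hz.sub hP hδ0.le
    set W : C(Icc (4 * P.M) P.outerRadius, ℝ) := ⟨fun r => z r, by
      refine hzs.cont.comp_continuous continuous_subtype_val fun r => ?_
      exact h4.trans_le r.2.1⟩ with hW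
    have hWz : EqOn (hP.extend W) z (Icc (4 * P.M) P.outerRadius) := by
      intro r hr
      rw [hP.extend_apply W hr]
      exact min_eq_left (hzs.le_ySS r (by linarith [hr.1]))
    have hWs : ∀ r, 2 * P.M < r → P.slopeOf δ (hP.extend W) r = P.slopeOf δ z r := fun r hr =>
      hP.slopeOf_eq_of_eqOn (hP.sub_extend W) hzs hWz hr
    have hint : ∀ (f g : ℝ → ℝ), (∀ r, 2 * P.M < r → f r = g r) → ∀ r, 2 * P.M < r →
        ∫ s in (4 * P.M)..r, f s = ∫ s in (4 * P.M)..r, g s := fun f g hfg r hr =>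
      intervalIntegral.integral_congr fun s hs => hfg s ((lt_min h4 hr).trans_le hs.1)
    have hWfix : hP.shellOp δ W = W := by
      ext r
      have hr : 2 * P.M < (r : ℝ) := h4.trans_le r.2.1
      rw [shellOp, dif_pos (hden _ (hP.sub_extend W))]
      simp only [ContinuousMap.coe_mk]
      rw [hint _ _ hWs r hr, hW]
      exact (hz.eq_integral hP hr).symm
    have hWZ : W = Z := hT.fixedPoint_unique hWfix
    rw [hz.eq_integral hP hr, hint _ _ (fun r hr => (hWs r hr).symm) r hr, hWZ]

end Admissible

end ShellParams

/-! ### The derivative of the right-hand side -/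

theorem hasDerivAt_slope {A N : ℝ → ℝ} {a n r : ℝ} (hr : 0 < r) (hden : 0 < r - 2 * A r)
    (hA : HasDerivAt A a r) (hN : HasDerivAt N n r) :
    HasDerivAt (fun r => slope (A r) (N r) r)
      (((a + n) * (r * (r - 2 * A r)) - (A r + N r) * (2 * r - 2 * A r - 2 * r * a)) /
        (r * (r - 2 * A r)) ^ 2) r := by
  have h := (hA.add hN).div ((hasDerivAt_id r).mul ((hasDerivAt_id r).sub (hA.const_mul 2)))
    (mul_pos hr hden).ne'
  unfold slope
  convert! h using 1
  simp only [Pi.mul_apply, Pi.sub_apply, Pi.add_apply, id]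
  ring

/-- The derivative of the right-hand side is close to its Schwarzschild value if the matter terms
and their derivatives are small. In terms of `1 / r` it is a continuous function on a compact box. -/
theorem exists_slope_deriv_sub_le {M ε : ℝ} (hM : 0 < M) (hε : 0 < ε) : ∃ η > 0, ∀ m N a n r,
    4 * M ≤ r → 0 ≤ m → m ≤ η → 0 ≤ N → N ≤ η → |a| ≤ η → |n| ≤ η →
      |((a + n) * (r * (r - 2 * (M + m))) - (M + m + N) * (2 * r - 2 * (M + m) - 2 * r * a)) /
          (r * (r - 2 * (M + m))) ^ 2 - -(M * (2 * r - 2 * M)) / (r * (r - 2 * M)) ^ 2| ≤ ε := by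
  set f : ℝ × ℝ × ℝ × ℝ × ℝ → ℝ := fun q =>
    q.1 ^ 2 * (q.2.2.2.1 + q.2.2.2.2) / (1 - 2 * q.2.1 * q.1) -
      q.1 ^ 3 * (q.2.1 + q.2.2.1) * (2 - 2 * q.2.1 * q.1 - 2 * q.2.2.2.1) /
        (1 - 2 * q.2.1 * q.1) ^ 2 with hf
  set S : Set (ℝ × ℝ × ℝ × ℝ × ℝ) := Icc 0 (1 / (4 * M)) ×ˢ Icc M (3 / 2 * M) ×ˢ Icc 0 M ×ˢ
    Icc (-1) 1 ×ˢ Icc (-1) 1 with hS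
  have hSc : IsCompact S := isCompact_Icc.prod (isCompact_Icc.prod (isCompact_Icc.prod
    (isCompact_Icc.prod isCompact_Icc)))
  have hpos : ∀ q ∈ S, 1 - 2 * q.2.1 * q.1 ≠ 0 := by
    rintro ⟨x, A, N, a, n⟩ ⟨hx, hA, -⟩
    simp only at hx hA ⊢
    have h1 : A * x ≤ 3 / 2 * M * (1 / (4 * M)) :=
      mul_le_mul hA.2 hx.2 hx.1 (by linarith)
    have h2 : 3 / 2 * M * (1 / (4 * M)) = 3 / 8 := by field_simp; norm_num
    have : 0 < 1 - 2 * A * x := by nlinarith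
    exact this.ne'
  have hfc : ContinuousOn f S := by
    refine ContinuousOn.sub (ContinuousOn.div (by fun_prop) (by fun_prop) hpos)
      (ContinuousOn.div (by fun_prop) (by fun_prop) fun q hq => pow_ne_zero 2 (hpos q hq))
  have hu := hSc.uniformContinuousOn_of_continuous hfc
  rw [Metric.uniformContinuousOn_iff_le] at hu
  obtain ⟨η, hη, h⟩ := hu ε hε
  refine ⟨min η (min (M / 2) 1), by positivity, fun m N a n r hr hm0 hm hN0 hN ha hn => ?_⟩
  have hη' : min η (min (M / 2) 1) ≤ η := min_le_left _ _
  have hM' : min η (min (M / 2) 1) ≤ M / 2 := (min_le_right _ _).trans (min_le_left _ _)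
  have h1' : min η (min (M / 2) 1) ≤ 1 := (min_le_right _ _).trans (min_le_right _ _)
  have hr0 : 0 < r := by linarith
  have hx : 1 / r ∈ Icc 0 (1 / (4 * M)) :=
    ⟨by positivity, one_div_le_one_div_of_le (by linarith) hr⟩
  have key : ∀ A N a n, 0 < r - 2 * A → f (1 / r, A, N, a, n) =
      ((a + n) * (r * (r - 2 * A)) - (A + N) * (2 * r - 2 * A - 2 * r * a)) /
        (r * (r - 2 * A)) ^ 2 := by
    intro A N a n hA
    have e : 1 - 2 * A * (1 / r) = (r - 2 * A) / r := by field_simp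
    have hA' := hA.ne'
    simp only [hf]
    rw [e]
    generalize hB : r - 2 * A = B at *
    have hA2 : A = (r - B) / 2 := by linarith
    subst hA2
    field_simp
  have hq := h (1 / r, M + m, N, a, n)
    ⟨hx, ⟨by linarith, by linarith⟩, ⟨hN0, by linarith⟩, abs_le.1 (ha.trans h1'),
      abs_le.1 (hn.trans h1')⟩
    (1 / r, M, 0, 0, 0) ⟨hx, ⟨le_rfl, by linarith⟩, ⟨le_rfl, hM.le⟩, by simp, by simp⟩ (by
      simp only [Prod.dist_eq, Real.dist_eq, sub_self, abs_zero, sub_zero, add_sub_cancel_left,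
        abs_of_nonneg hm0, abs_of_nonneg hN0]
      exact max_le hη.le (max_le (hm.trans hη') (max_le (hN.trans hη') (max_le (ha.trans hη')
        (hn.trans hη')))))
  rw [Real.dist_eq, key _ _ _ _ (by linarith), key _ _ _ _ (by linarith)] at hq
  convert! hq using 3
  ring

theorem tendsto_muSS {M : ℝ} : Tendsto (muSS M) atTop (𝓝 0) := by
  have h1 : Tendsto (fun r : ℝ => 1 - 2 * M / r) atTop (𝓝 1) := by
    have := (tendsto_const_nhds (x := (1 : ℝ))).sub
      ((tendsto_const_nhds (x := 2 * M)).div_atTop tendsto_id)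
    simpa using this
  have := (h1.log one_ne_zero).const_mul (1 / 2)
  rw [show muSS M = fun r => 1 / 2 * Real.log (1 - 2 * M / r) from rfl]
  simpa using this

namespace ShellParams

variable {P : ShellParams} {δ : ℝ} {u v y z : ℝ → ℝ} {r : ℝ}

/-! ### Limits and regularity of shells -/

theorem tendsto_ySS : Tendsto P.ySS atTop (𝓝 (Real.log P.E0)) := by
  have := (tendsto_const_nhds (x := Real.log P.E0)).sub (tendsto_muSS (M := P.M))
  rw [show P.ySS = fun r => Real.log P.E0 - muSS P.M r from rfl]
  simpa using this

theorem Admissible.log_E0_le_ySS (hP : P.Admissible) (hr : 2 * P.M < r) :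
    Real.log P.E0 ≤ P.ySS r := by
  have hM := hP.M_pos
  have h1 : Real.log (1 - 2 * P.M / r) ≤ 0 := by
    refine Real.log_nonpos (one_sub_pos hM hr).le ?_
    have : 0 ≤ 2 * P.M / r := div_nonneg (by linarith) (by linarith)
    linarith
  rw [ySS, muSS]
  linarith

theorem IsShell.tendsto_localMass (hP : P.Admissible) (hδ : 0 ≤ δ) (h : P.IsShell δ y) :
    Tendsto (P.localMass δ y) atTop (𝓝 (P.totalMass δ y)) ∧
      P.totalMass δ y = P.localMass δ y P.outerRadius := by
  have h1 : Tendsto (P.localMass δ y) atTop (𝓝 (P.localMass δ y P.outerRadius)) := by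
    refine tendsto_const_nhds.congr' ?_
    filter_upwards [eventually_ge_atTop P.outerRadius] with r hr
    exact (hP.localMass_outer (h.sub hP hδ) hr).symm
  have h2 : P.totalMass δ y = P.localMass δ y P.outerRadius := h1.limUnder_eq
  rw [h2]
  exact ⟨h1, rfl⟩

/-- If `-y'` is within `C δ / r²` of its Schwarzschild value, `y` is within `C δ / 4M` of `ySS`. -/
theorem IsShell.abs_sub_ySS_le (hP : P.Admissible) (hδ : 0 ≤ δ) (h : P.IsShell δ y) {C : ℝ}
    (hC : 0 ≤ C)
    (hs : ∀ r, 2 * P.M < r → |P.slopeOf δ y r - P.M / (r * (r - 2 * P.M))| ≤ C * δ / r ^ 2)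
    (hr : 2 * P.M < r) : |y r - P.ySS r| ≤ C * δ / (4 * P.M) := by
  have hM := hP.M_pos
  have hnn : 0 ≤ C * δ / (4 * P.M) := by positivity
  have h4 : y (4 * P.M) = P.ySS (4 * P.M) := h.initial.trans hP.ySS_four_mul.symm
  rcases le_total r (4 * P.M) with hr4 | hr4
  · rw [h.eq_ySS hP hδ hr hr4, sub_self, abs_zero]; exact hnn
  -- both signs of the deviation, corrected by `C δ / r`, decrease
  have key : ∀ σ : ℝ, |σ| = 1 → σ * (y r - P.ySS r) + C * δ * r⁻¹ ≤ C * δ * (4 * P.M)⁻¹ := by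
    intro σ hσ
    have hd : ∀ x, 2 * P.M < x → HasDerivAt (fun x => σ * (y x - P.ySS x) + C * δ * x⁻¹)
        (σ * (-P.slopeOf δ y x - -(P.M / (x * (x - 2 * P.M)))) + C * δ * -(x ^ 2)⁻¹) x :=
      fun x hx => (((h.hasDerivAt hP hx).sub (hP.hasDerivAt_ySS hx)).const_mul σ).add
        ((hasDerivAt_inv (by linarith : x ≠ 0)).const_mul (C * δ))
    have hanti : AntitoneOn (fun x => σ * (y x - P.ySS x) + C * δ * x⁻¹) (Ioi (2 * P.M)) := by
      refine antitoneOn_of_deriv_nonpos (convex_Ioi _) (fun x hx =>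
        (hd x hx).continuousAt.continuousWithinAt) ?_ ?_
      · intro x hx
        rw [interior_Ioi] at hx
        exact (hd x hx).differentiableAt.differentiableWithinAt
      · intro x hx
        rw [interior_Ioi] at hx
        rw [(hd x hx).deriv]
        have h1 := hs x hx
        have h2 : σ * (-P.slopeOf δ y x - -(P.M / (x * (x - 2 * P.M)))) ≤
            C * δ / x ^ 2 := by
          refine (le_abs_self _).trans ?_
          rw [abs_mul, hσ, one_mul, neg_sub_neg, abs_sub_comm]
          exact h1
        rw [div_eq_mul_inv (C * δ)] at h2
        linarith
    have := hanti (show 2 * P.M < 4 * P.M by linarith) (show 2 * P.M < r from hr) hr4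
    simpa [h4] using this
  have h1 := key 1 (by simp)
  have h2 := key (-1) (by simp)
  have h3 : 0 ≤ C * δ * r⁻¹ := mul_nonneg (mul_nonneg hC hδ) (inv_nonneg.2 (by linarith))
  rw [div_eq_mul_inv, abs_le]
  constructor <;> linarith

/-- `y` is decreasing and bounded from below, so it has a limit at infinity. -/
theorem IsShell.tendsto (hP : P.Admissible) (hδ : 0 ≤ δ) (h : P.IsShell δ y) {c : ℝ}
    (hc : ∀ r, 2 * P.M < r → |y r - P.ySS r| ≤ c) :
    Tendsto y atTop (𝓝 (Real.log (cutoffEnergy y))) ∧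
      |Real.log (cutoffEnergy y) - Real.log P.E0| ≤ c := by
  have hM := hP.M_pos
  have hanti : AntitoneOn y (Ioi (2 * P.M)) := by
    refine antitoneOn_of_deriv_nonpos (convex_Ioi _) h.contDiffOn.continuousOn ?_ ?_
    · intro x hx
      rw [interior_Ioi] at hx
      exact (h.hasDerivAt hP hx).differentiableAt.differentiableWithinAt
    · intro x hx
      rw [interior_Ioi] at hx
      have hx' : 2 * P.M < x := hx
      rw [(h.hasDerivAt hP hx).deriv, neg_nonpos, slopeOf, slope]
      have h1 := h.denom_pos hP hx
      have h2 := hP.localMass_nonneg h.vacuumInside hδ hx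
      have h3 := hP.pressureTerm_nonneg (u := y) hδ (by linarith : 0 < x)
      have h4 : 0 < x := by linarith
      positivity
  have hlim : ∃ ℓ, Tendsto y atTop (𝓝 ℓ) := by
    have h1 : Antitone fun r => y (max r (4 * P.M)) := fun a b hab =>
      hanti (show 2 * P.M < max a (4 * P.M) from lt_max_of_lt_right (by linarith))
        (show 2 * P.M < max b (4 * P.M) from lt_max_of_lt_right (by linarith))
        (max_le_max_right _ hab)
    have h2 : BddBelow (range fun r => y (max r (4 * P.M))) := by
      refine ⟨Real.log P.E0 - c, ?_⟩
      rintro _ ⟨r, rfl⟩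
      have hr : 2 * P.M < max r (4 * P.M) := lt_max_of_lt_right (by linarith)
      have := (abs_le.1 (hc _ hr)).1
      have := hP.log_E0_le_ySS hr
      simp only
      linarith
    refine ⟨_, (tendsto_atTop_ciInf h1 h2).congr' ?_⟩
    filter_upwards [eventually_ge_atTop (4 * P.M)] with r hr
    rw [max_eq_left hr]
  obtain ⟨ℓ, hℓ⟩ := hlim
  have h1 : Real.log (cutoffEnergy y) = ℓ := by
    rw [cutoffEnergy, Real.log_exp, hℓ.limUnder_eq]
  rw [h1]
  refine ⟨hℓ, le_of_tendsto (hℓ.sub tendsto_ySS).abs ?_⟩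
  filter_upwards [eventually_gt_atTop (2 * P.M)] with r hr
  exact hc r hr

theorem IsShell.hasDerivAt_mu (hP : P.Admissible) (h : P.IsShell δ y) (hr : 2 * P.M < r) :
    HasDerivAt (mu y) (P.slopeOf δ y r) r := by
  have := (h.hasDerivAt hP hr).const_sub (Real.log (cutoffEnergy y))
  rwa [neg_neg] at this

variable (P) in
/-- The term `4 π r³ p` divided by `δ`, as a function of the radius and `y`. -/
def pressureFun (q : ℝ × ℝ) : ℝ :=
  4 * Real.pi * q.1 ^ 3 * (P.χ (q.1 - P.r₀) * P.H q.1 q.2)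

theorem pressureTerm_eq : P.pressureTerm δ u = fun r => δ * P.pressureFun (r, u r) := by
  ext r
  rw [pressureTerm, pressure, pressureFun]
  ring

theorem Admissible.contDiffOn_pressureFun (hP : P.Admissible) :
    ContDiffOn ℝ 1 P.pressureFun (Ioi 0 ×ˢ univ) := by
  unfold pressureFun
  refine ContDiffOn.mul (by fun_prop) (ContDiffOn.mul ?_ hP.contDiffOn_H)
  exact ((hP.chi_smooth.of_le (by exact_mod_cast le_top)).comp
    (by fun_prop : ContDiff ℝ 1 fun q : ℝ × ℝ => q.1 - P.r₀)).contDiffOn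

theorem IsShell.hasDerivAt_pressureTerm (hP : P.Admissible) (h : P.IsShell δ y)
    (hr : 2 * P.M < r) :
    HasDerivAt (P.pressureTerm δ y)
      (δ * fderiv ℝ P.pressureFun (r, y r) (1, -P.slopeOf δ y r)) r := by
  have hr0 : 0 < r := by linarith [hP.M_pos]
  have hopen : IsOpen (Ioi (0 : ℝ) ×ˢ (univ : Set ℝ)) := isOpen_Ioi.prod isOpen_univ
  have h1 := ((hP.contDiffOn_pressureFun.differentiableOn one_ne_zero).differentiableAt
    (hopen.mem_nhds (show (r, y r) ∈ Ioi (0 : ℝ) ×ˢ univ from ⟨hr0, mem_univ _⟩))).hasFDerivAt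
  have h2 := (hasDerivAt_id r).prodMk (h.hasDerivAt hP hr)
  rw [pressureTerm_eq]
  exact (h1.comp_hasDerivAt r h2).const_mul δ

theorem IsShell.contDiffOn_mu (hP : P.Admissible) (h : P.IsShell δ y) :
    ContDiffOn ℝ 2 (mu y) (Ioi (2 * P.M)) := by
  have hM := hP.M_pos
  have hm : ContDiffOn ℝ 1 (P.localMass δ y) (Ioi (2 * P.M)) := by
    have h1 : ContDiffOn ℝ (0 + 1) (P.localMass δ y) (Ioi (2 * P.M)) := by
      rw [contDiffOn_succ_iff_deriv_of_isOpen isOpen_Ioi]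
      refine ⟨fun r hr => (hP.hasDerivAt_localMass h.vacuumInside
        hr).differentiableAt.differentiableWithinAt, by simp, ?_⟩
      rw [contDiffOn_zero]
      exact (continuousOn_const.mul (hP.continuousOn_integrand h.contDiffOn.continuousOn)).congr
        fun r hr => (hP.hasDerivAt_localMass h.vacuumInside hr).deriv
    simpa using h1
  have hp : ContDiffOn ℝ 1 (P.pressureTerm δ y) (Ioi (2 * P.M)) := by
    rw [pressureTerm_eq]
    exact contDiffOn_const.mul (hP.contDiffOn_pressureFun.comp (contDiffOn_id.prodMk h.contDiffOn)
      fun r hr => ⟨show 0 < r by linarith [mem_Ioi.1 hr], mem_univ _⟩)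
  have hs : ContDiffOn ℝ 1 (P.slopeOf δ y) (Ioi (2 * P.M)) := by
    refine ContDiffOn.div ((contDiffOn_const.add hm).add hp)
      (contDiffOn_id.mul (contDiffOn_id.sub
        (contDiffOn_const.mul (contDiffOn_const.add hm)))) fun r hr => ?_
    exact (mul_pos (by linarith [mem_Ioi.1 hr] : 0 < r) (h.denom_pos hP hr)).ne'
  have h2 : ContDiffOn ℝ (1 + 1) (mu y) (Ioi (2 * P.M)) := by
    rw [contDiffOn_succ_iff_deriv_of_isOpen isOpen_Ioi]
    exact ⟨fun r hr => (h.hasDerivAt_mu hP hr).differentiableAt.differentiableWithinAt, by simp,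
      hs.congr fun r hr => (h.hasDerivAt_mu hP hr).deriv⟩
  rwa [one_add_one_eq_two] at h2

/-! ### Convergence to the Schwarzschild case -/

namespace Admissible

theorem exists_shell_estimates (hP : P.Admissible) : ∃ δ₁ > 0, ∃ C, 0 ≤ C ∧
    ∀ δ, 0 < δ → δ ≤ δ₁ → ∀ y, P.IsShell δ y →
      |Real.log (cutoffEnergy y) - Real.log P.E0| ≤ C * δ ∧
      Tendsto y atTop (𝓝 (Real.log (cutoffEnergy y))) ∧
      ∀ r, 2 * P.M < r → |P.rho δ y r| ≤ C * δ ∧ |P.pressure δ y r| ≤ C * δ ∧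
        |P.pressureTerm δ y r| ≤ C * δ ∧ |P.localMass δ y r| ≤ C * δ ∧
        |y r - P.ySS r| ≤ C * δ ∧ P.localMass δ y r ≤ P.M / 2 ∧
        |P.slopeOf δ y r - P.M / (r * (r - 2 * P.M))| ≤ C * δ := by
  have hM := hP.M_pos
  obtain ⟨K, hK, hb⟩ := hP.exists_matter_le
  obtain ⟨δ₁, hδ₁, C, hC, hs⟩ := hP.exists_slope_estimates
  refine ⟨δ₁, hδ₁, K + C / (4 * P.M) + C / (2 * P.M) ^ 2, by positivity,
    fun δ hδ0 hδ y hy => ?_⟩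
  have hsub := hy.sub hP hδ0.le
  have h1 := (hs δ hδ0.le hδ).1 y hsub
  have h2 : ∀ r, 2 * P.M < r → |y r - P.ySS r| ≤ C * δ / (4 * P.M) := fun r hr =>
    hy.abs_sub_ySS_le hP hδ0.le hC (fun r hr => (h1 r hr).2.2.2) hr
  obtain ⟨h3, h4⟩ := hy.tendsto hP hδ0.le h2
  have e0 : 0 ≤ K * δ := by positivity
  have e1 : 0 ≤ C * δ / (4 * P.M) := by positivity
  have e2 : 0 ≤ C * δ / (2 * P.M) ^ 2 := by positivity
  have e : (K + C / (4 * P.M) + C / (2 * P.M) ^ 2) * δ =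
      K * δ + C * δ / (4 * P.M) + C * δ / (2 * P.M) ^ 2 := by ring
  rw [e]
  refine ⟨h4.trans (by linarith), h3, fun r hr => ?_⟩
  obtain ⟨b1, b2, b3, b4⟩ := hb δ hδ0.le y hsub r hr
  obtain ⟨s1, -, -, s4⟩ := h1 r hr
  have s5 : C * δ / r ^ 2 ≤ C * δ / (2 * P.M) ^ 2 := by gcongr
  exact ⟨b1.trans (by linarith), b2.trans (by linarith), b3.trans (by linarith),
    b4.trans (by linarith), (h2 r hr).trans (by linarith), s1, s4.trans (by linarith)⟩

/-- The derivatives of the local mass and of `4 π r³ p` are of size `δ`. -/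
theorem exists_matter_deriv_le (hP : P.Admissible) : ∃ δ₁ > 0, ∃ C, 0 ≤ C ∧
    ∀ δ, 0 < δ → δ ≤ δ₁ → ∀ y, P.IsShell δ y → ∀ r, 4 * P.M ≤ r →
      |4 * Real.pi * (r ^ 2 * P.rho δ y r)| ≤ C * δ ∧
      ∃ n, HasDerivAt (P.pressureTerm δ y) n r ∧ |n| ≤ C * δ := by
  have hM := hP.M_pos
  have hR := hP.six_mul_lt_outerRadius
  obtain ⟨δ₁, hδ₁, C, hC, h⟩ := hP.exists_shell_estimates
  have hS : IsCompact (Icc (4 * P.M) P.outerRadius ×ˢ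
      Icc (Real.log P.E0 - C * δ₁) (Real.log (√2 * P.E0))) := isCompact_Icc.prod isCompact_Icc
  have hopen : IsOpen (Ioi (0 : ℝ) ×ˢ (univ : Set ℝ)) := isOpen_Ioi.prod isOpen_univ
  obtain ⟨D, hD⟩ := hS.exists_bound_of_continuousOn (f := fderiv ℝ P.pressureFun)
    ((hP.contDiffOn_pressureFun.continuousOn_fderiv_of_isOpen hopen le_rfl).mono fun q hq =>
      ⟨show 0 < q.1 by linarith [hq.1.1], mem_univ _⟩)
  set B := 1 + C * δ₁ + P.M / (4 * P.M * (4 * P.M - 2 * P.M)) with hB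
  have hB0 : 0 ≤ P.M / (4 * P.M * (4 * P.M - 2 * P.M)) :=
    div_nonneg hM.le (mul_nonneg (by linarith) (by linarith))
  have hB1 : 1 ≤ B := by
    have : 0 ≤ C * δ₁ := by positivity
    linarith
  have hpi := Real.pi_pos
  refine ⟨δ₁, hδ₁, 4 * Real.pi * (P.outerRadius ^ 2 * C) + |D| * B, by positivity,
    fun δ hδ0 hδ y hy r hr => ?_⟩
  have hr2 : 2 * P.M < r := by linarith
  have hr0 : 0 < r := by linarith
  have hsub := hy.sub hP hδ0.le
  obtain ⟨-, -, hest⟩ := h δ hδ0 hδ y hy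
  have e1 : 0 ≤ 4 * Real.pi * (P.outerRadius ^ 2 * C) * δ := by positivity
  have e2 : 0 ≤ |D| * B * δ := by positivity
  rw [add_mul]
  rcases lt_or_ge P.outerRadius r with h' | h'
  · have hz : ∀ x, P.outerRadius ≤ x → P.rho δ y x = 0 := fun x hx =>
      hP.rho_eq_zero_outer (hsub.le_ySS x (by linarith)) hx
    refine ⟨by rw [hz r h'.le]; simp only [mul_zero, abs_zero]; linarith, 0, ?_, by
      rw [abs_zero]; linarith⟩
    refine (hasDerivAt_const r (0 : ℝ)).congr_of_eventuallyEq ?_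
    filter_upwards [Ioi_mem_nhds h'] with x hx
    have hx' : P.outerRadius < x := hx
    exact hP.pressureTerm_eq_zero (by linarith) (hz x hx'.le)
  · obtain ⟨b1, -, -, -, b5, -, b7⟩ := hest r hr2
    constructor
    · rw [abs_mul (4 * Real.pi), abs_mul (r ^ 2), abs_of_nonneg (by positivity : 0 ≤ 4 * Real.pi),
        abs_of_nonneg (sq_nonneg r)]
      have : 4 * Real.pi * (r ^ 2 * |P.rho δ y r|) ≤
          4 * Real.pi * (P.outerRadius ^ 2 * (C * δ)) := by gcongr
      linarith
    · refine ⟨_, hy.hasDerivAt_pressureTerm hP hr2, ?_⟩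
      have hCδ : C * δ ≤ C * δ₁ := by gcongr
      have hmem : (r, y r) ∈ Icc (4 * P.M) P.outerRadius ×ˢ
          Icc (Real.log P.E0 - C * δ₁) (Real.log (√2 * P.E0)) := by
        refine ⟨⟨hr, h'⟩, ?_, (hsub.le_ySS r hr2).trans (hP.ySS_le hr)⟩
        have := hP.log_E0_le_ySS hr2
        have := (abs_le.1 b5).1
        simp only
        linarith
      have h1 : |P.slopeOf δ y r| ≤ B := by
        have h2 : P.M / (r * (r - 2 * P.M)) ≤ P.M / (4 * P.M * (4 * P.M - 2 * P.M)) := by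
          have : 0 < 4 * P.M - 2 * P.M := by linarith
          gcongr
        have h3 : 0 ≤ P.M / (r * (r - 2 * P.M)) :=
          div_nonneg hM.le (mul_nonneg hr0.le (by linarith))
        have h4 := abs_le.1 b7
        rw [abs_le]
        constructor <;> linarith
      have h2 : ‖((1 : ℝ), -P.slopeOf δ y r)‖ ≤ B := by
        rw [Prod.norm_mk]
        refine max_le (by simpa using hB1) (by simpa using h1)
      have h3 := (fderiv ℝ P.pressureFun (r, y r)).le_of_opNorm_le
        ((hD _ hmem).trans (le_abs_self D)) ((1 : ℝ), -P.slopeOf δ y r)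
      rw [abs_mul, abs_of_pos hδ0, ← Real.norm_eq_abs]
      have h4 := h3.trans (mul_le_mul_of_nonneg_left h2 (abs_nonneg D))
      have := mul_le_mul_of_nonneg_left h4 hδ0.le
      linarith

theorem hasDerivAt_slopeSS (hP : P.Admissible) (hr : 2 * P.M < r) :
    HasDerivAt (fun r => P.M / (r * (r - 2 * P.M)))
      (-(P.M * (2 * r - 2 * P.M)) / (r * (r - 2 * P.M)) ^ 2) r := by
  have hM := hP.M_pos
  have := hasDerivAt_slope (A := fun _ => P.M) (N := fun _ => 0) (r := r) (by linarith)
    (by linarith) (hasDerivAt_const r P.M) (hasDerivAt_const r 0)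
  simp only [slope, add_zero] at this
  convert! this using 1
  ring

theorem exists_slopeOf_deriv_le (hP : P.Admissible) {ε : ℝ} (hε : 0 < ε) : ∃ δ₁ > 0,
    ∀ δ, 0 < δ → δ ≤ δ₁ → ∀ y, P.IsShell δ y → ∀ r, 2 * P.M < r →
      ∃ d, HasDerivAt (P.slopeOf δ y) d r ∧
        |d - -(P.M * (2 * r - 2 * P.M)) / (r * (r - 2 * P.M)) ^ 2| ≤ ε := by
  have hM := hP.M_pos
  obtain ⟨δ₁, hδ₁, C, hC, h⟩ := hP.exists_shell_estimates
  obtain ⟨δ₂, hδ₂, C', hC', h'⟩ := hP.exists_matter_deriv_le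
  obtain ⟨η, hη, hη'⟩ := exists_slope_deriv_sub_le hM hε
  refine ⟨min (min δ₁ δ₂) (η / (C + C' + 1)), by positivity, fun δ hδ0 hδ y hy r hr => ?_⟩
  have hδ1 : δ ≤ δ₁ := hδ.trans ((min_le_left _ _).trans (min_le_left _ _))
  have hδ2 : δ ≤ δ₂ := hδ.trans ((min_le_left _ _).trans (min_le_right _ _))
  have hδ3 : C * δ ≤ η ∧ C' * δ ≤ η := by
    have := hδ.trans (min_le_right _ _)
    rw [le_div_iff₀ (by positivity)] at this
    have a1 : 0 ≤ C * δ := by positivity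
    have a2 : 0 ≤ C' * δ := by positivity
    constructor <;> linarith
  have hr0 : 0 < r := by linarith
  rcases lt_or_ge r (4 * P.M) with h4 | h4
  · refine ⟨_, (hP.hasDerivAt_slopeSS hr).congr_of_eventuallyEq ?_, by simpa using hε.le⟩
    filter_upwards [Ioo_mem_nhds hr h4] with x hx
    exact hP.slopeOf_eq_of_le hy.vacuumInside hx.1 hx.2.le
  · obtain ⟨-, -, hest⟩ := h δ hδ0 hδ1 y hy
    obtain ⟨-, -, b3, b4, -, -, -⟩ := hest r hr
    obtain ⟨d1, n, hn, d2⟩ := h' δ hδ0 hδ2 y hy r h4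
    have hA := (hP.hasDerivAt_localMass hy.vacuumInside hr).const_add P.M
    refine ⟨_, hasDerivAt_slope hr0 (hy.denom_pos hP hr) hA hn, ?_⟩
    exact hη' _ _ _ _ _ h4 (hP.localMass_nonneg hy.vacuumInside hδ0.le hr)
      ((le_abs_self _).trans (b4.trans hδ3.1)) (hP.pressureTerm_nonneg hδ0.le hr0)
      ((le_abs_self _).trans (b3.trans hδ3.1)) (d1.trans hδ3.2) (d2.trans hδ3.2)

end Admissible

end ShellParams

namespace ShellParams

variable {P : ShellParams} {δ : ℝ} {u v y z : ℝ → ℝ} {r L : ℝ}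

/-! ### Single-well structure -/

theorem exp_mu (y : ℝ → ℝ) (r : ℝ) : Real.exp (mu y r) = cutoffEnergy y * Real.exp (-y r) := by
  rw [mu, sub_eq_add_neg, Real.exp_add, Real.exp_log (show 0 < cutoffEnergy y from Real.exp_pos _)]

theorem effPot_lt_iff (hL : 0 ≤ L) :
    (P.shell δ y).effPot L r < cutoffEnergy y ↔ energyRatio L r (y r) < 1 := by
  have h0 : 0 < cutoffEnergy y := Real.exp_pos _
  rw [energyRatio_lt_one_iff hL, SteadyState.effPot, shell, exp_mu, mul_assoc]
  exact mul_lt_iff_lt_one_right h0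

/-- The density is positive wherever `Ψ_L < E^δ` beyond the cut-off region, so the condition `ρ > 0`
only confines the well to the matter region. -/
theorem IsShell.mem_wellSet_iff (hP : P.Admissible) (hδ : 0 < δ) (h : P.IsShell δ y)
    (hL : P.L₀ ≤ L) : r ∈ (P.shell δ y).wellSet L ↔
      P.r₀ + P.η₀ < r ∧ r < P.outerRadius ∧ (P.shell δ y).effPot L r < cutoffEnergy y := by
  have hsub := h.sub hP hδ.le
  have hL0 := hP.L₀_pos
  have h3 := hP.three_mul_lt_r₀
  have hM := hP.M_pos
  have hη := hP.η₀_pos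
  constructor
  · rintro ⟨h1, h2, hρ⟩
    have h1' : 2 * P.M < r := h1
    have hρ' : 0 < P.rho δ y r := hρ
    refine ⟨?_, ?_, h2⟩
    · by_contra hc
      exact hρ'.ne' (hP.rho_eq_zero_inner (hsub.le_ySS r h1') (Or.inr (not_lt.1 hc)))
    · by_contra hc
      exact hρ'.ne' (hP.rho_eq_zero_outer (hsub.le_ySS r h1') (not_lt.1 hc))
  · rintro ⟨h1, -, h2⟩
    have hr : 0 < r := by linarith
    refine ⟨show 2 * P.M < r by linarith, h2, ?_⟩
    rw [effPot_lt_iff (hL0.le.trans hL)] at h2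
    have h4 : energyRatio P.L₀ r (y r) < 1 := by
      refine lt_of_le_of_lt ?_ h2
      unfold energyRatio
      gcongr
    have h5 := hP.G_pos hr h4
    show 0 < P.rho δ y r
    rw [rho, hP.chi_one _ (by linarith), mul_one]
    exact mul_pos hδ h5

theorem IsShell.hasDerivAt_effPot (hP : P.Admissible) (h : P.IsShell δ y) (hL : 0 ≤ L)
    (hr : 2 * P.M < r) : HasDerivAt ((P.shell δ y).effPot L)
      ((P.shell δ y).effPot L r * (P.slopeOf δ y r - L / (r * (r ^ 2 + L)))) r :=
  hasDerivAt_exp_mul_sqrt_angular hL (by linarith [hP.M_pos]) (h.hasDerivAt_mu hP hr)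

/-- The effective potential attains a minimum in the well, because it is at least `E^δ` at both
ends of the region with matter. -/
theorem IsShell.exists_critical (hP : P.Admissible) (hδ : 0 < δ) (h : P.IsShell δ y)
    (hL : P.L₀ ≤ L) (hne : ((P.shell δ y).wellSet L).Nonempty) :
    ∃ r ∈ (P.shell δ y).wellSet L, HasDerivAt ((P.shell δ y).effPot L) 0 r := by
  have hsub := h.sub hP hδ.le
  have hL0 := hP.L₀_pos
  have hL' := hL0.le.trans hL
  have h3 := hP.three_mul_lt_r₀
  have hM := hP.M_pos
  have hη := hP.η₀_pos
  obtain ⟨x, hx⟩ := hne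
  obtain ⟨hx1, hx2, hx3⟩ := (h.mem_wellSet_iff hP hδ hL).1 hx
  have hc : ContinuousOn ((P.shell δ y).effPot L) (Icc (P.r₀ + P.η₀) P.outerRadius) :=
    fun r hr => (h.hasDerivAt_effPot hP hL' (by linarith [hr.1])).continuousAt.continuousWithinAt
  obtain ⟨m, hm, hmin⟩ := isCompact_Icc.exists_isMinOn ⟨x, hx1.le, hx2.le⟩ hc
  have hmx : (P.shell δ y).effPot L m < cutoffEnergy y := (hmin ⟨hx1.le, hx2.le⟩).trans_lt hx3
  have hm1 : P.r₀ + P.η₀ < m := by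
    refine lt_of_le_of_ne hm.1 ?_
    rintro rfl
    rw [effPot_lt_iff hL'] at hmx
    have h4 := hP.one_lt_energyRatio (r := P.r₀ + P.η₀) (by linarith) (Or.inr le_rfl)
      (hsub.le_ySS _ (by linarith))
    have h5 : energyRatio P.L₀ (P.r₀ + P.η₀) (y (P.r₀ + P.η₀)) ≤
        energyRatio L (P.r₀ + P.η₀) (y (P.r₀ + P.η₀)) := by
      unfold energyRatio
      gcongr
    linarith
  have hm2 : m < P.outerRadius := by
    refine lt_of_le_of_ne hm.2 ?_
    rintro rfl
    rw [effPot_lt_iff hL'] at hmx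
    have := one_le_energyRatio_of_nonpos (r := P.outerRadius) hL'
      ((hsub.le_ySS _ (by linarith)).trans (hP.ySS_nonpos le_rfl))
    linarith
  have hd := h.hasDerivAt_effPot hP hL' (by linarith : 2 * P.M < m)
  have hloc : IsLocalMin ((P.shell δ y).effPot L) m := hmin.isLocalMin (Icc_mem_nhds hm1 hm2)
  refine ⟨m, (h.mem_wellSet_iff hP hδ hL).2 ⟨hm1, hm2, hmx⟩, ?_⟩
  rw [hloc.hasDerivAt_eq_zero hd] at hd
  exact hd

/-- If `1 - r F > 0` and `3 F + r F' - 2 r F² > 0`, then `L = r³ F / (1 - r F)`, the equation of a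
critical radius of the effective potential with `μ' = F`, has at most one solution `r`. -/
theorem eq_of_critical {F F' : ℝ → ℝ} {a b r₁ r₂ : ℝ} (ha : 0 < a) (hL : 0 ≤ L)
    (hF : ∀ r ∈ Icc a b, HasDerivAt F (F' r) r) (hpos : ∀ r ∈ Icc a b, 0 < 1 - r * F r)
    (hW : ∀ r ∈ Icc a b, 0 < 3 * F r + r * F' r - 2 * r * F r ^ 2)
    (h₁ : r₁ ∈ Icc a b) (h₂ : r₂ ∈ Icc a b) (hc₁ : F r₁ = L / (r₁ * (r₁ ^ 2 + L)))
    (hc₂ : F r₂ = L / (r₂ * (r₂ ^ 2 + L))) : r₁ = r₂ := by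
  have hd : ∀ r ∈ Icc a b, HasDerivAt (fun r => r ^ 3 * F r / (1 - r * F r))
      (r ^ 2 * (3 * F r + r * F' r - 2 * r * F r ^ 2) / (1 - r * F r) ^ 2) r := by
    intro r hr
    have := ((hasDerivAt_pow 3 r).mul (hF r hr)).div
      (((hasDerivAt_id r).mul (hF r hr)).const_sub 1) (hpos r hr).ne'
    convert! this using 1
    simp only [Pi.mul_apply, id]
    push_cast
    ring
  have hmono : StrictMonoOn (fun r => r ^ 3 * F r / (1 - r * F r)) (Icc a b) := by
    refine strictMonoOn_of_deriv_pos (convex_Icc a b)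
      (fun r hr => (hd r hr).continuousAt.continuousWithinAt) fun r hr => ?_
    have hr' := interior_subset hr
    rw [(hd r hr').deriv]
    have h1 := hpos r hr'
    have h2 := hW r hr'
    have h3 : 0 < r := ha.trans_le hr'.1
    positivity
  have hval : ∀ r ∈ Icc a b, F r = L / (r * (r ^ 2 + L)) →
      r ^ 3 * F r / (1 - r * F r) = L := by
    intro r hr hc
    have hr0 : 0 < r := ha.trans_le hr.1
    have h1 : 1 - r * F r = r ^ 2 / (r ^ 2 + L) := by
      rw [hc]; field_simp; ring
    rw [h1, hc]
    field_simp
  exact hmono.injOn h₁ h₂ ((hval r₁ h₁ hc₁).trans (hval r₂ h₂ hc₂).symm)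

theorem Admissible.exists_slopeOf_close (hP : P.Admissible) {ε : ℝ} (hε : 0 < ε) : ∃ δ₁ > 0,
    ∀ δ, 0 < δ → δ ≤ δ₁ → ∀ y, P.IsShell δ y → ∀ r, 2 * P.M < r →
      |P.slopeOf δ y r - P.M / (r * (r - 2 * P.M))| ≤ ε ∧ ∃ d, HasDerivAt (P.slopeOf δ y) d r ∧
        |d - -(P.M * (2 * r - 2 * P.M)) / (r * (r - 2 * P.M)) ^ 2| ≤ ε := by
  obtain ⟨δ₁, hδ₁, C, hC, h⟩ := hP.exists_shell_estimates
  obtain ⟨δ₂, hδ₂, h'⟩ := hP.exists_slopeOf_deriv_le hε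
  refine ⟨min (min δ₁ δ₂) (ε / (C + 1)), by positivity, fun δ hδ0 hδ y hy r hr => ?_⟩
  have hδ1 : δ ≤ δ₁ := hδ.trans ((min_le_left _ _).trans (min_le_left _ _))
  have hδ2 : δ ≤ δ₂ := hδ.trans ((min_le_left _ _).trans (min_le_right _ _))
  have hδ3 : C * δ ≤ ε := by
    have := hδ.trans (min_le_right _ _)
    rw [le_div_iff₀ (by positivity)] at this
    linarith
  exact ⟨((h δ hδ0 hδ1 y hy).2.2 r hr).2.2.2.2.2.2.trans hδ3, h' δ hδ0 hδ2 y hy r hr⟩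

/-- In the Schwarzschild case, critical radii beyond the cut-off region for `L ≥ L₀` lie beyond
`6M`, with a uniform margin. -/
theorem Admissible.exists_inner_margin (hP : P.Admissible) : ∃ ρ₁, 6 * P.M < ρ₁ ∧ ∃ c > 0,
    ∀ r ∈ Icc (P.r₀ + P.η₀) ρ₁,
      c ≤ P.L₀ / (r * (r ^ 2 + P.L₀)) - P.M / (r * (r - 2 * P.M)) := by
  have hM := hP.M_pos
  have hL0 := hP.L₀_pos
  have hη := hP.η₀_pos
  obtain ⟨h3, h6, h6', hfac⟩ := critRadii_spec hM hP.L₀_gt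
  have hr0 : P.r₀ = sSS P.M P.L₀ := rfl
  set s := sSS P.M P.L₀
  set t := rSS P.M P.L₀
  refine ⟨(6 * P.M + t) / 2, by linarith, ?_⟩
  have hpos : ∀ r ∈ Icc (P.r₀ + P.η₀) ((6 * P.M + t) / 2), 0 < r ∧ 0 < r - 2 * P.M :=
    fun r hr => ⟨by linarith [hr.1], by linarith [hr.1]⟩
  refine (isCompact_Icc (a := P.r₀ + P.η₀) (b := (6 * P.M + t) / 2)).exists_forall_le' ?_ ?_
  · refine ContinuousOn.sub (ContinuousOn.div (by fun_prop) (by fun_prop) fun r hr => ?_)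
      (ContinuousOn.div (by fun_prop) (by fun_prop) fun r hr => ?_)
    · obtain ⟨h1, -⟩ := hpos r hr
      positivity
    · obtain ⟨h1, h2⟩ := hpos r hr
      positivity
  · intro r hr
    obtain ⟨h1, h2⟩ := hpos r hr
    have e : P.L₀ / (r * (r ^ 2 + P.L₀)) - P.M / (r * (r - 2 * P.M)) =
        -(P.M * (r - s) * (r - t)) / (r * (r - 2 * P.M) * (r ^ 2 + P.L₀)) := by
      rw [← hfac, div_sub_div _ _ (by positivity) (by positivity),
        div_eq_div_iff (by positivity) (by positivity)]
      ring
    rw [e]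
    have h5 : 0 < P.M * (r - s) * (t - r) :=
      mul_pos (mul_pos hM (by linarith [hr.1])) (by linarith [hr.2])
    have h6 : -(P.M * (r - s) * (r - t)) = P.M * (r - s) * (t - r) := by ring
    rw [h6]
    positivity

theorem Admissible.exists_outer_margin (hP : P.Admissible) {ρ₁ : ℝ} (hρ : 6 * P.M < ρ₁) :
    ∃ c > 0, ∀ r ∈ Icc ρ₁ P.outerRadius, c ≤ 3 * (P.M / (r * (r - 2 * P.M))) +
      r * (-(P.M * (2 * r - 2 * P.M)) / (r * (r - 2 * P.M)) ^ 2) -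
        2 * r * (P.M / (r * (r - 2 * P.M))) ^ 2 := by
  have hM := hP.M_pos
  have hpos : ∀ r ∈ Icc ρ₁ P.outerRadius, 0 < r ∧ 0 < r - 2 * P.M :=
    fun r hr => ⟨by linarith [hr.1], by linarith [hr.1]⟩
  have hne : ∀ r ∈ Icc ρ₁ P.outerRadius, r * (r - 2 * P.M) ≠ 0 := fun r hr => by
    obtain ⟨h1, h2⟩ := hpos r hr
    positivity
  have hF : ContinuousOn (fun r => P.M / (r * (r - 2 * P.M))) (Icc ρ₁ P.outerRadius) :=
    ContinuousOn.div (by fun_prop) (by fun_prop) hne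
  refine (isCompact_Icc (a := ρ₁) (b := P.outerRadius)).exists_forall_le' ?_ ?_
  · exact ((continuousOn_const.mul hF).add (continuousOn_id.mul (ContinuousOn.div (by fun_prop)
      (by fun_prop) fun r hr => pow_ne_zero 2 (hne r hr)))).sub
      (ContinuousOn.mul (by fun_prop) (hF.pow 2))
  · intro r hr
    obtain ⟨h1, h2⟩ := hpos r hr
    have e : 3 * (P.M / (r * (r - 2 * P.M))) +
        r * (-(P.M * (2 * r - 2 * P.M)) / (r * (r - 2 * P.M)) ^ 2) -
        2 * r * (P.M / (r * (r - 2 * P.M))) ^ 2 = P.M * (r - 6 * P.M) / (r * (r - 2 * P.M) ^ 2) := by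
      have h2' := h2.ne'
      rw [div_pow, mul_div_assoc', mul_div_assoc', mul_div_assoc', div_add_div _ _ (by positivity)
        (by positivity), div_sub_div _ _ (by positivity) (by positivity),
        div_eq_div_iff (by positivity) (by positivity)]
      ring
    rw [e]
    have h3 : 0 < r - 6 * P.M := by linarith [hr.1]
    positivity

theorem Admissible.exists_singleWell (hP : P.Admissible) : ∃ δ₀ > 0, ∀ δ, 0 < δ → δ ≤ δ₀ →
    ∀ y : ℝ → ℝ, P.IsShell δ y → (P.shell δ y).HasSingleWell := by
  have hM := hP.M_pos
  have hL0 := hP.L₀_pos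
  have hη := hP.η₀_pos
  have h3 := hP.three_mul_lt_r₀
  obtain ⟨ρ₁, hρ₁, c₁, hc₁, hin⟩ := hP.exists_inner_margin
  obtain ⟨c₂, hc₂, hout⟩ := hP.exists_outer_margin hρ₁
  have hR : 0 < P.outerRadius := by linarith [hP.six_mul_lt_outerRadius]
  set R := P.outerRadius
  set D := 3 + R + 2 * R * (1 / (12 * P.M) + 1) with hD
  have hD0 : 0 < D := by positivity
  set ε := min (min (c₁ / 2) (c₂ / (2 * D))) (min 1 (1 / (4 * R))) with hε
  have hε0 : 0 < ε := by positivity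
  have e1 : ε ≤ c₁ / 2 := (min_le_left _ _).trans (min_le_left _ _)
  have e2 : ε * D ≤ c₂ / 2 := by
    have : ε ≤ c₂ / (2 * D) := (min_le_left _ _).trans (min_le_right _ _)
    rw [le_div_iff₀ (by positivity)] at this
    linarith
  have e3 : ε ≤ 1 := (min_le_right _ _).trans (min_le_left _ _)
  have e4 : R * ε ≤ 1 / 4 := by
    have : ε ≤ 1 / (4 * R) := (min_le_right _ _).trans (min_le_right _ _)
    rw [le_div_iff₀ (by positivity)] at this
    linarith
  obtain ⟨δ₁, hδ₁, h⟩ := hP.exists_slopeOf_close hε0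
  refine ⟨δ₁, hδ₁, fun δ hδ0 hδ y hy L hLpos hL hne => ?_⟩
  have hL : P.L₀ ≤ L := hL
  have hclose := h δ hδ0 hδ y hy
  obtain ⟨x, hx, hxc⟩ := hy.exists_critical hP hδ0 hL hne
  refine ⟨x, ⟨hx, hxc⟩, ?_⟩
  -- critical radii in the well are beyond `ρ₁`
  have hcrit : ∀ r, r ∈ (P.shell δ y).wellSet L → HasDerivAt ((P.shell δ y).effPot L) 0 r →
      r ∈ Icc ρ₁ R ∧ P.slopeOf δ y r = L / (r * (r ^ 2 + L)) := by
    intro r hr hd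
    obtain ⟨h1, h2, -⟩ := (hy.mem_wellSet_iff hP hδ0 hL).1 hr
    have hr2 : 2 * P.M < r := by linarith
    have hr0 : 0 < r := by linarith
    have hs : P.slopeOf δ y r = L / (r * (r ^ 2 + L)) :=
      (hasDerivAt_exp_mul_sqrt_angular_zero_iff hLpos.le hr0 (hy.hasDerivAt_mu hP hr2)).1 hd
    refine ⟨⟨?_, h2.le⟩, hs⟩
    by_contra hlt
    have h4 := hin r ⟨h1.le, (not_le.1 hlt).le⟩
    have h5 := (abs_le.1 (hclose r hr2).1).2
    have h6 : P.L₀ / (r * (r ^ 2 + P.L₀)) ≤ L / (r * (r ^ 2 + L)) := by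
      rw [div_le_div_iff₀ (by positivity) (by positivity)]
      have : 0 ≤ r ^ 3 * (L - P.L₀) := mul_nonneg (by positivity) (by linarith)
      linarith
    rw [hs] at h5
    linarith
  rintro z ⟨hz, hzc⟩
  obtain ⟨hz1, hz2⟩ := hcrit z hz hzc
  obtain ⟨hx1, hx2⟩ := hcrit x hx hxc
  have hderiv : ∀ r ∈ Icc ρ₁ R, HasDerivAt (P.slopeOf δ y) (deriv (P.slopeOf δ y) r) r := by
    intro r hr
    obtain ⟨-, d, hd, -⟩ := hclose r (by linarith [hr.1])
    exact hd.differentiableAt.hasDerivAt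
  refine eq_of_critical (F := P.slopeOf δ y) (F' := deriv (P.slopeOf δ y)) (by linarith : 0 < ρ₁)
    hLpos.le hderiv ?_ ?_ hz1 hx1 hz2 hx2
  · intro r hr
    have hr2 : 2 * P.M < r := by linarith [hr.1]
    have hr0 : 0 < r := by linarith
    have h1 := (abs_le.1 (hclose r hr2).1).2
    have h2 : r * (P.M / (r * (r - 2 * P.M))) ≤ 1 / 4 := by
      rw [← mul_div_assoc, mul_div_mul_left _ _ hr0.ne', div_le_iff₀ (by linarith)]
      linarith [hr.1]
    have h4 := mul_le_mul_of_nonneg_left h1 hr0.le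
    have h5 : r * ε ≤ R * ε := mul_le_mul_of_nonneg_right hr.2 hε0.le
    linarith
  · intro r hr
    have hr2 : 2 * P.M < r := by linarith [hr.1]
    have hr0 : 0 < r := by linarith
    obtain ⟨h1, d, hd, h2⟩ := hclose r hr2
    rw [hd.deriv]
    have h3 := hout r hr
    set F₀ := P.M / (r * (r - 2 * P.M)) with hF₀
    set F₀' := -(P.M * (2 * r - 2 * P.M)) / (r * (r - 2 * P.M)) ^ 2
    set F := P.slopeOf δ y r
    have hF₀0 : 0 ≤ F₀ := div_nonneg hM.le (mul_nonneg hr0.le (by linarith))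
    have hF₀1 : F₀ ≤ 1 / (24 * P.M) := by
      have h6 : 6 * P.M ≤ r := by linarith [hr.1]
      rw [hF₀, div_le_div_iff₀ (mul_pos hr0 (by linarith)) (by positivity)]
      nlinarith
    have hsum : |F + F₀| ≤ 1 / (12 * P.M) + 1 := by
      have h7 : 1 / (12 * P.M) = 1 / (24 * P.M) + 1 / (24 * P.M) := by field_simp; norm_num
      have h8 := abs_le.1 h1
      rw [h7, abs_le]
      constructor <;> linarith
    have t1 : -(3 * ε) ≤ 3 * (F - F₀) := by linarith [(abs_le.1 h1).1]
    have t2 : -(R * ε) ≤ r * (d - F₀') := by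
      have := mul_le_mul_of_nonneg_left (abs_le.1 h2).1 hr0.le
      have h5 : r * ε ≤ R * ε := mul_le_mul_of_nonneg_right hr.2 hε0.le
      linarith
    have t3 : 2 * r * ((F - F₀) * (F + F₀)) ≤ 2 * R * (ε * (1 / (12 * P.M) + 1)) := by
      have h7 : (F - F₀) * (F + F₀) ≤ ε * (1 / (12 * P.M) + 1) := by
        refine (le_abs_self _).trans ?_
        rw [abs_mul]
        exact mul_le_mul h1 hsum (abs_nonneg _) hε0.le
      have h8 : 0 ≤ ε * (1 / (12 * P.M) + 1) := by positivity
      have h9 := mul_le_mul_of_nonneg_left h7 hr0.le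
      have h10 := mul_le_mul_of_nonneg_right hr.2 h8
      linarith
    have e5 : ε * D = 3 * ε + R * ε + 2 * R * (ε * (1 / (12 * P.M) + 1)) := by rw [hD]; ring
    linarith [e5]

/-! ### Uniform convergence -/

/-- Uniform convergence along every family of shells follows from an estimate valid for all shells
with small `δ`. -/
theorem tendstoUniformlyOn_of_forall {A : ℝ → (ℝ → ℝ) → ℝ → ℝ} {B : ℝ → ℝ}
    (h : ∀ ε > 0, ∃ δ₁ > 0, ∀ δ, 0 < δ → δ ≤ δ₁ → ∀ y, P.IsShell δ y → ∀ r, 2 * P.M < r →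
      |A δ y r - B r| ≤ ε) {y : ℝ → ℝ → ℝ} (hy : ∀ᶠ δ in 𝓝[>] (0 : ℝ), P.IsShell δ (y δ)) :
    TendstoUniformlyOn (fun δ => A δ (y δ)) B (𝓝[>] 0) (Ioi (2 * P.M)) := by
  rw [Metric.tendstoUniformlyOn_iff]
  intro ε hε
  obtain ⟨δ₁, hδ₁, h⟩ := h (ε / 2) (by linarith)
  filter_upwards [hy, Ioc_mem_nhdsGT hδ₁] with δ h1 h2 r hr
  rw [dist_comm, Real.dist_eq]
  exact (h δ h2.1 h2.2 _ h1 r hr).trans_lt (by linarith)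

theorem tendstoUniformlyOn_of_le_mul {A : ℝ → (ℝ → ℝ) → ℝ → ℝ} {B : ℝ → ℝ} {C δ₁ : ℝ}
    (hC : 0 ≤ C) (hδ₁ : 0 < δ₁)
    (h : ∀ δ, 0 < δ → δ ≤ δ₁ → ∀ y, P.IsShell δ y → ∀ r, 2 * P.M < r → |A δ y r - B r| ≤ C * δ)
    {y : ℝ → ℝ → ℝ} (hy : ∀ᶠ δ in 𝓝[>] (0 : ℝ), P.IsShell δ (y δ)) :
    TendstoUniformlyOn (fun δ => A δ (y δ)) B (𝓝[>] 0) (Ioi (2 * P.M)) := by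
  refine tendstoUniformlyOn_of_forall (fun ε hε => ?_) hy
  refine ⟨min δ₁ (ε / (C + 1)), by positivity, fun δ hδ0 hδ y hy r hr => ?_⟩
  refine (h δ hδ0 (hδ.trans (min_le_left _ _)) y hy r hr).trans ?_
  have := hδ.trans (min_le_right _ _)
  rw [le_div_iff₀ (by positivity)] at this
  linarith

theorem tendsto_of_le_mul {A : ℝ → (ℝ → ℝ) → ℝ} {b C δ₁ : ℝ} (hδ₁ : 0 < δ₁)
    (h : ∀ δ, 0 < δ → δ ≤ δ₁ → ∀ y, P.IsShell δ y → |A δ y - b| ≤ C * δ)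
    {y : ℝ → ℝ → ℝ} (hy : ∀ᶠ δ in 𝓝[>] (0 : ℝ), P.IsShell δ (y δ)) :
    Tendsto (fun δ => A δ (y δ)) (𝓝[>] 0) (𝓝 b) := by
  rw [tendsto_iff_dist_tendsto_zero]
  have h0 : Tendsto (fun δ : ℝ => C * δ) (𝓝[>] 0) (𝓝 0) := by
    have : Tendsto (fun δ : ℝ => C * δ) (𝓝 0) (𝓝 (C * 0)) := (continuous_const_mul C).tendsto 0
    rw [mul_zero] at this
    exact this.mono_left nhdsWithin_le_nhds
  refine squeeze_zero' (Eventually.of_forall fun _ => dist_nonneg) ?_ h0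
  filter_upwards [hy, Ioc_mem_nhdsGT hδ₁] with δ h1 h2
  exact h δ h2.1 h2.2 _ h1

/-- On `[4M, ∞[` the argument of the logarithm stays above `1 / 4`, so `λ` depends Lipschitz
continuously on the local mass. -/
theorem IsShell.abs_lambda_sub_le (hP : P.Admissible) (hδ : 0 ≤ δ) (h : P.IsShell δ y)
    (hr : 2 * P.M < r) (hm : P.localMass δ y r ≤ P.M / 2) :
    |P.lambda δ y r - lambdaSS P.M r| ≤ 1 / P.M * |P.localMass δ y r| := by
  have hM := hP.M_pos
  have hr0 : 0 < r := by linarith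
  rcases le_total r (4 * P.M) with h4 | h4
  · rw [lambda, lambdaSS, h.vacuumInside.localMass_eq_zero hr h4, add_zero,
      show 2 / r * P.M = 2 * P.M / r by ring, sub_self, abs_zero]
    positivity
  have hm0 := hP.localMass_nonneg h.vacuumInside hδ hr
  set m := P.localMass δ y r with hmdef
  set a := 1 - 2 / r * (P.M + m) with ha
  set b := 1 - 2 * P.M / r with hb
  have hba : b - a = 2 * m / r := by rw [ha, hb]; ring
  have ha4 : 1 / 4 ≤ a := by
    have : 2 / r * (P.M + m) ≤ 3 / 4 := by
      rw [div_mul_eq_mul_div, div_le_iff₀ hr0]; linarith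
    linarith
  have hab : a ≤ b := by
    have : 0 ≤ 2 * m / r := by positivity
    linarith
  have ha0 : 0 < a := by linarith
  have hl1 : Real.log a ≤ Real.log b := Real.log_le_log ha0 hab
  have hl2 : Real.log b - Real.log a ≤ 2 * m / P.M := by
    rw [← Real.log_div (by linarith) ha0.ne']
    have h1 := Real.log_le_sub_one_of_pos (div_pos (ha0.trans_le hab) ha0)
    have h2 : b / a - 1 = (b - a) / a := by field_simp
    have h3 : (b - a) / a ≤ 2 * m / P.M := by
      rw [div_le_iff₀ ha0, hba, div_mul_eq_mul_div, div_le_div_iff₀ hr0 hM]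
      have : P.M ≤ a * r := by nlinarith
      nlinarith
    linarith
  rw [lambda, lambdaSS, ← hmdef, ← ha, ← hb, abs_of_nonneg hm0, abs_le]
  have e : 2 * m / P.M = 2 * (1 / P.M * m) := by ring
  rw [e] at hl2
  constructor <;> linarith

theorem Admissible.tendstoUniformlyOn_mu (hP : P.Admissible) {y : ℝ → ℝ → ℝ}
    (hy : ∀ᶠ δ in 𝓝[>] (0 : ℝ), P.IsShell δ (y δ)) {k : ℕ} (hk : k ≤ 2) :
    TendstoUniformlyOn (fun δ => iteratedDeriv k (mu (y δ))) (iteratedDeriv k (muSS P.M))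
      (𝓝[>] 0) (Ioi (2 * P.M)) := by
  have hM := hP.M_pos
  have h0 : ∀ r, 2 * P.M < r → deriv (muSS P.M) r = P.M / (r * (r - 2 * P.M)) :=
    fun r hr => (hasDerivAt_muSS hM hr).deriv
  interval_cases k
  · obtain ⟨δ₁, hδ₁, C, hC, h⟩ := hP.exists_shell_estimates
    refine tendstoUniformlyOn_of_le_mul (A := fun _ y => iteratedDeriv 0 (mu y))
      (by positivity : 0 ≤ 2 * C) hδ₁ (fun δ hδ0 hδ y hy r hr => ?_) hy
    obtain ⟨h1, -, h2⟩ := h δ hδ0 hδ y hy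
    have h3 := (h2 r hr).2.2.2.2.1
    rw [iteratedDeriv_zero, iteratedDeriv_zero, mu]
    have e : Real.log (cutoffEnergy y) - y r - muSS P.M r =
        (Real.log (cutoffEnergy y) - Real.log P.E0) - (y r - P.ySS r) := by rw [ySS]; ring
    rw [e]
    exact (abs_sub _ _).trans (by linarith)
  · refine tendstoUniformlyOn_of_forall (A := fun _ y => iteratedDeriv 1 (mu y))
      (fun ε hε => ?_) hy
    obtain ⟨δ₁, hδ₁, h⟩ := hP.exists_slopeOf_close hε
    refine ⟨δ₁, hδ₁, fun δ hδ0 hδ y hy r hr => ?_⟩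
    rw [iteratedDeriv_one, iteratedDeriv_one, h0 r hr, (hy.hasDerivAt_mu hP hr).deriv]
    exact (h δ hδ0 hδ y hy r hr).1
  · refine tendstoUniformlyOn_of_forall (A := fun _ y => iteratedDeriv 2 (mu y))
      (fun ε hε => ?_) hy
    obtain ⟨δ₁, hδ₁, h⟩ := hP.exists_slopeOf_close hε
    refine ⟨δ₁, hδ₁, fun δ hδ0 hδ y hy r hr => ?_⟩
    obtain ⟨-, d, hd, hd'⟩ := h δ hδ0 hδ y hy r hr
    have e1 : deriv (mu y) =ᶠ[𝓝 r] P.slopeOf δ y := by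
      filter_upwards [Ioi_mem_nhds hr] with x hx
      exact (hy.hasDerivAt_mu hP hx).deriv
    have e2 : deriv (muSS P.M) =ᶠ[𝓝 r] fun r => P.M / (r * (r - 2 * P.M)) := by
      filter_upwards [Ioi_mem_nhds hr] with x hx
      exact h0 x hx
    simp only [iteratedDeriv_succ, iteratedDeriv_zero]
    rw [e1.deriv_eq, e2.deriv_eq, hd.deriv, (hP.hasDerivAt_slopeSS hr).deriv]
    exact hd'

end ShellParams

end EinsteinVlasov

end

theorem mainTheorem4 (P : EinsteinVlasov.ShellParams) (hP : P.Admissible) :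
    -- for small `δ` the shell exists, is unique, and its mass, cut-off energy and `μ''` make sense
    (∃ δ₁ > 0, ∀ δ, 0 < δ → δ ≤ δ₁ → ∃ y : ℝ → ℝ, P.IsShell δ y ∧
      (∀ z : ℝ → ℝ, P.IsShell δ z → EqOn z y (Ioi (2 * P.M))) ∧
      Tendsto (P.localMass δ y) atTop (𝓝 (P.totalMass δ y)) ∧
      Tendsto y atTop (𝓝 (Real.log (EinsteinVlasov.cutoffEnergy y))) ∧
      ContDiffOn ℝ 2 (EinsteinVlasov.mu y) (Ioi (2 * P.M))) ∧
    -- the convergences as `δ → 0`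
    (∀ y : ℝ → ℝ → ℝ, (∀ᶠ δ in 𝓝[>] (0 : ℝ), P.IsShell δ (y δ)) →
      TendstoUniformlyOn (fun δ => P.rho δ (y δ)) (fun _ => 0) (𝓝[>] 0) (Ioi (2 * P.M)) ∧
      TendstoUniformlyOn (fun δ => P.pressure δ (y δ)) (fun _ => 0) (𝓝[>] 0) (Ioi (2 * P.M)) ∧
      TendstoUniformlyOn (fun δ => P.lambda δ (y δ)) (EinsteinVlasov.lambdaSS P.M) (𝓝[>] 0)
        (Ioi (2 * P.M)) ∧
      Tendsto (fun δ => P.totalMass δ (y δ)) (𝓝[>] 0) (𝓝 0) ∧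
      Tendsto (fun δ => EinsteinVlasov.cutoffEnergy (y δ)) (𝓝[>] 0) (𝓝 P.E0) ∧
      ∀ k : ℕ, k ≤ 2 →
        TendstoUniformlyOn (fun δ => iteratedDeriv k (EinsteinVlasov.mu (y δ)))
          (iteratedDeriv k (EinsteinVlasov.muSS P.M)) (𝓝[>] 0) (Ioi (2 * P.M))) ∧
    -- single-well structure of all small shells
    (∃ δ₀ > 0, ∀ δ, 0 < δ → δ ≤ δ₀ → ∀ y : ℝ → ℝ, P.IsShell δ y →
      (P.shell δ y).HasSingleWell) := by
  obtain ⟨δ₁, hδ₁, C, hC, h⟩ := hP.exists_shell_estimates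
  obtain ⟨δ₂, hδ₂, hex⟩ := hP.exists_shell
  have hM := hP.M_pos
  have hR := hP.six_mul_lt_outerRadius
  refine ⟨⟨min δ₁ δ₂, lt_min hδ₁ hδ₂, fun δ hδ0 hδ => ?_⟩, fun y hy => ?_, hP.exists_singleWell⟩
  · obtain ⟨y, hy, huniq⟩ := hex δ hδ0 (hδ.trans (min_le_right _ _))
    exact ⟨y, hy, huniq, (hy.tendsto_localMass hP hδ0.le).1,
      (h δ hδ0 (hδ.trans (min_le_left _ _)) y hy).2.1, hy.contDiffOn_mu hP⟩
  · refine ⟨?_, ?_, ?_, ?_, ?_, fun k hk => hP.tendstoUniformlyOn_mu hy hk⟩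
    · refine EinsteinVlasov.ShellParams.tendstoUniformlyOn_of_le_mul (A := P.rho) hC hδ₁
        (fun δ hδ0 hδ y hy r hr => ?_) hy
      rw [sub_zero]
      exact ((h δ hδ0 hδ y hy).2.2 r hr).1
    · refine EinsteinVlasov.ShellParams.tendstoUniformlyOn_of_le_mul (A := P.pressure) hC hδ₁
        (fun δ hδ0 hδ y hy r hr => ?_) hy
      rw [sub_zero]
      exact ((h δ hδ0 hδ y hy).2.2 r hr).2.1
    · refine EinsteinVlasov.ShellParams.tendstoUniformlyOn_of_le_mul (A := P.lambda)
        (by positivity : 0 ≤ 1 / P.M * C) hδ₁ (fun δ hδ0 hδ y hy r hr => ?_) hy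
      obtain ⟨-, -, -, h4, -, h6, -⟩ := (h δ hδ0 hδ y hy).2.2 r hr
      rw [mul_assoc]
      exact (hy.abs_lambda_sub_le hP hδ0.le hr h6).trans
        (mul_le_mul_of_nonneg_left h4 (by positivity))
    · refine EinsteinVlasov.ShellParams.tendsto_of_le_mul (A := P.totalMass) (C := C) hδ₁
        (fun δ hδ0 hδ y hy => ?_) hy
      rw [sub_zero, (hy.tendsto_localMass hP hδ0.le).2]
      exact ((h δ hδ0 hδ y hy).2.2 P.outerRadius (by linarith)).2.2.2.1
    · have h1 : Tendsto (fun δ => Real.log (EinsteinVlasov.cutoffEnergy (y δ))) (𝓝[>] 0)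
          (𝓝 (Real.log P.E0)) :=
        EinsteinVlasov.ShellParams.tendsto_of_le_mul
          (A := fun _ y => Real.log (EinsteinVlasov.cutoffEnergy y)) hδ₁
          (fun δ hδ0 hδ y hy => (h δ hδ0 hδ y hy).1) hy
      have h2 := (Real.continuous_exp.tendsto _).comp h1
      rw [Real.exp_log hP.E0_pos] at h2
      exact h2.congr fun δ => Real.exp_log (Real.exp_pos _)
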